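/- Let $R$ be a commutative ring. Differential graded (DG) $R$-modules are $\mathbf{Z}$-graded, with differentials of lower degree $-1$. Let $\mathcal{O}$ be an operad in DG $R$-modules (with symmetric group actions and a unit), such that the category of $\mathcal{O}$-algebras is a closed model category in which the fibrations are the surjections and the weak equivalences are the quasi-isomorphisms. For a graded $R$-module $V$ write $\mathcal{O}(V)$ for the free graded $\mathcal{O}$-algebra on $V$; $(\mathcal{O}(V),d)$ denotes an $\mathcal{O}$-algebra that is free on $V$ when differentials are ignored. Write $\vee$ for the coproduct of $\mathcal{O}$-algebras, and $sV$ for the suspension, $s : V_j \cong (sV)_{j+1}$. A morphism $j : A \to B$ of $\mathcal{O}$-algebras is a cell extension if, forgetting differentials, $B \cong A \vee \mathcal{O}(V)$ with $j$ the canonical inclusion, where $V$ is the union of a nested sequence of graded submodules $V(0) \subset V(1) \subset \cdots$ such that, with $V(-1) = 0$, each $V(k)/V(k-1)$ is a free graded $R$-module and $d(V(k)) \subset A \vee \mathcal{O}(V(k-1))$ for all $k \ge 0$. A cell algebra is a cell extension of the initial $\mathcal{O}$-algebra $\mathcal{O}(0)$; thus it has the form $(\mathcal{O}(V),d)$ with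 $d(V(k)) \subset \mathcal{O}(V(k-1))$. Let $A = (\mathcal{O}(V),d)$ be a cell $\mathcal{O}$-algebra, with filtration $V(k)$ of $V$. Then the fold map $\nabla : A \vee A \to A$ factors as $$A \vee A \xrightarrow{\ i\ } IA \xrightarrow{\ q\ } A,$$ where $i$ is a cell extension with generators $sV$ and filtration $(sV)(k) = s(V(k))$, and $q$ is a surjective quasi-isomorphism. Forgetting differentials, $IA = \mathcal{O}(V' \oplus V'' \oplus sV)$, where $V' = V'' = V$, and for $x \in V$ the corresponding elements $x' \in V'$ and $x'' \in V''$ of $IA$ are the images under $i$ of the two copies of $x$ in $A \vee A$. Furthermore, for all $k \ge 0$ and $x \in V(k)$ (in particular for $x \in V_k$, where $V(k) = V_k \oplus V(k-1)$ is any splitting), $$d(sx) - x' + x'' \in \mathcal{O}\bigl(V'(k-1) \oplus V''(k-1) \oplus sV(k-1)\bigr),$$ the $\mathcal{O}$-subalgebra of $IA$, ignoring differentials, generated by $V'(k-1)$, $V''(k-1)$ and $sV(k-1)$. -/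

import Mathlib

open CategoryTheory CategoryTheory.Limits

universe u

/-! ### Graded and differential graded modules -/

/-- A `ℤ`-graded `R`-module, presented by its total module together with its homogeneous
components (lower grading). -/
structure GrMod (R : Type u) [CommRing R] where
  carrier : Type u
  [addCommGroup : AddCommGroup carrier]
  [module : Module R carrier]
  /-- The submodule of elements of degree `p`. -/
  gr : ℤ → Submodule R carrier
  isInternal : DirectSum.IsInternal gr

attribute [instance] GrMod.addCommGroup GrMod.module

/-- A differential graded `R`-module: the differential lowers the degree by one. -/
structure DGMod (R : Type u) [CommRing R] extends GrMod R where
  d : carrier →ₗ[R] carrier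
  d_mem : ∀ (p : ℤ) (x : carrier), x ∈ gr p → d x ∈ gr (p - 1)
  d_d : ∀ x : carrier, d (d x) = 0

/-- A morphism of graded modules: a linear map that preserves the degree. -/
structure GrMod.Hom {R : Type u} [CommRing R] (M N : GrMod R) where
  toLin : M.carrier →ₗ[R] N.carrier
  map_mem : ∀ (p : ℤ) (x : M.carrier), x ∈ M.gr p → toLin x ∈ N.gr p

/-- The homology of the endomorphism `d` (a differential), as a module. -/
abbrev DGMod.Homology {R : Type u} [CommRing R] (M : DGMod R) : Type u :=
  LinearMap.ker M.d ⧸ (LinearMap.range M.d).submoduleOf (LinearMap.ker M.d)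

/-- The map induced in homology by a linear map which commutes with the differentials. -/
def DGMod.homologyMap {R : Type u} [CommRing R] {M N : DGMod R}
    (f : M.carrier →ₗ[R] N.carrier) (hf : ∀ x, f (M.d x) = N.d (f x)) :
    M.Homology →ₗ[R] N.Homology :=
  Submodule.mapQ _ _
    (f.restrict (p := LinearMap.ker M.d) (q := LinearMap.ker N.d)
      (fun x hx => by
        rw [LinearMap.mem_ker] at hx ⊢
        rw [← hf, hx, map_zero]))
    (by
      rintro ⟨x, hx⟩ ⟨y, hy⟩
      exact ⟨f y, by rw [← hf, hy]; rfl⟩)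

/-! ### Direct sums and suspensions of graded modules -/

/-- The direct sum of two graded modules. -/
abbrev GrMod.prod {R : Type u} [CommRing R] (M N : GrMod R) : GrMod R where
  carrier := M.carrier × N.carrier
  gr p := (M.gr p).prod (N.gr p)
  isInternal := by
    classical
    have hM := (DirectSum.isInternal_submodule_iff_iSupIndep_and_iSup_eq_top _).1 M.isInternal
    have hN := (DirectSum.isInternal_submodule_iff_iSupIndep_and_iSup_eq_top _).1 N.isInternal
    refine (DirectSum.isInternal_submodule_iff_iSupIndep_and_iSup_eq_top _).2 ⟨?_, ?_⟩
    · intro p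
      rw [Submodule.disjoint_def]
      rintro ⟨x, y⟩ ⟨hx, hy⟩ hxy
      have h1 : (⨆ j, ⨆ (_ : j ≠ p), (M.gr j).prod (N.gr j)) ≤
          (⨆ j, ⨆ (_ : j ≠ p), M.gr j).prod (⨆ j, ⨆ (_ : j ≠ p), N.gr j) := by
        refine iSup₂_le fun j hj => Submodule.prod_mono ?_ ?_
        · exact le_iSup₂ (f := fun j (_ : j ≠ p) => M.gr j) j hj
        · exact le_iSup₂ (f := fun j (_ : j ≠ p) => N.gr j) j hj
      obtain ⟨hx', hy'⟩ := h1 hxy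
      have ex : x = 0 := Submodule.disjoint_def.1 (hM.1 p) x hx hx'
      have ey : y = 0 := Submodule.disjoint_def.1 (hN.1 p) y hy hy'
      rw [ex, ey]; rfl
    · rw [eq_top_iff]
      rintro ⟨x, y⟩ -
      have hx : x ∈ (⨆ p, (M.gr p).prod (N.gr p)).comap (LinearMap.inl R _ _) := by
        have : (⨆ p, M.gr p) ≤ (⨆ p, (M.gr p).prod (N.gr p)).comap (LinearMap.inl R _ _) :=
          iSup_le fun p z hz =>
            (le_iSup (fun p => (M.gr p).prod (N.gr p)) p) ⟨hz, (N.gr p).zero_mem⟩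
        exact this (hM.2 ▸ Submodule.mem_top)
      have hy : y ∈ (⨆ p, (M.gr p).prod (N.gr p)).comap (LinearMap.inr R _ _) := by
        have : (⨆ p, N.gr p) ≤ (⨆ p, (M.gr p).prod (N.gr p)).comap (LinearMap.inr R _ _) :=
          iSup_le fun p z hz =>
            (le_iSup (fun p => (M.gr p).prod (N.gr p)) p) ⟨(M.gr p).zero_mem, hz⟩
        exact this (hN.2 ▸ Submodule.mem_top)
      have := Submodule.add_mem _ (Submodule.mem_comap.1 hx) (Submodule.mem_comap.1 hy)
      simpa using this

/-- The suspension `sM` of a graded module: `(sM)_p = M_{p-1}`. -/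
abbrev GrMod.susp {R : Type u} [CommRing R] (M : GrMod R) : GrMod R where
  carrier := M.carrier
  gr p := M.gr (p - 1)
  isInternal := by
    classical
    have hM := (DirectSum.isInternal_submodule_iff_iSupIndep_and_iSup_eq_top _).1 M.isInternal
    refine (DirectSum.isInternal_submodule_iff_iSupIndep_and_iSup_eq_top _).2 ⟨?_, ?_⟩
    · exact hM.1.comp (sub_left_injective (b := (1 : ℤ)))
    · rw [← hM.2]
      exact (Equiv.subRight (1 : ℤ)).iSup_comp (g := M.gr)

/-- The suspension isomorphism `s : M → sM`, of degree `+1`. -/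
def GrMod.s {R : Type u} [CommRing R] (M : GrMod R) : M.carrier ≃ₗ[R] M.susp.carrier :=
  LinearEquiv.refl R M.carrier

/-- The morphism out of a direct sum given by a pair of morphisms. -/
def GrMod.Hom.coprod {R : Type u} [CommRing R] {M N P : GrMod R} (f : M.Hom P) (g : N.Hom P) :
    (M.prod N).Hom P where
  toLin := f.toLin.coprod g.toLin
  map_mem p x hx := (P.gr p).add_mem (f.map_mem p x.1 hx.1) (g.map_mem p x.2 hx.2)

/-- Composition of morphisms of graded modules. -/
def GrMod.Hom.comp {R : Type u} [CommRing R] {M N P : GrMod R} (g : N.Hom P) (f : M.Hom N) :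
    M.Hom P where
  toLin := g.toLin.comp f.toLin
  map_mem p x hx := g.map_mem p _ (f.map_mem p x hx)

/-! ### Operads -/

/-- The lexicographic identification of the disjoint union of blocks of sizes `j 0, j 1, …`
with `{0, …, m - 1}`, where `m` is the sum of the sizes. -/
def blockEquiv {n m : ℕ} (j : Fin n → ℕ) (h : ∑ s, j s = m) : (Σ s, Fin (j s)) ≃ Fin m :=
  finSigmaFinEquiv.trans (finCongr h)

/-- The block permutation `σ(j_1, …, j_n)`: it moves the `s`-th block (of size `j s`) to the
`σ s`-th place, without changing the order inside the blocks. -/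
def blockPerm {n m : ℕ} (σ : Equiv.Perm (Fin n)) (j : Fin n → ℕ) (h : ∑ s, j s = m)
    (h' : ∑ s, j (σ.symm s) = m) : Equiv.Perm (Fin m) :=
  (blockEquiv j h).symm.trans
    ((Equiv.sigmaCongrLeft' (β := fun s => Fin (j s)) σ).trans
      (blockEquiv (fun s => j (σ.symm s)) h'))

/-- The direct sum `τ_1 ⊕ ⋯ ⊕ τ_n` of permutations, acting inside the blocks. -/
def sumPerm {n m : ℕ} (j : Fin n → ℕ) (h : ∑ s, j s = m) (τ : ∀ s, Equiv.Perm (Fin (j s))) :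
    Equiv.Perm (Fin m) :=
  (blockEquiv j h).symm.trans ((Equiv.sigmaCongrRight τ).trans (blockEquiv j h))

/-- The Koszul sign of the rearrangement of `x_1 ⊗ ⋯ ⊗ x_n` (of degrees `q`) that moves the factor
`x_i` to the place `σ i`. -/
def permSign {n : ℕ} (σ : Equiv.Perm (Fin n)) (q : Fin n → ℤ) : ℤˣ :=
  ∏ i, ∏ i' ∈ Finset.Ioi i, if σ i' < σ i then Int.negOnePow (q i * q i') else 1

/-- The Koszul sign of the rearrangement
`x_1 ⊗ ⋯ ⊗ x_n ⊗ Y_1 ⊗ ⋯ ⊗ Y_n → x_1 ⊗ Y_1 ⊗ ⋯ ⊗ x_n ⊗ Y_n`, where `x_s` has degree `a s` and `Y_s`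
has degree `b s`. -/
def shuffleSign {n : ℕ} (a b : Fin n → ℤ) : ℤˣ :=
  Int.negOnePow (∑ s, ∑ s' ∈ Finset.Iio s, a s * b s')

/-- A differential graded operad over `R` (with symmetric group actions, a unit and composition
products). The target arity of a composition product is an argument `m` together with the proof
that it is the sum `j_1 + ⋯ + j_n`; for `n = 0` the composition product is the identity of the
arity zero component, by `comp_one`. -/
structure Operad (R : Type u) [CommRing R] where
  obj : ℕ → DGMod R
  /-- The unit, the image of `1` under `R → O(1)`. -/
  one : (obj 1).carrier
  one_mem : one ∈ (obj 1).gr 0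
  d_one : (obj 1).d one = 0
  /-- The right action of the symmetric groups. -/
  perm : ∀ {n : ℕ}, Equiv.Perm (Fin n) → (obj n).carrier →ₗ[R] (obj n).carrier
  perm_mem : ∀ {n : ℕ} (σ : Equiv.Perm (Fin n)) (p : ℤ) (o : (obj n).carrier),
    o ∈ (obj n).gr p → perm σ o ∈ (obj n).gr p
  d_perm : ∀ {n : ℕ} (σ : Equiv.Perm (Fin n)) (o : (obj n).carrier),
    (obj n).d (perm σ o) = perm σ ((obj n).d o)
  perm_one : ∀ {n : ℕ} (o : (obj n).carrier), perm 1 o = o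
  perm_mul : ∀ {n : ℕ} (σ τ : Equiv.Perm (Fin n)) (o : (obj n).carrier),
    perm (σ * τ) o = perm τ (perm σ o)
  /-- The composition products `O(n) ⊗ O(j_1) ⊗ ⋯ ⊗ O(j_n) → O(j_1 + ⋯ + j_n)`. -/
  comp : ∀ {n m : ℕ} (j : Fin n → ℕ), ∑ s, j s = m → (obj n).carrier →ₗ[R]
    MultilinearMap R (fun s => (obj (j s)).carrier) (obj m).carrier
  comp_mem : ∀ {n m : ℕ} (j : Fin n → ℕ) (h : ∑ s, j s = m) (p : ℤ) (a : Fin n → ℤ)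
    (o : (obj n).carrier) (x : ∀ s, (obj (j s)).carrier), o ∈ (obj n).gr p →
    (∀ s, x s ∈ (obj (j s)).gr (a s)) → comp j h o x ∈ (obj m).gr (p + ∑ s, a s)
  d_comp : ∀ {n m : ℕ} (j : Fin n → ℕ) (h : ∑ s, j s = m) (p : ℤ) (a : Fin n → ℤ)
    (o : (obj n).carrier) (x : ∀ s, (obj (j s)).carrier), o ∈ (obj n).gr p →
    (∀ s, x s ∈ (obj (j s)).gr (a s)) →
    (obj m).d (comp j h o x) = comp j h ((obj n).d o) x +
      ∑ s, Int.negOnePow (p + ∑ s' ∈ Finset.Iio s, a s') •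
        comp j h o (Function.update x s ((obj (j s)).d (x s)))
  one_comp : ∀ {n : ℕ} (h : ∑ _s : Fin 1, n = n) (o : (obj n).carrier),
    comp (fun _ : Fin 1 => n) h one (fun _ => o) = o
  comp_one : ∀ {n : ℕ} (h : ∑ _s : Fin n, 1 = n) (o : (obj n).carrier),
    comp (fun _ : Fin n => 1) h o (fun _ => one) = o
  /-- Associativity: `γ(γ(o; x_1, …, x_n); y_1, …, y_m) = ± γ(o; γ(x_1; Y_1), …, γ(x_n; Y_n))`, where
  `Y_s` is the `s`-th block of the `y`s. -/
  comp_assoc : ∀ {n m l : ℕ} (j : Fin n → ℕ) (h : ∑ s, j s = m) (k : Fin m → ℕ)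
    (hk : ∑ t, k t = l) (hk' : ∑ s, ∑ i, k (blockEquiv j h ⟨s, i⟩) = l)
    (o : (obj n).carrier) (x : ∀ s, (obj (j s)).carrier) (y : ∀ t, (obj (k t)).carrier)
    (a : Fin n → ℤ) (b : Fin m → ℤ), (∀ s, x s ∈ (obj (j s)).gr (a s)) →
    (∀ t, y t ∈ (obj (k t)).gr (b t)) →
    comp k hk (comp j h o x) y =
      shuffleSign a (fun s => ∑ i, b (blockEquiv j h ⟨s, i⟩)) •
        comp (fun s => ∑ i, k (blockEquiv j h ⟨s, i⟩)) hk' o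
          (fun s => comp (fun i => k (blockEquiv j h ⟨s, i⟩)) rfl (x s)
            (fun i => y (blockEquiv j h ⟨s, i⟩)))
  /-- Equivariance: `γ(oσ; x_1, …, x_n) = ± γ(o; x_{σ⁻¹(1)}, …, x_{σ⁻¹(n)}) σ(j_1, …, j_n)`. -/
  comp_perm_left : ∀ {n m : ℕ} (σ : Equiv.Perm (Fin n)) (j : Fin n → ℕ) (h : ∑ s, j s = m)
    (h' : ∑ s, j (σ.symm s) = m) (o : (obj n).carrier) (x : ∀ s, (obj (j s)).carrier)
    (a : Fin n → ℤ), (∀ s, x s ∈ (obj (j s)).gr (a s)) →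
    comp j h (perm σ o) x =
      permSign σ a • perm (blockPerm σ j h h')
        (comp (fun s => j (σ.symm s)) h' o (fun s => x (σ.symm s)))
  /-- Equivariance: `γ(o; x_1τ_1, …, x_nτ_n) = γ(o; x_1, …, x_n) (τ_1 ⊕ ⋯ ⊕ τ_n)`. -/
  comp_perm_right : ∀ {n m : ℕ} (j : Fin n → ℕ) (h : ∑ s, j s = m)
    (τ : ∀ s, Equiv.Perm (Fin (j s))) (o : (obj n).carrier) (x : ∀ s, (obj (j s)).carrier),
    comp j h o (fun s => perm (τ s) (x s)) = perm (sumPerm j h τ) (comp j h o x)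

/-! ### Algebras over an operad -/

/-- A graded `O`-algebra: an `O`-algebra with the differentials (of `O` and of the algebra)
forgotten. -/
structure GrAlg {R : Type u} [CommRing R] (O : Operad R) extends GrMod R where
  /-- The structure maps `O(n) ⊗ A^{⊗ n} → A`. -/
  act : ∀ {n : ℕ}, (O.obj n).carrier →ₗ[R]
    MultilinearMap R (fun _ : Fin n => carrier) carrier
  act_mem : ∀ {n : ℕ} (p : ℤ) (q : Fin n → ℤ) (o : (O.obj n).carrier) (x : Fin n → carrier),
    o ∈ (O.obj n).gr p → (∀ i, x i ∈ gr (q i)) → act o x ∈ gr (p + ∑ i, q i)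
  act_one : ∀ x : carrier, act O.one (fun _ => x) = x
  act_comp : ∀ {n m : ℕ} (j : Fin n → ℕ) (h : ∑ s, j s = m) (o : (O.obj n).carrier)
    (y : ∀ s, (O.obj (j s)).carrier) (x : Fin m → carrier) (a : Fin n → ℤ) (b : Fin m → ℤ),
    (∀ s, y s ∈ (O.obj (j s)).gr (a s)) → (∀ t, x t ∈ gr (b t)) →
    act (O.comp j h o y) x =
      shuffleSign a (fun s => ∑ i, b (blockEquiv j h ⟨s, i⟩)) •
        act o (fun s => act (y s) (fun i => x (blockEquiv j h ⟨s, i⟩)))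
  act_perm : ∀ {n : ℕ} (σ : Equiv.Perm (Fin n)) (o : (O.obj n).carrier) (x : Fin n → carrier)
    (q : Fin n → ℤ), (∀ i, x i ∈ gr (q i)) →
    act (O.perm σ o) x = permSign σ q • act o (fun i => x (σ.symm i))

/-- An `O`-algebra: a differential graded module with structure maps `O(n) ⊗ A^{⊗ n} → A` that are
chain maps and are associative, unital and equivariant. -/
structure OAlg {R : Type u} [CommRing R] (O : Operad R) extends GrAlg O, DGMod R where
  d_act : ∀ {n : ℕ} (p : ℤ) (q : Fin n → ℤ) (o : (O.obj n).carrier) (x : Fin n → carrier),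
    o ∈ (O.obj n).gr p → (∀ i, x i ∈ gr (q i)) →
    d (act o x) = act ((O.obj n).d o) x +
      ∑ i, Int.negOnePow (p + ∑ i' ∈ Finset.Iio i, q i') •
        act o (Function.update x i (d (x i)))

/-- A morphism of graded `O`-algebras. -/
structure GrAlg.Hom {R : Type u} [CommRing R] {O : Operad R} (A B : GrAlg O) extends
    toGrModHom : GrMod.Hom A.toGrMod B.toGrMod where
  map_act : ∀ {n : ℕ} (o : (O.obj n).carrier) (x : Fin n → A.carrier),
    toLin (A.act o x) = B.act o (fun i => toLin (x i))

/-- A morphism of `O`-algebras. -/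
structure OAlg.Hom {R : Type u} [CommRing R] {O : Operad R} (A B : OAlg O) extends
    toGrAlgHom : GrAlg.Hom A.toGrAlg B.toGrAlg where
  map_d : ∀ x : A.carrier, toLin (A.d x) = B.d (toLin x)

/-- The category of `O`-algebras. -/
instance OAlg.category {R : Type u} [CommRing R] (O : Operad R) : Category.{u} (OAlg O) where
  Hom A B := OAlg.Hom A B
  id A :=
    { toLin := LinearMap.id
      map_mem := fun _ _ hx => hx
      map_act := fun _ _ => rfl
      map_d := fun _ => rfl }
  comp {A B C} f g :=
    { toLin := g.toLin.comp f.toLin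
      map_mem := fun p x hx => g.map_mem p _ (f.map_mem p x hx)
      map_act := fun o x => by
        rw [LinearMap.comp_apply, f.map_act, g.map_act]; rfl
      map_d := fun x => by
        rw [LinearMap.comp_apply, f.map_d, g.map_d]; rfl }

/-- The underlying linear map of a morphism of `O`-algebras. -/
abbrev OAlg.lin {R : Type u} [CommRing R] {O : Operad R} {A B : OAlg O} (f : A ⟶ B) :
    A.carrier →ₗ[R] B.carrier :=
  (OAlg.Hom.toGrAlgHom f).toLin

/-- The underlying morphism of graded `O`-algebras. -/
abbrev OAlg.grHom {R : Type u} [CommRing R] {O : Operad R} {A B : OAlg O} (f : A ⟶ B) :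
    GrAlg.Hom A.toGrAlg B.toGrAlg :=
  OAlg.Hom.toGrAlgHom f

/-- A morphism of `O`-algebras is a quasi-isomorphism if it induces an isomorphism in homology. -/
def OAlg.IsQuasiIso {R : Type u} [CommRing R] {O : Operad R} {A B : OAlg O} (f : A ⟶ B) : Prop :=
  Function.Bijective
    (DGMod.homologyMap (M := A.toDGMod) (N := B.toDGMod) (OAlg.lin f) (OAlg.Hom.map_d f))

/-- The `O`-algebras form a closed model category in which the fibrations are the surjections and
the weak equivalences are the quasi-isomorphisms. -/
def Operad.HasSurjQuasiIsoModel {R : Type u} [CommRing R] (O : Operad R) : Prop :=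
  ∃ _ : HomotopicalAlgebra.ModelCategory (OAlg O),
    (∀ {A B : OAlg O} (f : A ⟶ B),
      HomotopicalAlgebra.Fibration f ↔ Function.Surjective (OAlg.lin f)) ∧
    (∀ {A B : OAlg O} (f : A ⟶ B),
      HomotopicalAlgebra.WeakEquivalence f ↔ OAlg.IsQuasiIso f)

/-! ### Free algebras and cell extensions -/

/-- The (graded) `O`-subalgebra generated by a set. -/
def GrAlg.adjoin {R : Type u} [CommRing R] {O : Operad R} (A : GrAlg O) (S : Set A.carrier) :
    Submodule R A.carrier :=
  sInf {T | S ⊆ T ∧ ∀ (n : ℕ) (o : (O.obj n).carrier) (x : Fin n → A.carrier),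
    (∀ i, x i ∈ T) → A.act o x ∈ T}

/-- `ι : V → B` exhibits `B` as the free graded `O`-algebra `O(V)`. -/
def GrAlg.IsFree {R : Type u} [CommRing R] {O : Operad R} {B : GrAlg O} {V : GrMod R}
    (ι : V.Hom B.toGrMod) : Prop :=
  ∀ (C : GrAlg O) (g : V.Hom C.toGrMod),
    ∃! φ : GrAlg.Hom B C, ∀ v, φ.toLin (ι.toLin v) = g.toLin v

/-- `j : A → B` and `ι : V → B` exhibit `B` as the coproduct `A ∨ O(V)` of graded `O`-algebras, with
`j` the canonical inclusion. -/
def GrAlg.IsFreeExtension {R : Type u} [CommRing R] {O : Operad R} {A B : GrAlg O} {V : GrMod R}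
    (j : GrAlg.Hom A B) (ι : V.Hom B.toGrMod) : Prop :=
  ∀ (C : GrAlg O) (f : GrAlg.Hom A C) (g : V.Hom C.toGrMod),
    ∃! φ : GrAlg.Hom B C,
      (∀ x, φ.toLin (j.toLin x) = f.toLin x) ∧ ∀ v, φ.toLin (ι.toLin v) = g.toLin v

/-- The stage `V(k-1)` of a filtration `V(0) ⊂ V(1) ⊂ ⋯`, with `V(-1) = 0`. -/
def prevStage {R : Type u} [CommRing R] {V : GrMod R} (F : ℕ → Submodule R V.carrier) :
    ℕ → Submodule R V.carrier
  | 0 => ⊥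
  | k + 1 => F k

/-- `V` is the union of the nested sequence of graded submodules `V(k) = F k`, such that `V(0)` and
all the quotients `V(k)/V(k-1)` are free (graded) `R`-modules. -/
structure IsCellFiltration {R : Type u} [CommRing R] (V : GrMod R)
    (F : ℕ → Submodule R V.carrier) : Prop where
  graded : ∀ k, F k = ⨆ p, F k ⊓ V.gr p
  mono : Monotone F
  exhaustive : ∀ v, ∃ k, v ∈ F k
  free : ∀ (k : ℕ) (p : ℤ), Module.Free R
    (↥(F k ⊓ V.gr p) ⧸ (prevStage F k ⊓ V.gr p).submoduleOf (F k ⊓ V.gr p))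

/-- `A = (O(V), d)` is a cell `O`-algebra with generators `ι : V → A` and filtration `F` of `V`. This
is a cell extension of the initial `O`-algebra `O(0)`. -/
structure OAlg.IsCellAlgebra {R : Type u} [CommRing R] {O : Operad R} (A : OAlg O) (V : GrMod R)
    (F : ℕ → Submodule R V.carrier) (ι : V.Hom A.toGrMod) : Prop where
  isCellFiltration : IsCellFiltration V F
  isFree : GrAlg.IsFree (B := A.toGrAlg) ι
  d_mem : ∀ (k : ℕ), ∀ v ∈ F k, A.d (ι.toLin v) ∈ A.adjoin (ι.toLin '' (prevStage F k))

/-- `j : A → B` is a cell extension, `B = (A ∨ O(V), d)`, with generators `ι : V → B` and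
filtration `F` of `V`. -/
structure OAlg.IsCellExtension {R : Type u} [CommRing R] {O : Operad R} {A B : OAlg O} (j : A ⟶ B)
    (V : GrMod R) (F : ℕ → Submodule R V.carrier) (ι : V.Hom B.toGrMod) : Prop where
  isCellFiltration : IsCellFiltration V F
  isFreeExtension : GrAlg.IsFreeExtension (OAlg.grHom j) ι
  d_mem : ∀ (k : ℕ), ∀ v ∈ F k,
    B.d (ι.toLin v) ∈ B.adjoin (Set.range (OAlg.lin j) ∪ ι.toLin '' (prevStage F k))

/-!
The underlying graded algebra of the cylinder `IA` has to be `B = O(V' ⊕ V'' ⊕ sV)`, and its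
differential has to extend those of the two copies of `A`. It is therefore determined by a
*correction term*, a map `h : V → B` of degree `0` with `d(sx) = x' - x'' - h(x)`. What is required
of `h` (`IsCylCorrection`) is that `h(V(k))` lie in the stage `B(k-1)` generated by `V'(k-1)`,
`V''(k-1)` and `sV(k-1)`, that `h` be killed by the projection `q` (`x', x'' ↦ x`, `sx ↦ 0`), so
that `q` is a chain map, and that `d(h(x)) = (dx)' - (dx)''`, so that `d² = 0` (a derivation of
degree `-1` has square zero if it has on generators, `GrAlg.IsDerivation.sq_eq_zero`).

*The projection is a quasi-isomorphism.* For any correction term, the inclusion `A → IA`, `x ↦ x'`,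
has the left lifting property with respect to surjections (`exists_cylHom_lift`): given values on
the `x'`, choose lifts `e(x)` of the values on the `sx`, which is possible as `V` is free. The
values on the `x''` have to be those of `x' - h(x) - d(sx)`, and as `h` lowers the filtration, this
determines them recursively. So the inclusion is a trivial cofibration, and its left inverse `q` is
a weak equivalence (`IsCylCorrection.isQuasiIso_q`). This is the only use of the model structure.

*Existence of the correction term.* It is constructed by induction over the levels of a homogeneous
basis of `V` adapted to the filtration (`IsCellFiltration.nonempty_cellBasis`). To avoid a tower of
algebras, everything takes place in the same `B`, with varying differentials: the differential of
`A` is replaced by the one which agrees with it on basis elements of level less than `n` and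
vanishes on the others (`truncDiff`), and `h` is zero on the others. For a basis element `x` of
level `n`, the element `(dx)' - (dx)''` is then a cycle in `B(n-1)` which is killed by `q`. As `q`
is a quasi-isomorphism for the truncated differential, the cycle is the boundary of an element
killed by `q`, and applying the retraction `cylTrunc` of `B` onto `B(n-1)` moves this element to
`B(n-1)`; this is `h(x)` (`exists_correction_basis`, `exists_isCylCorrection`).

*The graded algebra.* Free graded algebras are constructed as formal expressions modulo the axioms
(`Operad.freeAlg`). A derivation `δ` of a free algebra `B` with given values on the generators is
the second component of a morphism `x ↦ (x, δx)` to an algebra structure on `B ⊕ sB`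
(`GrAlg.IsFree.exists_derivation`). Finally, `A ∨ A → IA` is a free extension because `A ∨ A`,
which is given by its universal property among differential algebras, is generated by the two
copies of `V` (`adjoin_coprod_eq_top`).
-/

/-! ### Graded modules -/

namespace GrMod

variable {R : Type u} [CommRing R]

@[elab_as_elim]
theorem induction_on (M : GrMod R) {motive : M.carrier → Prop} (x : M.carrier)
    (mem : ∀ p, ∀ x ∈ M.gr p, motive x) (add : ∀ x y, motive x → motive y → motive (x + y)) :
    motive x := by
  have hx : x ∈ ⨆ p, M.gr p := by
    rw [((DirectSum.isInternal_submodule_iff_iSupIndep_and_iSup_eq_top _).1 M.isInternal).2]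
    exact Submodule.mem_top
  exact Submodule.iSup_induction (motive := motive) M.gr hx mem (mem 0 0 (M.gr 0).zero_mem) add

/-- The linear map on a graded module with given restrictions to the homogeneous components. -/
noncomputable def desc (M : GrMod R) {N : Type*} [AddCommGroup N] [Module R N]
    (f : ∀ p, M.gr p →ₗ[R] N) : M.carrier →ₗ[R] N :=
  (DirectSum.toModule R ℤ N f).comp
    (LinearEquiv.ofBijective (DirectSum.coeLinearMap M.gr) M.isInternal).symm.toLinearMap

theorem desc_apply (M : GrMod R) {N : Type*} [AddCommGroup N] [Module R N]
    (f : ∀ p, M.gr p →ₗ[R] N) {p : ℤ} {x : M.carrier} (hx : x ∈ M.gr p) :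
    M.desc f x = f p ⟨x, hx⟩ := by
  have : (LinearEquiv.ofBijective (DirectSum.coeLinearMap M.gr) M.isInternal).symm x =
      DirectSum.lof R ℤ (fun p => M.gr p) p ⟨x, hx⟩ := by
    rw [LinearEquiv.symm_apply_eq]
    exact (DirectSum.coeLinearMap_lof M.gr p ⟨x, hx⟩).symm
  rw [desc, LinearMap.comp_apply, LinearEquiv.coe_coe, this, DirectSum.toModule_lof]

/-- The projection of a graded module to its component of degree `p`. -/
noncomputable def proj (M : GrMod R) (p : ℤ) : M.carrier →ₗ[R] M.carrier :=
  M.desc fun r => if r = p then (M.gr r).subtype else 0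

theorem proj_of_mem (M : GrMod R) {p : ℤ} {x : M.carrier} (hx : x ∈ M.gr p) :
    M.proj p x = x := by
  simp [proj, desc_apply M _ hx]

theorem proj_of_mem_ne (M : GrMod R) {p r : ℤ} (h : r ≠ p) {x : M.carrier} (hx : x ∈ M.gr r) :
    M.proj p x = 0 := by
  simp [proj, desc_apply M _ hx, h]

theorem proj_mem (M : GrMod R) (p : ℤ) (x : M.carrier) : M.proj p x ∈ M.gr p := by
  induction x using M.induction_on with
  | mem r x hx =>
    by_cases h : r = p
    · subst h; rwa [proj_of_mem M hx]
    · rw [proj_of_mem_ne M h hx]; exact zero_mem _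
  | add x y hx hy => rw [map_add]; exact add_mem hx hy

/-- A linear map that shifts the degrees by `c` commutes with the projections. -/
theorem map_proj {M N : GrMod R} (f : M.carrier →ₗ[R] N.carrier) (c : ℤ)
    (hf : ∀ p, ∀ x ∈ M.gr p, f x ∈ N.gr (p + c)) (p : ℤ) (x : M.carrier) :
    f (M.proj p x) = N.proj (p + c) (f x) := by
  induction x using M.induction_on with
  | mem r x hx =>
    by_cases h : r = p
    · subst h; rw [proj_of_mem M hx, proj_of_mem N (hf _ _ hx)]
    · rw [proj_of_mem_ne M h hx, proj_of_mem_ne N (by omega) (hf _ _ hx), map_zero]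
  | add x y hx hy => simp only [map_add, hx, hy]

/-- The degree involution `x ↦ (-1)^p x`, for `x` of degree `p`. It absorbs the Koszul signs, so
that the Leibniz rule can be stated for elements that are not homogeneous. -/
noncomputable def sgn (M : GrMod R) : M.carrier →ₗ[R] M.carrier :=
  M.desc fun p => Int.negOnePow p • (M.gr p).subtype

theorem sgn_of_mem (M : GrMod R) {p : ℤ} {x : M.carrier} (hx : x ∈ M.gr p) :
    M.sgn x = Int.negOnePow p • x := by
  rw [sgn, desc_apply M _ hx]; rfl

theorem units_smul_mem (M : GrMod R) (u : ℤˣ) {p : ℤ} {x : M.carrier} (hx : x ∈ M.gr p) :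
    u • x ∈ M.gr p := by
  rcases Int.units_eq_one_or u with rfl | rfl
  · simpa
  · simpa [Units.smul_def] using hx

theorem sgn_mem (M : GrMod R) {p : ℤ} {x : M.carrier} (hx : x ∈ M.gr p) : M.sgn x ∈ M.gr p := by
  rw [sgn_of_mem M hx]; exact M.units_smul_mem _ hx

theorem map_units_smul {M N : Type*} [AddCommGroup M] [Module R M] [AddCommGroup N] [Module R N]
    (f : M →ₗ[R] N) (u : ℤˣ) (x : M) : f (u • x) = u • f x := by
  rw [Units.smul_def, Units.smul_def, map_zsmul]

theorem sgn_sgn (M : GrMod R) (x : M.carrier) : M.sgn (M.sgn x) = x := by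
  induction x using M.induction_on with
  | mem p x hx =>
    rw [sgn_of_mem M (M.sgn_mem hx), sgn_of_mem M hx, smul_smul, ← Int.negOnePow_add,
      Int.negOnePow_even _ (Even.add_self p), one_smul]
  | add x y hx hy => simp only [map_add, hx, hy]

theorem map_sgn {M N : GrMod R} (f : M.carrier →ₗ[R] N.carrier)
    (hf : ∀ p, ∀ x ∈ M.gr p, f x ∈ N.gr p) (x : M.carrier) : f (M.sgn x) = N.sgn (f x) := by
  induction x using M.induction_on with
  | mem p x hx => rw [sgn_of_mem M hx, sgn_of_mem N (hf p x hx), map_units_smul]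
  | add x y hx hy => simp only [map_add, hx, hy]

/-- A linear map of degree `-1` anticommutes with the degree involutions. -/
theorem map_sgn_of_degree_neg_one {M N : GrMod R} (f : M.carrier →ₗ[R] N.carrier)
    (hf : ∀ p, ∀ x ∈ M.gr p, f x ∈ N.gr (p - 1)) (x : M.carrier) :
    f (M.sgn x) = - N.sgn (f x) := by
  induction x using M.induction_on with
  | mem p x hx =>
    rw [sgn_of_mem M hx, sgn_of_mem N (hf p x hx), map_units_smul, Int.negOnePow_sub,
      Int.negOnePow_one, mul_neg, mul_one, Units.neg_smul, neg_neg]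
  | add x y hx hy => simp only [map_add, hx, hy, neg_add]

theorem multilinear_ext (M : GrMod R) {n : ℕ} {N : Type*} [AddCommGroup N] [Module R N]
    {f g : MultilinearMap R (fun _ : Fin n => M.carrier) N}
    (h : ∀ (q : Fin n → ℤ) (x : Fin n → M.carrier), (∀ i, x i ∈ M.gr (q i)) → f x = g x) :
    f = g := by
  -- the entries outside of a finite set `s` are homogeneous
  have key : ∀ (s : Finset (Fin n)) (x : Fin n → M.carrier),
      (∀ i ∉ s, ∃ q, x i ∈ M.gr q) → f x = g x := by
    intro s
    induction s using Finset.induction_on with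
    | empty =>
      intro x hx
      choose q hq using fun i => hx i (by simp)
      exact h q x hq
    | insert i s hi ih =>
      intro x hx
      have : ∀ y, f (Function.update x i y) = g (Function.update x i y) := by
        intro y
        induction y using M.induction_on with
        | mem p y hy =>
          refine ih _ fun l hl => ?_
          by_cases hli : l = i
          · subst hli; exact ⟨p, by simpa using hy⟩
          · rw [Function.update_of_ne hli]
            exact hx l (by simp [hli, hl])
        | add y z hy hz =>
          rw [MultilinearMap.map_update_add, MultilinearMap.map_update_add, hy, hz]
      simpa using this (x i)
  ext x
  exact key Finset.univ x (by simp)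

@[ext] theorem Hom.ext' {M N : GrMod R} {f g : M.Hom N} (h : ∀ x, f.toLin x = g.toLin x) :
    f = g := by
  cases f; cases g
  congr
  exact LinearMap.ext h

end GrMod

/-! ### The free graded algebra -/

namespace Operad

variable {R : Type u} [CommRing R] (O : Operad R) (V : GrMod R)

/-- Formal expressions of degree `p` in the generators `V`, the module operations and the operations
of `O` applied to homogeneous arguments. The degree `r` of an operation is an argument together with
an equation, so that no expression has to be transported along an equality of degrees. -/
inductive FreeTerm : ℤ → Type u
  | of {p : ℤ} (v : V.gr p) : FreeTerm p
  | zero (p : ℤ) : FreeTerm p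
  | add {p : ℤ} (s t : FreeTerm p) : FreeTerm p
  | smul {p : ℤ} (c : R) (t : FreeTerm p) : FreeTerm p
  | act {n : ℕ} {p : ℤ} {q : Fin n → ℤ} {r : ℤ} (h : p + ∑ i, q i = r) (o : (O.obj n).gr p)
      (x : ∀ i, FreeTerm (q i)) : FreeTerm r

variable {O V}

/-- The congruence on formal expressions generated by the axioms of a graded `O`-algebra. -/
inductive FreeRel : ∀ {p : ℤ}, O.FreeTerm V p → O.FreeTerm V p → Prop
  | refl {p : ℤ} (s : O.FreeTerm V p) : FreeRel s s
  | symm {p : ℤ} {s t : O.FreeTerm V p} : FreeRel s t → FreeRel t s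
  | trans {p : ℤ} {s t u : O.FreeTerm V p} : FreeRel s t → FreeRel t u → FreeRel s u
  | add_congr {p : ℤ} {s s' t t' : O.FreeTerm V p} :
      FreeRel s s' → FreeRel t t' → FreeRel (.add s t) (.add s' t')
  | smul_congr {p : ℤ} (c : R) {s t : O.FreeTerm V p} :
      FreeRel s t → FreeRel (.smul c s) (.smul c t)
  | act_congr {n : ℕ} {p : ℤ} {q : Fin n → ℤ} {r : ℤ} (h : p + ∑ i, q i = r)
      (o : (O.obj n).gr p) {x y : ∀ i, O.FreeTerm V (q i)} :
      (∀ i, FreeRel (x i) (y i)) → FreeRel (.act h o x) (.act h o y)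
  | add_assoc {p : ℤ} (s t u : O.FreeTerm V p) :
      FreeRel (.add (.add s t) u) (.add s (.add t u))
  | add_comm {p : ℤ} (s t : O.FreeTerm V p) : FreeRel (.add s t) (.add t s)
  | zero_add {p : ℤ} (s : O.FreeTerm V p) : FreeRel (.add (.zero p) s) s
  | neg_add {p : ℤ} (s : O.FreeTerm V p) : FreeRel (.add (.smul (-1) s) s) (.zero p)
  | smul_add {p : ℤ} (c : R) (s t : O.FreeTerm V p) :
      FreeRel (.smul c (.add s t)) (.add (.smul c s) (.smul c t))
  | add_smul {p : ℤ} (c c' : R) (s : O.FreeTerm V p) :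
      FreeRel (.smul (c + c') s) (.add (.smul c s) (.smul c' s))
  | mul_smul {p : ℤ} (c c' : R) (s : O.FreeTerm V p) :
      FreeRel (.smul (c * c') s) (.smul c (.smul c' s))
  | one_smul {p : ℤ} (s : O.FreeTerm V p) : FreeRel (.smul 1 s) s
  | of_add {p : ℤ} (v w : V.gr p) : FreeRel (.of (v + w)) (.add (.of v) (.of w))
  | of_smul {p : ℤ} (c : R) (v : V.gr p) : FreeRel (.of (c • v)) (.smul c (.of v))
  | act_add {n : ℕ} {p : ℤ} {q : Fin n → ℤ} {r : ℤ} (h : p + ∑ i, q i = r)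
      (o o' : (O.obj n).gr p) (x : ∀ i, O.FreeTerm V (q i)) :
      FreeRel (.act h (o + o') x) (.add (.act h o x) (.act h o' x))
  | act_smul {n : ℕ} {p : ℤ} {q : Fin n → ℤ} {r : ℤ} (h : p + ∑ i, q i = r) (c : R)
      (o : (O.obj n).gr p) (x : ∀ i, O.FreeTerm V (q i)) :
      FreeRel (.act h (c • o) x) (.smul c (.act h o x))
  | act_update_add {n : ℕ} {p : ℤ} {q : Fin n → ℤ} {r : ℤ} (h : p + ∑ i, q i = r)
      (o : (O.obj n).gr p) (x : ∀ i, O.FreeTerm V (q i)) (i : Fin n) (s t : O.FreeTerm V (q i)) :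
      FreeRel (.act h o (Function.update x i (.add s t)))
        (.add (.act h o (Function.update x i s)) (.act h o (Function.update x i t)))
  | act_update_smul {n : ℕ} {p : ℤ} {q : Fin n → ℤ} {r : ℤ} (h : p + ∑ i, q i = r)
      (o : (O.obj n).gr p) (x : ∀ i, O.FreeTerm V (q i)) (i : Fin n) (c : R)
      (s : O.FreeTerm V (q i)) :
      FreeRel (.act h o (Function.update x i (.smul c s)))
        (.smul c (.act h o (Function.update x i s)))
  | act_one {q : ℤ} (h : 0 + ∑ _i : Fin 1, q = q) (s : O.FreeTerm V q) :
      FreeRel (.act h ⟨O.one, O.one_mem⟩ (fun _ => s)) s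
  | act_comp {n m : ℕ} (j : Fin n → ℕ) (h : ∑ s, j s = m) {p : ℤ} {a : Fin n → ℤ}
      {b : Fin m → ℤ} {r : ℤ} (o : (O.obj n).gr p) (y : ∀ s, (O.obj (j s)).gr (a s))
      (x : ∀ t, O.FreeTerm V (b t)) (h₁ : p + ∑ s, a s + ∑ t, b t = r)
      (h₂ : p + ∑ s, (a s + ∑ i, b (blockEquiv j h ⟨s, i⟩)) = r) :
      FreeRel
        (.act h₁ ⟨O.comp j h o (fun s => y s), O.comp_mem j h p a _ _ o.2 fun s => (y s).2⟩ x)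
        (.smul ((shuffleSign a (fun s => ∑ i, b (blockEquiv j h ⟨s, i⟩)) : ℤˣ) : ℤ)
          (.act h₂ o fun s => .act rfl (y s) fun i => x (blockEquiv j h ⟨s, i⟩)))
  | act_perm {n : ℕ} (σ : Equiv.Perm (Fin n)) {p : ℤ} {q : Fin n → ℤ} {r : ℤ}
      (o : (O.obj n).gr p) (x : ∀ i, O.FreeTerm V (q i)) (h₁ : p + ∑ i, q i = r)
      (h₂ : p + ∑ i, q (σ.symm i) = r) :
      FreeRel (.act h₁ ⟨O.perm σ o, O.perm_mem σ p _ o.2⟩ x)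
        (.smul ((permSign σ q : ℤˣ) : ℤ) (.act h₂ o fun i => x (σ.symm i)))

variable (O V)

/-- The equality of formal expressions modulo the axioms of a graded `O`-algebra. -/
def freeSetoid (p : ℤ) : Setoid (O.FreeTerm V p) where
  r := FreeRel
  iseqv := ⟨.refl, .symm, .trans⟩

/-- The component of degree `p` of the free graded `O`-algebra on `V`. -/
def FreeComponent (p : ℤ) : Type u := Quotient (O.freeSetoid V p)

namespace FreeComponent

variable {O V}

/-- The class of a formal expression. -/
def mk {p : ℤ} (t : O.FreeTerm V p) : O.FreeComponent V p := Quotient.mk (O.freeSetoid V p) t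

theorem mk_eq {p : ℤ} {s t : O.FreeTerm V p} (h : FreeRel s t) : mk s = mk t :=
  Quotient.sound (s := O.freeSetoid V p) h

theorem mk_out {p : ℤ} (x : O.FreeComponent V p) :
    mk (Quotient.out (s := O.freeSetoid V p) x) = x :=
  Quotient.out_eq (s := O.freeSetoid V p) x

theorem rel_out {p : ℤ} (t : O.FreeTerm V p) :
    FreeRel (Quotient.out (s := O.freeSetoid V p) (mk t)) t :=
  Quotient.mk_out (s := O.freeSetoid V p) t

@[elab_as_elim]
theorem ind {p : ℤ} {motive : O.FreeComponent V p → Prop} (h : ∀ t, motive (mk t)) (x) :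
    motive x :=
  Quotient.ind (s := O.freeSetoid V p) h x

instance (p : ℤ) : Zero (O.FreeComponent V p) := ⟨mk (.zero p)⟩

instance (p : ℤ) : Add (O.FreeComponent V p) :=
  ⟨Quotient.map₂ (sa := O.freeSetoid V p) (sb := O.freeSetoid V p) (sc := O.freeSetoid V p)
    .add fun _ _ h _ _ h' => .add_congr h h'⟩

instance (p : ℤ) : SMul R (O.FreeComponent V p) :=
  ⟨fun c => Quotient.map (sa := O.freeSetoid V p) (sb := O.freeSetoid V p)
    (.smul c) fun _ _ h => .smul_congr c h⟩

instance (p : ℤ) : Neg (O.FreeComponent V p) := ⟨fun x => (-1 : R) • x⟩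

theorem mk_add {p : ℤ} (s t : O.FreeTerm V p) : mk (.add s t) = mk s + mk t := rfl

theorem mk_smul {p : ℤ} (c : R) (t : O.FreeTerm V p) : mk (.smul c t) = c • mk t := rfl

instance (p : ℤ) : AddCommGroup (O.FreeComponent V p) :=
  { AddGroup.ofLeftAxioms (G := O.FreeComponent V p)
      (fun x y z => ind (fun s => ind (fun t => ind (fun u => mk_eq (.add_assoc s t u)) z) y) x)
      (fun x => ind (fun s => mk_eq (.zero_add s)) x)
      (fun x => ind (fun s => mk_eq (.neg_add s)) x) with
    add_comm := fun x y => ind (fun s => ind (fun t => mk_eq (.add_comm s t)) y) x }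

instance (p : ℤ) : Module R (O.FreeComponent V p) :=
  Module.ofMinimalAxioms
    (fun c x y => ind (fun s => ind (fun t => mk_eq (.smul_add c s t)) y) x)
    (fun c c' x => ind (fun s => mk_eq (.add_smul c c' s)) x)
    (fun c c' x => ind (fun s => mk_eq (.mul_smul c c' s)) x)
    (fun x => ind (fun s => mk_eq (.one_smul s)) x)

/-- The inclusion of the generators. -/
def of (p : ℤ) : V.gr p →ₗ[R] O.FreeComponent V p where
  toFun v := mk (.of v)
  map_add' v w := mk_eq (.of_add v w)
  map_smul' c v := mk_eq (.of_smul c v)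

theorem mk_act_eq {n : ℕ} {p : ℤ} {q : Fin n → ℤ} {r : ℤ} (h : p + ∑ i, q i = r)
    (o : (O.obj n).gr p) {x y : ∀ i, O.FreeTerm V (q i)} (hxy : ∀ i, mk (x i) = mk (y i)) :
    mk (.act h o x) = mk (.act h o y) :=
  mk_eq (.act_congr h o fun i => Quotient.exact (s := O.freeSetoid V (q i)) (hxy i))

theorem mk_out_update {n : ℕ} {q : Fin n → ℤ} [D : DecidableEq (Fin n)]
    (x : ∀ i, O.FreeComponent V (q i)) (i : Fin n)
    (t : O.FreeTerm V (q i)) (l : Fin n) :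
    mk (Quotient.out (s := O.freeSetoid V (q l)) (Function.update x i (mk t) l)) =
      mk (Function.update (fun l => Quotient.out (s := O.freeSetoid V (q l)) (x l)) i t l) := by
  rw [mk_out]
  by_cases h : l = i
  · subst h; simp
  · rw [Function.update_of_ne h, Function.update_of_ne h, mk_out]

/-- The operations of `O` on the components of the free graded algebra. -/
noncomputable def act {n : ℕ} {p : ℤ} {q : Fin n → ℤ} {r : ℤ} (h : p + ∑ i, q i = r) :
    (O.obj n).gr p →ₗ[R]
      MultilinearMap R (fun i => O.FreeComponent V (q i)) (O.FreeComponent V r) where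
  toFun o :=
    { toFun := fun x => mk (.act h o fun i => Quotient.out (s := O.freeSetoid V (q i)) (x i))
      map_update_add' := fun {D} x i y z => by
        obtain rfl : D = instDecidableEqFin n := Subsingleton.elim _ _
        induction y using ind with | _ s
        induction z using ind with | _ t
        rw [← mk_add, mk_act_eq h o (mk_out_update x i _), mk_act_eq h o (mk_out_update x i _),
          mk_act_eq h o (mk_out_update x i _)]
        exact mk_eq (.act_update_add h o _ i s t)
      map_update_smul' := fun {D} x i c y => by
        obtain rfl : D = instDecidableEqFin n := Subsingleton.elim _ _
        induction y using ind with | _ s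
        rw [← mk_smul, mk_act_eq h o (mk_out_update x i _), mk_act_eq h o (mk_out_update x i _)]
        exact mk_eq (.act_update_smul h o _ i c s) }
  map_add' o o' := by ext x; exact mk_eq (.act_add h o o' _)
  map_smul' c o := by ext x; exact mk_eq (.act_smul h c o _)

theorem act_mk {n : ℕ} {p : ℤ} {q : Fin n → ℤ} {r : ℤ} (h : p + ∑ i, q i = r)
    (o : (O.obj n).gr p) (x : ∀ i, O.FreeTerm V (q i)) :
    act h o (fun i => mk (x i)) = mk (.act h o x) :=
  mk_eq (.act_congr h o fun i => rel_out (x i))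

end FreeComponent

/-- The underlying graded module of the free graded `O`-algebra. -/
noncomputable def freeGrMod : GrMod R where
  carrier := DirectSum ℤ (O.FreeComponent V)
  gr p := LinearMap.range (DirectSum.lof R ℤ (O.FreeComponent V) p)
  isInternal := by
    classical
    set g : DirectSum ℤ (O.FreeComponent V) →ₗ[R]
        DirectSum ℤ (fun p => LinearMap.range (DirectSum.lof R ℤ (O.FreeComponent V) p)) :=
      DirectSum.toModule R ℤ _ fun p =>
        (DirectSum.lof R ℤ (fun p => LinearMap.range (DirectSum.lof R ℤ (O.FreeComponent V) p))
          p).comp (LinearMap.rangeRestrict _)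
    have h₁ : g ∘ₗ DirectSum.coeLinearMap _ = LinearMap.id := by
      refine DirectSum.linearMap_ext R fun p => LinearMap.ext ?_
      rintro ⟨_, x, rfl⟩
      simp only [LinearMap.comp_apply, DirectSum.coeLinearMap_lof, g, DirectSum.toModule_lof]
      rfl
    have h₂ : DirectSum.coeLinearMap _ ∘ₗ g = LinearMap.id := by
      refine DirectSum.linearMap_ext R fun p => LinearMap.ext fun x => ?_
      simp only [LinearMap.comp_apply, g, DirectSum.toModule_lof, DirectSum.coeLinearMap_lof]
      rfl
    exact Function.bijective_iff_has_inverse.2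
      ⟨g, LinearMap.congr_fun h₁, LinearMap.congr_fun h₂⟩

variable {O V}

/-- The inclusion of the component of degree `p`. -/
noncomputable def freeIn (p : ℤ) : O.FreeComponent V p →ₗ[R] (O.freeGrMod V).carrier :=
  DirectSum.lof R ℤ (O.FreeComponent V) p

theorem freeIn_mem (p : ℤ) (x : O.FreeComponent V p) : freeIn p x ∈ (O.freeGrMod V).gr p :=
  ⟨x, rfl⟩

theorem exists_freeIn {p : ℤ} {x : (O.freeGrMod V).carrier} (hx : x ∈ (O.freeGrMod V).gr p) :
    ∃ t : O.FreeTerm V p, freeIn p (.mk t) = x := by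
  obtain ⟨y, rfl⟩ := hx
  exact ⟨_, congrArg _ (FreeComponent.mk_out y)⟩

/-- The operations of `O` on the free graded algebra. -/
noncomputable def freeAct {n : ℕ} : (O.obj n).carrier →ₗ[R]
    MultilinearMap R (fun _ : Fin n => (O.freeGrMod V).carrier) (O.freeGrMod V).carrier :=
  (O.obj n).desc fun p =>
    (MultilinearMap.fromDFinsuppEquiv (M := fun (_ : Fin n) => O.FreeComponent V)
        (fun _ : Fin n => ℤ) R).toLinearMap ∘ₗ
      LinearMap.pi fun q =>
        ((freeIn (p + ∑ i, q i)).compMultilinearMapₗ R) ∘ₗ FreeComponent.act rfl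

theorem freeAct_in {n : ℕ} {p : ℤ} {q : Fin n → ℤ} {r : ℤ} (h : p + ∑ i, q i = r)
    (o : (O.obj n).gr p) (x : ∀ i, O.FreeTerm V (q i)) :
    freeAct (o : (O.obj n).carrier) (fun i => freeIn (q i) (.mk (x i))) =
      freeIn r (.mk (.act h o x)) := by
  subst h
  rw [freeAct, GrMod.desc_apply _ _ o.2]
  refine (MultilinearMap.fromDFinsuppEquiv_single _ q _).trans ?_
  exact congrArg (freeIn _) (FreeComponent.act_mk rfl o x)

end Operad

namespace Operad

variable {R : Type u} [CommRing R] {O : Operad R} {V : GrMod R}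

theorem int_units_smul_eq {M : Type*} [AddCommGroup M] [Module R M] (u : ℤˣ) (x : M) :
    u • x = (((u : ℤˣ) : ℤ) : R) • x := by
  rw [Units.smul_def, Int.cast_smul_eq_zsmul]

variable (O V)

/-- The free graded `O`-algebra on the graded module `V`. -/
noncomputable def freeAlg : GrAlg O where
  toGrMod := O.freeGrMod V
  act := freeAct
  act_mem {n} p q o x ho hx := by
    choose t ht using fun i => exists_freeIn (hx i)
    obtain rfl : (fun i => freeIn (q i) (.mk (t i))) = x := funext ht
    exact freeAct_in rfl ⟨o, ho⟩ t ▸ freeIn_mem _ _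
  act_one x := by
    induction x using GrMod.induction_on with
    | mem p x hx =>
      obtain ⟨t, rfl⟩ := exists_freeIn hx
      refine (freeAct_in (q := fun _ => p) (r := p) (by simp) ⟨O.one, O.one_mem⟩
        fun _ => t).trans ?_
      exact congrArg _ (FreeComponent.mk_eq (.act_one _ t))
    | add x y hx hy =>
      have h (z : (O.freeGrMod V).carrier) :
          (fun _ : Fin 1 => z) = Function.update (fun _ => 0) 0 z := by
        ext i; fin_cases i; rfl
      rw [h] at hx hy ⊢
      rw [MultilinearMap.map_update_add, hx, hy]
  act_comp {n m} j h o y x a b hy hx := by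
    choose t ht using fun i => exists_freeIn (hx i)
    obtain rfl : (fun i => freeIn (b i) (.mk (t i))) = x := funext ht
    induction o using GrMod.induction_on with
    | mem p o ho =>
      have h₂ : p + ∑ s, (a s + ∑ i, b (blockEquiv j h ⟨s, i⟩)) = p + ∑ s, a s + ∑ t, b t := by
        rw [← (blockEquiv j h).sum_comp, Fintype.sum_sigma, Finset.sum_add_distrib, add_assoc]
      have e₁ := freeAct_in (V := V) (q := b) rfl
        ⟨O.comp j h o y, O.comp_mem j h p a o y ho hy⟩ t
      have e₂ := fun s => freeAct_in (V := V) rfl ⟨y s, hy s⟩ fun i => t (blockEquiv j h ⟨s, i⟩)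
      have e₃ := freeAct_in (V := V) h₂ ⟨o, ho⟩
        fun s => .act rfl ⟨y s, hy s⟩ fun i => t (blockEquiv j h ⟨s, i⟩)
      simp only at e₁ e₂ e₃
      simp only [e₁, e₂, e₃]
      rw [int_units_smul_eq (R := R), ← map_smul, ← FreeComponent.mk_smul]
      exact congrArg _ (FreeComponent.mk_eq
        (.act_comp j h ⟨o, ho⟩ (fun s => ⟨y s, hy s⟩) t rfl h₂))
    | add o o' ho ho' =>
      simp only [map_add, add_apply, ho, ho', smul_add]
  act_perm {n} σ o x q hx := by
    choose t ht using fun i => exists_freeIn (hx i)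
    obtain rfl : (fun i => freeIn (q i) (.mk (t i))) = x := funext ht
    induction o using GrMod.induction_on with
    | mem p o ho =>
      have h₂ : p + ∑ i, q (σ.symm i) = p + ∑ i, q i := by rw [σ.symm.sum_comp]
      have e₁ := freeAct_in (V := V) (q := q) rfl ⟨O.perm σ o, O.perm_mem σ p o ho⟩ t
      have e₂ := freeAct_in (V := V) h₂ ⟨o, ho⟩ fun i => t (σ.symm i)
      simp only at e₁ e₂
      simp only [e₁, e₂]
      rw [int_units_smul_eq (R := R), ← map_smul, ← FreeComponent.mk_smul]
      exact congrArg _ (FreeComponent.mk_eq (.act_perm σ ⟨o, ho⟩ t rfl h₂))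
    | add o o' ho ho' =>
      simp only [map_add, add_apply, ho, ho', smul_add]

/-- The inclusion of the generators in the free graded algebra. -/
noncomputable def freeι : V.Hom (O.freeAlg V).toGrMod where
  toLin := V.desc fun p => freeIn p ∘ₗ FreeComponent.of p
  map_mem p x hx := by
    rw [GrMod.desc_apply V _ hx]
    exact freeIn_mem _ _

variable {O V}

theorem freeι_apply {p : ℤ} (v : V.gr p) :
    (O.freeι V).toLin v = freeIn p (.mk (.of v)) :=
  V.desc_apply _ v.2

end Operad

namespace GrAlg

variable {R : Type u} [CommRing R] {O : Operad R}

theorem subset_adjoin (A : GrAlg O) (S : Set A.carrier) : S ⊆ A.adjoin S :=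
  fun _ hx => Submodule.mem_sInf.2 fun _ hT => hT.1 hx

theorem act_mem_adjoin (A : GrAlg O) (S : Set A.carrier) {n : ℕ} (o : (O.obj n).carrier)
    (x : Fin n → A.carrier) (hx : ∀ i, x i ∈ A.adjoin S) : A.act o x ∈ A.adjoin S :=
  Submodule.mem_sInf.2 fun T hT => hT.2 n o x fun i => Submodule.mem_sInf.1 (hx i) T hT

theorem adjoin_le {A : GrAlg O} {S : Set A.carrier} {T : Submodule R A.carrier} (hS : S ⊆ T)
    (hT : ∀ (n : ℕ) (o : (O.obj n).carrier) (x : Fin n → A.carrier),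
      (∀ i, x i ∈ T) → A.act o x ∈ T) : A.adjoin S ≤ T :=
  sInf_le ⟨hS, hT⟩

theorem adjoin_mono (A : GrAlg O) {S T : Set A.carrier} (h : S ⊆ T) : A.adjoin S ≤ A.adjoin T :=
  adjoin_le (h.trans (A.subset_adjoin T)) fun _ => A.act_mem_adjoin T

@[ext] theorem Hom.ext' {A B : GrAlg O} {f g : GrAlg.Hom A B} (h : ∀ x, f.toLin x = g.toLin x) :
    f = g := by
  cases f; cases g
  congr
  exact GrMod.Hom.ext' h

theorem Hom.map_mem_adjoin {A B : GrAlg O} (f : GrAlg.Hom A B) {S : Set A.carrier}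
    {T : Set B.carrier} (h : ∀ x ∈ S, f.toLin x ∈ B.adjoin T) {x : A.carrier}
    (hx : x ∈ A.adjoin S) : f.toLin x ∈ B.adjoin T := by
  refine adjoin_le (T := (B.adjoin T).comap f.toLin) h (fun n o x hx => ?_) hx
  rw [Submodule.mem_comap, f.map_act]
  exact B.act_mem_adjoin T o _ hx

theorem Hom.eqOn_adjoin {A B : GrAlg O} {f g : GrAlg.Hom A B} {S : Set A.carrier}
    (h : ∀ x ∈ S, f.toLin x = g.toLin x) {x : A.carrier} (hx : x ∈ A.adjoin S) :
    f.toLin x = g.toLin x := by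
  refine adjoin_le (T := LinearMap.eqLocus f.toLin g.toLin) h (fun n o x hx => ?_) hx
  rw [LinearMap.mem_eqLocus, f.map_act, g.map_act]
  exact congrArg _ (funext hx)

/-- The identity morphism of a graded algebra. -/
def Hom.id (A : GrAlg O) : GrAlg.Hom A A where
  toLin := LinearMap.id
  map_mem _ _ hx := hx
  map_act _ _ := rfl

/-- The composition of morphisms of graded algebras. -/
def Hom.comp {A B C : GrAlg O} (g : GrAlg.Hom B C) (f : GrAlg.Hom A B) : GrAlg.Hom A C where
  toGrModHom := g.toGrModHom.comp f.toGrModHom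
  map_act o x := by
    change g.toLin (f.toLin _) = _
    rw [f.map_act, g.map_act]; rfl

end GrAlg

namespace Operad

variable {R : Type u} [CommRing R] {O : Operad R} {V : GrMod R}

theorem adjoin_range_freeι : (O.freeAlg V).adjoin (Set.range (O.freeι V).toLin) = ⊤ := by
  refine Submodule.eq_top_iff'.2 fun x => ?_
  induction x using GrMod.induction_on with
  | mem p x hx =>
    obtain ⟨t, rfl⟩ := exists_freeIn hx
    clear hx
    induction t with
    | of v => exact GrAlg.subset_adjoin _ _ ⟨v, freeι_apply v⟩
    | zero p =>
      have : freeIn (O := O) (V := V) p (.mk (.zero p)) = 0 := map_zero (freeIn p)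
      exact this ▸ Submodule.zero_mem _
    | add s t hs ht =>
      rw [FreeComponent.mk_add, map_add]
      exact add_mem hs ht
    | smul c t ht =>
      rw [FreeComponent.mk_smul, map_smul]
      exact Submodule.smul_mem _ _ ht
    | act h o x hx =>
      rw [← freeAct_in]
      exact GrAlg.act_mem_adjoin (O.freeAlg V) _ _ _ hx
  | add x y hx hy => exact add_mem hx hy

/-- The value of a formal expression in a graded algebra, for given values of the generators. -/
def FreeTerm.eval (C : GrAlg O) (g : V.Hom C.toGrMod) : ∀ {p : ℤ}, O.FreeTerm V p → C.carrier
  | _, .of v => g.toLin v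
  | _, .zero _ => 0
  | _, .add s t => s.eval C g + t.eval C g
  | _, .smul c t => c • t.eval C g
  | _, .act _ o x => C.act (o : (O.obj _).carrier) fun i => (x i).eval C g

theorem FreeTerm.eval_mem (C : GrAlg O) (g : V.Hom C.toGrMod) {p : ℤ} (t : O.FreeTerm V p) :
    t.eval C g ∈ C.gr p := by
  induction t with
  | of v => exact g.map_mem _ _ v.2
  | zero p => exact zero_mem _
  | add s t hs ht => exact add_mem hs ht
  | smul c t ht => exact Submodule.smul_mem _ _ ht
  | act h o x hx => exact h ▸ C.act_mem _ _ _ _ o.2 hx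

theorem FreeTerm.eval_update (C : GrAlg O) (g : V.Hom C.toGrMod) {n : ℕ} {q : Fin n → ℤ}
    (x : ∀ i, O.FreeTerm V (q i)) (i : Fin n) (t : O.FreeTerm V (q i)) :
    (fun l => (Function.update x i t l).eval C g) =
      Function.update (fun l => (x l).eval C g) i (t.eval C g) := by
  ext l
  by_cases h : l = i
  · subst h; simp
  · simp [h]

theorem FreeRel.eval_eq (C : GrAlg O) (g : V.Hom C.toGrMod) {p : ℤ} {s t : O.FreeTerm V p}
    (h : FreeRel s t) : s.eval C g = t.eval C g := by
  induction h with
  | refl => rfl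
  | symm _ h => exact h.symm
  | trans _ _ h h' => exact h.trans h'
  | add_congr _ _ h h' => simp only [FreeTerm.eval, h, h']
  | smul_congr c _ h => simp only [FreeTerm.eval, h]
  | act_congr h o _ hx => simp only [FreeTerm.eval, hx]
  | add_assoc => simp only [FreeTerm.eval, _root_.add_assoc]
  | add_comm => simp only [FreeTerm.eval, _root_.add_comm]
  | zero_add => simp only [FreeTerm.eval, _root_.zero_add]
  | neg_add => simp [FreeTerm.eval]
  | smul_add => simp only [FreeTerm.eval, _root_.smul_add]
  | add_smul => simp only [FreeTerm.eval, _root_.add_smul]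
  | mul_smul => simp only [FreeTerm.eval, SemigroupAction.mul_smul]
  | one_smul => simp only [FreeTerm.eval, _root_.one_smul]
  | of_add v w => exact map_add g.toLin _ _
  | of_smul c v => exact map_smul g.toLin _ _
  | act_add h o o' x => simp [FreeTerm.eval]
  | act_smul h c o x => simp [FreeTerm.eval]
  | act_update_add h o x i s t =>
    simp only [FreeTerm.eval, FreeTerm.eval_update, MultilinearMap.map_update_add]
  | act_update_smul h o x i c s =>
    simp only [FreeTerm.eval, FreeTerm.eval_update, MultilinearMap.map_update_smul]
  | act_one h s => exact C.act_one _
  | act_comp j h o y x h₁ h₂ =>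
    simp only [FreeTerm.eval, ← int_units_smul_eq]
    exact C.act_comp j h _ _ _ _ _ (fun s => (y s).2) fun t => (x t).eval_mem C g
  | act_perm σ o x h₁ h₂ =>
    simp only [FreeTerm.eval, ← int_units_smul_eq]
    exact C.act_perm σ _ _ _ fun i => (x i).eval_mem C g

/-- The value of an element of the free graded algebra, for given values of the generators. -/
noncomputable def freeEval (C : GrAlg O) (g : V.Hom C.toGrMod) :
    (O.freeAlg V).carrier →ₗ[R] C.carrier :=
  DirectSum.toModule R ℤ C.carrier fun p =>
    { toFun := Quotient.lift (s := O.freeSetoid V p) (fun t => t.eval C g)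
        fun _ _ h => h.eval_eq C g
      map_add' := fun x y => by
        induction x using FreeComponent.ind
        induction y using FreeComponent.ind
        rfl
      map_smul' := fun c x => by
        induction x using FreeComponent.ind
        rfl }

theorem freeEval_in (C : GrAlg O) (g : V.Hom C.toGrMod) {p : ℤ} (t : O.FreeTerm V p) :
    freeEval C g (freeIn p (.mk t)) = t.eval C g :=
  (DirectSum.toModule_lof R p _).trans rfl

variable (O V)

theorem isFree_freeι : GrAlg.IsFree (O.freeι V) := by
  intro C g
  refine ⟨{ toLin := freeEval C g, map_mem := ?_, map_act := ?_ }, ?_, ?_⟩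
  · intro p x hx
    obtain ⟨t, rfl⟩ := exists_freeIn hx
    exact freeEval_in C g t ▸ t.eval_mem C g
  · intro n o x
    induction o using GrMod.induction_on with
    | mem p o ho =>
      refine DFunLike.congr_fun (f := (freeEval C g).compMultilinearMap ((O.freeAlg V).act o))
        (g := (C.act o).compLinearMap fun _ => freeEval C g)
        (GrMod.multilinear_ext _ fun q x hx => ?_) x
      choose t ht using fun i => exists_freeIn (hx i)
      obtain rfl : (fun i => freeIn (q i) (.mk (t i))) = x := funext ht
      have e := freeAct_in (V := V) rfl ⟨o, ho⟩ t
      simp only at e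
      refine (congrArg (freeEval C g) e).trans ((freeEval_in C g _).trans ?_)
      exact congrArg (C.act o) (funext fun i => (freeEval_in C g (t i)).symm)
    | add o o' ho ho' => simp only [map_add, add_apply, ho, ho']
  · intro v
    induction v using GrMod.induction_on with
    | mem p v hv =>
      exact (congrArg (freeEval C g) (freeι_apply ⟨v, hv⟩)).trans (freeEval_in C g _)
    | add v w hv hw => rw [map_add, map_add, map_add, hv, hw]
  · intro φ hφ
    ext x
    refine GrAlg.Hom.eqOn_adjoin (S := Set.range (O.freeι V).toLin) ?_
      (adjoin_range_freeι (O := O) (V := V) ▸ Submodule.mem_top)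
    rintro _ ⟨v, rfl⟩
    rw [hφ]
    induction v using GrMod.induction_on with
    | mem p v hv =>
      exact ((congrArg (freeEval C g) (freeι_apply ⟨v, hv⟩)).trans (freeEval_in C g _)).symm
    | add v w hv hw => rw [map_add, map_add, map_add, hv, hw]

end Operad

namespace GrAlg

variable {R : Type u} [CommRing R] {O : Operad R} {V : GrMod R} {B : GrAlg O}
  {ι : V.Hom B.toGrMod}

/-- The morphism out of a free graded algebra with given values on the generators. -/
noncomputable def IsFree.lift (h : IsFree ι) {C : GrAlg O} (g : V.Hom C.toGrMod) :
    GrAlg.Hom B C :=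
  (h C g).choose

theorem IsFree.lift_apply (h : IsFree ι) {C : GrAlg O} (g : V.Hom C.toGrMod) (v : V.carrier) :
    (h.lift g).toLin (ι.toLin v) = g.toLin v :=
  (h C g).choose_spec.1 v

theorem IsFree.hom_ext (h : IsFree ι) {C : GrAlg O} {f g : GrAlg.Hom B C}
    (hfg : ∀ v, f.toLin (ι.toLin v) = g.toLin (ι.toLin v)) : f = g :=
  (h C (f.toGrModHom.comp ι)).unique (fun _ => rfl) fun v => (hfg v).symm

theorem IsFree.adjoin_eq_top (h : IsFree ι) : B.adjoin (Set.range ι.toLin) = ⊤ := by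
  -- transfer along the isomorphism with the algebra of formal expressions
  refine eq_top_iff.2 fun x _ => ?_
  let f := h.lift (O.freeι V)
  let g := (O.isFree_freeι V).lift ι
  have e : g.comp f = Hom.id B := h.hom_ext fun v => by
    change g.toLin (f.toLin _) = _
    rw [h.lift_apply, IsFree.lift_apply]; rfl
  have ex : g.toLin (f.toLin x) = x := congrArg (fun φ : GrAlg.Hom B B => φ.toLin x) e
  rw [← ex]
  refine g.map_mem_adjoin (S := Set.range (O.freeι V).toLin) ?_
    (Operad.adjoin_range_freeι (O := O) (V := V) ▸ Submodule.mem_top)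
  rintro _ ⟨v, rfl⟩
  rw [IsFree.lift_apply]
  exact B.subset_adjoin _ ⟨v, rfl⟩

end GrAlg

/-! ### Koszul signs -/

theorem negOnePow_sum {α : Type*} (s : Finset α) (f : α → ℤ) :
    Int.negOnePow (∑ i ∈ s, f i) = ∏ i ∈ s, Int.negOnePow (f i) := by
  classical
  induction s using Finset.induction_on with
  | empty => simp
  | insert a s ha ih => rw [Finset.sum_insert ha, Finset.prod_insert ha, Int.negOnePow_add, ih]

theorem MultilinearMap.map_units_smul_univ {R : Type*} [CommRing R] {n : ℕ} {M N : Type*}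
    [AddCommGroup M] [Module R M] [AddCommGroup N] [Module R N]
    (f : MultilinearMap R (fun _ : Fin n => M) N) (c : Fin n → ℤˣ) (x : Fin n → M) :
    f (fun i => c i • x i) = (∏ i, c i) • f x := by
  simp only [Operad.int_units_smul_eq (R := R)]
  rw [f.map_smul_univ]
  simp

theorem sum_Iio_eq {n : ℕ} (l : Fin n) (f : Fin n → ℤ) :
    ∑ t ∈ Finset.Iio l, f t = ∑ t, if t < l then f t else 0 := by
  rw [← Finset.sum_filter]; congr 1; ext; simp

theorem sum_Ioi_eq {n : ℕ} (l : Fin n) (f : Fin n → ℤ) :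
    ∑ t ∈ Finset.Ioi l, f t = ∑ t, if l < t then f t else 0 := by
  rw [← Finset.sum_filter]; congr 1; ext; simp

theorem update_sub_one_eq {n : ℕ} (q : Fin n → ℤ) (i : Fin n) :
    Function.update q i (q i - 1) = fun l => q l - if l = i then 1 else 0 := by
  ext l
  by_cases h : l = i
  · subst h; simp
  · simp [h]

/-- The order of `{0, …, m - 1}` is the lexicographic order on positions in blocks. -/
theorem blockEquiv_lt_iff {n m : ℕ} (j : Fin n → ℕ) (h : ∑ s, j s = m) (s s' : Fin n)
    (i : Fin (j s)) (i' : Fin (j s')) :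
    blockEquiv j h ⟨s', i'⟩ < blockEquiv j h ⟨s, i⟩ ↔
      s' < s ∨ ∃ e : s' = s, Fin.cast (congrArg j e) i' < i := by
  have key : ∀ (s s' : Fin n) (i : Fin (j s)) (i' : Fin (j s')), s' < s →
      blockEquiv j h ⟨s', i'⟩ < blockEquiv j h ⟨s, i⟩ := by
    intro s s' i i' hs
    rw [Fin.lt_def]
    simp only [blockEquiv, Equiv.trans_apply, finCongr_apply, Fin.val_cast, finSigmaFinEquiv_apply]
    have e (t : Fin n) : ∑ l : Fin t, j (Fin.castLE t.2.le l) = ∑ l ∈ Finset.Iio t, j l := by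
      refine Finset.sum_bij (fun l _ => Fin.castLE t.2.le l) ?_ ?_ ?_ ?_
      · intro l _; simp [Fin.lt_def]
      · intro a _ b _ hab; simpa using hab
      · intro b hb; exact ⟨⟨b, Fin.lt_def.1 (Finset.mem_Iio.1 hb)⟩, Finset.mem_univ _, rfl⟩
      · intro _ _; rfl
    rw [e, e]
    have h₁ : ∑ l ∈ Finset.Iio s', j l + j s' ≤ ∑ l ∈ Finset.Iio s, j l := by
      rw [add_comm, ← Finset.sum_insert (by simp), Finset.Iio_insert]
      exact Finset.sum_le_sum_of_subset fun l hl => by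
        simp only [Finset.mem_Iic, Finset.mem_Iio] at hl ⊢; exact lt_of_le_of_lt hl hs
    have := i'.2
    omega
  rcases lt_trichotomy s' s with hs | rfl | hs
  · exact iff_of_true (key _ _ _ _ hs) (Or.inl hs)
  · rw [Fin.lt_def]
    simp [blockEquiv, finSigmaFinEquiv_apply]
  · refine iff_of_false (key _ _ _ _ hs).not_gt ?_
    rintro (h' | ⟨e, _⟩)
    · exact h'.not_gt hs
    · exact hs.ne' e

theorem sum_Iio_blockEquiv {n m : ℕ} (j : Fin n → ℕ) (h : ∑ s, j s = m) (b : Fin m → ℤ)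
    (s : Fin n) (i : Fin (j s)) :
    ∑ t ∈ Finset.Iio (blockEquiv j h ⟨s, i⟩), b t =
      ∑ s' ∈ Finset.Iio s, ∑ i', b (blockEquiv j h ⟨s', i'⟩) +
        ∑ i' ∈ Finset.Iio i, b (blockEquiv j h ⟨s, i'⟩) := by
  rw [sum_Iio_eq, sum_Iio_eq, sum_Iio_eq, ← (blockEquiv j h).sum_comp, Fintype.sum_sigma,
    ← Finset.add_sum_erase Finset.univ _ (Finset.mem_univ s), add_comm,
    ← Finset.add_sum_erase Finset.univ (fun s' => if s' < s then _ else _) (Finset.mem_univ s)]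
  simp only [lt_irrefl, if_false, zero_add]
  congr 1
  · refine Finset.sum_congr rfl fun s' hs' => ?_
    have hne : s' ≠ s := (Finset.mem_erase.1 hs').1
    simp only [blockEquiv_lt_iff, hne, IsEmpty.exists_iff, or_false]
    split_ifs <;> simp
  · refine Finset.sum_congr rfl fun i' _ => ?_
    simp [blockEquiv_lt_iff]

/-- The change of the shuffle sign when an operator of degree `-1` is applied to `x_s`. -/
theorem shuffleSign_update_left {n : ℕ} (a b : Fin n → ℤ) (s : Fin n) :
    shuffleSign (Function.update a s (a s - 1)) b =
      shuffleSign a b * Int.negOnePow (∑ s' ∈ Finset.Iio s, b s') := by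
  rw [shuffleSign, shuffleSign, update_sub_one_eq, ← Int.negOnePow_add, Int.negOnePow_eq_iff]
  have : ∑ l, ∑ l' ∈ Finset.Iio l, (a l - if l = s then 1 else 0) * b l' =
      ∑ l, ∑ l' ∈ Finset.Iio l, a l * b l' - ∑ l' ∈ Finset.Iio s, b l' := by
    simp only [sub_mul, Finset.sum_sub_distrib, ite_mul, one_mul, zero_mul]
    simp only [sum_Iio_eq]
    rw [Finset.sum_comm (f := fun l l' => if l' < l then if l = s then b l' else 0 else 0)]
    congr 1
    refine Finset.sum_congr rfl fun l _ => ?_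
    rw [Finset.sum_eq_single s]
    · simp
    · intro l' _ hl; simp [hl]
    · simp
  rw [this]
  exact ⟨-∑ l' ∈ Finset.Iio s, b l', by ring⟩

/-- The change of the shuffle sign when an operator of degree `-1` is applied to `Y_s`. -/
theorem shuffleSign_update_right {n : ℕ} (a b : Fin n → ℤ) (s : Fin n) :
    shuffleSign a (Function.update b s (b s - 1)) =
      shuffleSign a b * Int.negOnePow (∑ s' ∈ Finset.Ioi s, a s') := by
  rw [shuffleSign, shuffleSign, update_sub_one_eq, ← Int.negOnePow_add, Int.negOnePow_eq_iff]
  have : ∑ l, ∑ l' ∈ Finset.Iio l, a l * (b l' - if l' = s then 1 else 0) =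
      ∑ l, ∑ l' ∈ Finset.Iio l, a l * b l' - ∑ l ∈ Finset.Ioi s, a l := by
    simp only [mul_sub, Finset.sum_sub_distrib, mul_ite, mul_one, mul_zero]
    simp only [sum_Iio_eq, sum_Ioi_eq]
    congr 1
    refine Finset.sum_congr rfl fun l _ => ?_
    rw [Finset.sum_eq_single s]
    · simp
    · intro l' _ hl; simp [hl]
    · simp
  rw [this]
  exact ⟨-∑ l ∈ Finset.Ioi s, a l, by ring⟩

/-- Applying an operator of degree `-1` to the factor `x_i` before or after a rearrangement gives
the same sign, including that of moving the operator to its place. -/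
theorem permSign_update {n : ℕ} (σ : Equiv.Perm (Fin n)) (q : Fin n → ℤ) (i : Fin n) :
    Int.negOnePow (∑ l ∈ Finset.Iio i, q l) * permSign σ (Function.update q i (q i - 1)) =
      permSign σ q * Int.negOnePow (∑ l ∈ Finset.Iio (σ i), q (σ.symm l)) := by
  have hE (q : Fin n → ℤ) : permSign σ q =
      Int.negOnePow (∑ a, ∑ b, if a < b ∧ σ b < σ a then q a * q b else 0) := by
    rw [permSign, negOnePow_sum]
    refine Finset.prod_congr rfl fun a _ => ?_
    rw [negOnePow_sum]
    have : Finset.Ioi a = Finset.univ.filter fun b => a < b := by ext; simp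
    rw [this, Finset.prod_filter]
    refine Finset.prod_congr rfl fun b _ => ?_
    by_cases h : a < b <;> by_cases h' : σ b < σ a <;> simp [h, h']
  have h₁ : ∑ l ∈ Finset.Iio (σ i), q (σ.symm l) = ∑ l, if σ l < σ i then q l else 0 := by
    rw [← Equiv.sum_comp σ.symm, ← Finset.sum_filter]
    simp only [Equiv.apply_symm_apply]
    congr 1; ext; simp
  have h₃ : (∑ a, ∑ b, if a < b ∧ σ b < σ a then
        (q a - if a = i then 1 else 0) * (q b - if b = i then 1 else 0) else 0) =
      (∑ a, ∑ b, if a < b ∧ σ b < σ a then q a * q b else 0) -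
      (∑ b, if i < b ∧ σ b < σ i then q b else 0) -
      ∑ a, if a < i ∧ σ i < σ a then q a else 0 := by
    have e₁ : (∑ b, if i < b ∧ σ b < σ i then q b else 0) =
        ∑ a, ∑ b, if a = i then (if a < b ∧ σ b < σ a then q b else 0) else 0 := by
      rw [Finset.sum_comm]; simp
    have e₂ : (∑ a, if a < i ∧ σ i < σ a then q a else 0) =
        ∑ a, ∑ b, if b = i then (if a < b ∧ σ b < σ a then q a else 0) else 0 := by
      simp
    rw [e₁, e₂]
    simp only [← Finset.sum_sub_distrib]
    refine Finset.sum_congr rfl fun a _ => Finset.sum_congr rfl fun b _ => ?_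
    by_cases h : a < b ∧ σ b < σ a
    · by_cases ha : a = i
      · have hb : b ≠ i := fun hb => by rw [ha, hb] at h; exact h.1.ne rfl
        simp only [if_pos h, if_pos ha, if_neg hb]; ring
      · by_cases hb : b = i
        · simp only [if_pos h, if_neg ha, if_pos hb]; ring
        · simp only [if_pos h, if_neg ha, if_neg hb]; ring
    · simp [h]
  rw [hE, hE, update_sub_one_eq, h₃, h₁, sum_Iio_eq, ← Int.negOnePow_add, ← Int.negOnePow_add,
    Int.negOnePow_eq_iff]
  have : (∑ l, if l < i then q l else 0) +
      ((∑ a, ∑ b, if a < b ∧ σ b < σ a then q a * q b else 0) -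
      (∑ b, if i < b ∧ σ b < σ i then q b else 0) -
      ∑ a, if a < i ∧ σ i < σ a then q a else 0) -
      ((∑ a, ∑ b, if a < b ∧ σ b < σ a then q a * q b else 0) +
      ∑ l, if σ l < σ i then q l else 0) =
      ∑ l, ((if l < i then q l else 0) - (if i < l ∧ σ l < σ i then q l else 0) -
        (if l < i ∧ σ i < σ l then q l else 0) - (if σ l < σ i then q l else 0)) := by
    simp only [Finset.sum_sub_distrib]; ring
  rw [this]
  refine Finset.even_sum _ fun l _ => ?_
  rcases lt_trichotomy l i with h | rfl | h
  · rcases lt_or_gt_of_ne (fun e => h.ne (σ.injective e) : σ l ≠ σ i) with h' | h' <;>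
      simp [h, h', h.not_gt, h'.not_gt]
  · simp
  · rcases lt_or_gt_of_ne (fun e => h.ne' (σ.injective e) : σ l ≠ σ i) with h' | h'
    · simpa [h, h', h.not_gt, h'.not_gt] using ⟨-q l, rfl⟩
    · simp [h, h'.not_gt, h.not_gt]

/-! ### Derivations of graded algebras -/

/-- The tuple `(±x_0, …, ±x_{i-1}, y, x_{i+1}, …)`, with the signs that arise when an operator of
odd degree is moved past `x_0, …, x_{i-1}`. -/
noncomputable def GrMod.koszul {R : Type u} [CommRing R] (M : GrMod R) {n : ℕ} (i : Fin n)
    (x : Fin n → M.carrier) (y : M.carrier) : Fin n → M.carrier :=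
  fun l => if l < i then M.sgn (x l) else if l = i then y else x l

namespace GrAlg

variable {R : Type u} [CommRing R] {O : Operad R}

theorem act_koszul (B : GrAlg O) {n : ℕ} (i : Fin n) {p : ℤ} {q : Fin n → ℤ}
    {o : (O.obj n).carrier} (ho : o ∈ (O.obj n).gr p) {x : Fin n → B.carrier}
    (hx : ∀ l, x l ∈ B.gr (q l)) (y : B.carrier) :
    B.act ((O.obj n).sgn o) (B.koszul i x y) =
      Int.negOnePow (p + ∑ l ∈ Finset.Iio i, q l) • B.act o (Function.update x i y) := by
  have h₁ : B.koszul i x y = fun l =>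
      (if l < i then Int.negOnePow (q l) else 1) • Function.update x i y l := by
    ext l
    by_cases h : l < i
    · simp only [GrMod.koszul, if_pos h, Function.update_of_ne h.ne]
      exact GrMod.sgn_of_mem _ (hx l)
    · by_cases h' : l = i
      · subst h'; simp [GrMod.koszul]
      · simp [GrMod.koszul, h, h']
  have h₂ : ∏ l, (if l < i then Int.negOnePow (q l) else 1) =
      Int.negOnePow (∑ l ∈ Finset.Iio i, q l) := by
    rw [negOnePow_sum, ← Finset.prod_filter]
    congr 1; ext; simp
  rw [h₁, MultilinearMap.map_units_smul_univ, h₂, GrMod.sgn_of_mem _ ho,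
    Operad.int_units_smul_eq (R := R) _ o, map_smul, smul_apply,
    ← Operad.int_units_smul_eq, smul_smul, Int.negOnePow_add, mul_comm]

/-- A derivation of degree `-1` of a graded `O`-algebra, over the differential of the operad. The
degree involutions carry the signs of the Leibniz rule. -/
structure IsDerivation (B : GrAlg O) (δ : B.carrier →ₗ[R] B.carrier) : Prop where
  mem : ∀ (p : ℤ) (x : B.carrier), x ∈ B.gr p → δ x ∈ B.gr (p - 1)
  leibniz : ∀ {n : ℕ} (o : (O.obj n).carrier) (x : Fin n → B.carrier),
    δ (B.act o x) = B.act ((O.obj n).d o) x +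
      ∑ i, B.act ((O.obj n).sgn o) (B.koszul i x (δ (x i)))

/-- The linear functions `(x, y) ↦ ±x, y, x` that make up `GrMod.koszul`. -/
noncomputable def koszulLin (B : GrAlg O) {n : ℕ} (i l : Fin n) :
    B.carrier × B.carrier →ₗ[R] B.carrier :=
  if l < i then B.sgn ∘ₗ LinearMap.fst R _ _ else
    if l = i then LinearMap.snd R _ _ else LinearMap.fst R _ _

theorem koszulLin_apply (B : GrAlg O) {n : ℕ} (i : Fin n) (z : Fin n → B.carrier × B.carrier) :
    (fun l => B.koszulLin i l (z l)) = B.koszul i (fun l => (z l).1) (z i).2 := by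
  ext l
  simp only [koszulLin, GrMod.koszul]
  split_ifs with h h'
  · rfl
  · rw [h']; rfl
  · rfl

/-- The operations of the algebra `dual B`. -/
noncomputable def dualAct (B : GrAlg O) {n : ℕ} : (O.obj n).carrier →ₗ[R]
    MultilinearMap R (fun _ : Fin n => B.carrier × B.carrier) (B.carrier × B.carrier) where
  toFun o := ((B.act o).compLinearMap fun _ => LinearMap.fst R _ _).prod
    ((B.act ((O.obj n).d o)).compLinearMap (fun _ => LinearMap.fst R _ _) +
      ∑ i, (B.act ((O.obj n).sgn o)).compLinearMap (B.koszulLin i))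
  map_add' o o' := by
    ext z
    · simp
    · simp [Finset.sum_add_distrib]; abel
  map_smul' c o := by
    ext z
    · simp
    · simp [Finset.smul_sum]

theorem dualAct_fst (B : GrAlg O) {n : ℕ} (o : (O.obj n).carrier)
    (z : Fin n → B.carrier × B.carrier) : (B.dualAct o z).1 = B.act o fun i => (z i).1 := rfl

theorem dualAct_snd (B : GrAlg O) {n : ℕ} (o : (O.obj n).carrier)
    (z : Fin n → B.carrier × B.carrier) :
    (B.dualAct o z).2 = B.act ((O.obj n).d o) (fun i => (z i).1) +
      ∑ i, B.act ((O.obj n).sgn o) (B.koszul i (fun l => (z l).1) (z i).2) := by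
  change (_ + _ : B.carrier) = _
  simp only [sum_apply, MultilinearMap.compLinearMap_apply, koszulLin_apply]
  rfl

theorem dualAct_snd_of_mem (B : GrAlg O) {n : ℕ} {p : ℤ} {q : Fin n → ℤ}
    {o : (O.obj n).carrier} (ho : o ∈ (O.obj n).gr p) {z : Fin n → B.carrier × B.carrier}
    (hz : ∀ l, (z l).1 ∈ B.gr (q l)) :
    (B.dualAct o z).2 = B.act ((O.obj n).d o) (fun i => (z i).1) +
      ∑ i, Int.negOnePow (p + ∑ l ∈ Finset.Iio i, q l) •
        B.act o (Function.update (fun l => (z l).1) i (z i).2) := by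
  rw [dualAct_snd]
  exact congrArg _ (Finset.sum_congr rfl fun i _ => B.act_koszul i ho hz _)

theorem update_mem {M : GrMod R} {n : ℕ} {q : Fin n → ℤ} {x : Fin n → M.carrier}
    (hx : ∀ l, x l ∈ M.gr (q l)) (i : Fin n) {r : ℤ} {y : M.carrier} (hy : y ∈ M.gr r) (l : Fin n) :
    Function.update x i y l ∈ M.gr (Function.update q i r l) := by
  by_cases h : l = i
  · subst h; simpa
  · simpa [h] using hx l

theorem dualAct_mem (B : GrAlg O) {n : ℕ} (p : ℤ) (q : Fin n → ℤ) (o : (O.obj n).carrier)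
    (z : Fin n → B.carrier × B.carrier) (ho : o ∈ (O.obj n).gr p)
    (hz : ∀ i, z i ∈ (B.toGrMod.prod B.toGrMod.susp).gr (q i)) :
    B.dualAct o z ∈ (B.toGrMod.prod B.toGrMod.susp).gr (p + ∑ i, q i) := by
  refine ⟨B.act_mem p q o _ ho fun i => (hz i).1, ?_⟩
  have h := B.dualAct_snd_of_mem ho fun i => (hz i).1
  change (B.dualAct o z).2 ∈ B.gr (p + ∑ i, q i - 1)
  rw [h]
  refine add_mem ?_ (Submodule.sum_mem _ fun i _ => GrMod.units_smul_mem _ _ ?_)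
  · have := B.act_mem (p - 1) q _ (fun i => (z i).1) ((O.obj n).d_mem p o ho) fun i => (hz i).1
    rwa [show p - 1 + ∑ i, q i = p + ∑ i, q i - 1 by ring] at this
  · have := B.act_mem p _ o _ ho (update_mem (fun i => (hz i).1) i (hz i).2)
    rwa [update_sub_one_eq, Finset.sum_sub_distrib, Finset.sum_ite_eq', if_pos (Finset.mem_univ _),
      ← add_sub_assoc] at this

theorem dualAct_one (B : GrAlg O) (z : B.carrier × B.carrier) :
    B.dualAct O.one (fun _ => z) = z := by
  refine Prod.ext (B.act_one z.1) ?_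
  rw [dualAct_snd, O.d_one, map_zero, zero_apply, zero_add, Fin.sum_univ_one,
    GrMod.sgn_of_mem _ O.one_mem, Int.negOnePow_zero, one_smul]
  have : B.koszul (0 : Fin 1) (fun _ => z.1) z.2 = fun _ => z.2 := by
    ext l; fin_cases l; simp [GrMod.koszul]
  rw [this, B.act_one]

theorem dualAct_perm (B : GrAlg O) {n : ℕ} (σ : Equiv.Perm (Fin n)) (o : (O.obj n).carrier)
    (z : Fin n → B.carrier × B.carrier) (q : Fin n → ℤ)
    (hz : ∀ i, z i ∈ (B.toGrMod.prod B.toGrMod.susp).gr (q i)) :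
    B.dualAct (O.perm σ o) z = permSign σ q • B.dualAct o (fun i => z (σ.symm i)) := by
  induction o using GrMod.induction_on with
  | mem p o ho =>
    refine Prod.ext (B.act_perm σ o _ q fun i => (hz i).1) ?_
    change _ = permSign σ q • (B.dualAct o (fun i => z (σ.symm i))).2
    have h₁ := B.dualAct_snd_of_mem (O.perm_mem σ p o ho) fun i => (hz i).1
    have h₂ := B.dualAct_snd_of_mem (z := fun i => z (σ.symm i)) ho fun i => (hz (σ.symm i)).1
    rw [h₁, h₂, O.d_perm, B.act_perm σ _ _ q fun i => (hz i).1, smul_add, Finset.smul_sum]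
    congr 1
    rw [← Equiv.sum_comp σ (fun l => permSign σ q • _)]
    refine Finset.sum_congr rfl fun i _ => ?_
    rw [B.act_perm σ o _ _ (update_mem (fun i => (hz i).1) i (hz i).2), smul_smul, smul_smul,
      Int.negOnePow_add, Int.negOnePow_add, mul_assoc, permSign_update, mul_left_comm]
    congr 2
    ext l
    by_cases h : l = σ i
    · subst h; simp
    · have h' : σ.symm l ≠ i := fun e => h (by rw [← e, Equiv.apply_symm_apply])
      simp [h, h']
  | add o o' ho ho' => simp only [map_add, add_apply, ho, ho', smul_add]

theorem comp_sign_left {n : ℕ} (p : ℤ) (a c : Fin n → ℤ) (s : Fin n) :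
    Int.negOnePow (p + ∑ s' ∈ Finset.Iio s, a s') *
      shuffleSign (Function.update a s (a s - 1)) c =
    shuffleSign a c * Int.negOnePow (p + ∑ s' ∈ Finset.Iio s, (a s' + c s')) := by
  rw [shuffleSign_update_left, Finset.sum_add_distrib]
  simp only [Int.negOnePow_add]
  ac_rfl

theorem comp_sign_right {n : ℕ} (p e : ℤ) (a c : Fin n → ℤ) (s : Fin n) :
    Int.negOnePow (p + ∑ s', a s' + (∑ s' ∈ Finset.Iio s, c s' + e)) *
      shuffleSign a (Function.update c s (c s - 1)) =
    shuffleSign a c * (Int.negOnePow (p + ∑ s' ∈ Finset.Iio s, (a s' + c s')) *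
      Int.negOnePow (a s + e)) := by
  have h : ∑ s', a s' = ∑ s' ∈ Finset.Iio s, a s' + a s + ∑ s' ∈ Finset.Ioi s, a s' := by
    rw [sum_Iio_eq, sum_Ioi_eq]
    have : a s = ∑ s', if s' = s then a s' else 0 := by simp
    rw [this, ← Finset.sum_add_distrib, ← Finset.sum_add_distrib]
    refine Finset.sum_congr rfl fun l _ => ?_
    rcases lt_trichotomy l s with h | rfl | h
    · simp [h, h.ne, h.not_gt]
    · simp
    · simp [h, h.ne', h.not_gt]
  have h' : Int.negOnePow (∑ s' ∈ Finset.Ioi s, a s') * Int.negOnePow (∑ s' ∈ Finset.Ioi s, a s')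
      = 1 := Int.units_mul_self _
  rw [shuffleSign_update_right, h, Finset.sum_add_distrib]
  simp only [Int.negOnePow_add]
  calc _ = shuffleSign a c * (Int.negOnePow p * (Int.negOnePow (∑ s' ∈ Finset.Iio s, a s') *
        Int.negOnePow (∑ s' ∈ Finset.Iio s, c s')) * (Int.negOnePow (a s) * Int.negOnePow e)) *
        (Int.negOnePow (∑ s' ∈ Finset.Ioi s, a s') *
          Int.negOnePow (∑ s' ∈ Finset.Ioi s, a s')) := by ac_rfl
    _ = _ := by rw [h', mul_one]

theorem dualAct_comp (B : GrAlg O) {n m : ℕ} (j : Fin n → ℕ) (h : ∑ s, j s = m)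
    (o : (O.obj n).carrier) (y : ∀ s, (O.obj (j s)).carrier) (z : Fin m → B.carrier × B.carrier)
    (a : Fin n → ℤ) (b : Fin m → ℤ) (hy : ∀ s, y s ∈ (O.obj (j s)).gr (a s))
    (hz : ∀ t, z t ∈ (B.toGrMod.prod B.toGrMod.susp).gr (b t)) :
    B.dualAct (O.comp j h o y) z =
      shuffleSign a (fun s => ∑ i, b (blockEquiv j h ⟨s, i⟩)) •
        B.dualAct o (fun s => B.dualAct (y s) (fun i => z (blockEquiv j h ⟨s, i⟩))) := by
  induction o using GrMod.induction_on with
  | mem p o ho =>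
    set c : Fin n → ℤ := fun s => ∑ i, b (blockEquiv j h ⟨s, i⟩) with hc
    set x : Fin m → B.carrier := fun t => (z t).1 with hx
    have hxm : ∀ t, x t ∈ B.gr (b t) := fun t => (hz t).1
    refine Prod.ext (B.act_comp j h o y x a b hy hxm) ?_
    change _ = shuffleSign a c • (B.dualAct o _).2
    have h₁ := B.dualAct_snd_of_mem (O.comp_mem j h p a o y ho hy) hxm
    have h₂ := B.dualAct_snd_of_mem (q := fun s => a s + c s) ho
      (z := fun s => B.dualAct (y s) (fun i => z (blockEquiv j h ⟨s, i⟩)))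
      fun s => B.act_mem (a s) (fun i => b (blockEquiv j h ⟨s, i⟩)) (y s) _ (hy s)
        fun i => hxm (blockEquiv j h ⟨s, i⟩)
    have h₃ := fun s => B.dualAct_snd_of_mem (hy s) (z := fun i => z (blockEquiv j h ⟨s, i⟩))
      fun i => hxm (blockEquiv j h ⟨s, i⟩)
    rw [h₁, h₂]
    simp only [h₃, dualAct_fst]
    rw [O.d_comp j h p a o y ho hy, map_add, add_apply,
      B.act_comp j h _ y x a b hy hxm, smul_add, add_assoc]
    congr 1
    rw [← (blockEquiv j h).sum_comp (fun t => Int.negOnePow _ • _), Fintype.sum_sigma, map_sum,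
      sum_apply, ← Finset.sum_add_distrib, Finset.smul_sum]
    refine Finset.sum_congr rfl fun s _ => ?_
    rw [MultilinearMap.map_update_add, MultilinearMap.map_update_sum, smul_add, smul_add,
      Finset.smul_sum, Finset.smul_sum]
    congr 1
    · rw [GrMod.map_units_smul, Operad.int_units_smul_eq (R := R), smul_apply,
        ← Operad.int_units_smul_eq,
        B.act_comp j h o (Function.update y s ((O.obj (j s)).d (y s))) x
          (Function.update a s (a s - 1)) b (fun s' => ?_) hxm,
        smul_smul, smul_smul, comp_sign_left]
      · congr 2
        ext s'
        by_cases e : s' = s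
        · subst e; simp [hx]
        · simp [e, hx]
      · by_cases e : s' = s
        · subst e; simpa using (O.obj _).d_mem _ _ (hy s')
        · simpa [e] using hy s'
    · refine Finset.sum_congr rfl fun i _ => ?_
      rw [B.act_comp j h o y _ a _ hy (update_mem hxm (blockEquiv j h ⟨s, i⟩)
        (hz (blockEquiv j h ⟨s, i⟩)).2)]
      have e₁ : (fun s' => ∑ i', Function.update b (blockEquiv j h ⟨s, i⟩)
          (b (blockEquiv j h ⟨s, i⟩) - 1) (blockEquiv j h ⟨s', i'⟩)) =
          Function.update c s (c s - 1) := by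
        ext s'
        rw [update_sub_one_eq, update_sub_one_eq]
        simp only [Finset.sum_sub_distrib, hc, EmbeddingLike.apply_eq_iff_eq]
        congr 1
        by_cases e : s' = s
        · subst e; simp
        · simp [e]
      have e₂ : (fun s' => B.act (y s') fun i' => Function.update x (blockEquiv j h ⟨s, i⟩)
          (z (blockEquiv j h ⟨s, i⟩)).2 (blockEquiv j h ⟨s', i'⟩)) =
          Function.update (fun s' => B.act (y s') fun i' => x (blockEquiv j h ⟨s', i'⟩)) s
            (B.act (y s) (Function.update (fun i' => x (blockEquiv j h ⟨s, i'⟩)) i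
              (z (blockEquiv j h ⟨s, i⟩)).2)) := by
        ext s'
        by_cases e : s' = s
        · subst e
          rw [Function.update_self]
          congr 1
          ext i'
          by_cases e : i' = i
          · subst e; simp
          · simp [e]
        · simp [e]
      rw [Operad.int_units_smul_eq (R := R) _ (B.act (y s) _), MultilinearMap.map_update_smul,
        ← Operad.int_units_smul_eq, e₁, e₂, smul_smul, smul_smul, smul_smul, sum_Iio_blockEquiv,
        comp_sign_right, ← mul_assoc]
  | add o o' ho ho' => simp only [map_add, add_apply, ho, ho', smul_add]

/-- The graded algebra of pairs `(x, y)`, where the degree of `y` is one less than that of `x`, with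
the operations for which `x ↦ (x, δ x)` is a morphism precisely if `δ` is a derivation. -/
noncomputable def dual (B : GrAlg O) : GrAlg O where
  toGrMod := B.toGrMod.prod B.toGrMod.susp
  act := B.dualAct
  act_mem := B.dualAct_mem
  act_one := B.dualAct_one
  act_comp := B.dualAct_comp
  act_perm := B.dualAct_perm

/-- A derivation of a free graded algebra may be prescribed on the generators. -/
theorem IsFree.exists_derivation {B : GrAlg O} {V : GrMod R} {ι : V.Hom B.toGrMod} (h : IsFree ι)
    (g : V.carrier →ₗ[R] B.carrier) (hg : ∀ p, ∀ v ∈ V.gr p, g v ∈ B.gr (p - 1)) :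
    ∃ δ : B.carrier →ₗ[R] B.carrier, B.IsDerivation δ ∧ ∀ v, δ (ι.toLin v) = g v := by
  let φ : GrAlg.Hom B B.dual := h.lift
    { toLin := ι.toLin.prod g
      map_mem := fun p v hv => ⟨ι.map_mem p v hv, hg p v hv⟩ }
  let π : GrAlg.Hom B.dual B :=
    { toLin := LinearMap.fst R B.carrier B.carrier
      map_mem := fun p z hz => hz.1
      map_act := fun _ _ => rfl }
  have hφ : ∀ v, φ.toLin (ι.toLin v) = (ι.toLin v, g v) := fun v => h.lift_apply _ v
  have h₁ : ∀ x, (φ.toLin x).1 = x := fun x =>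
    congrArg (fun ψ : GrAlg.Hom B B => ψ.toLin x)
      (h.hom_ext (f := π.comp φ) (g := Hom.id B) fun v => congrArg Prod.fst (hφ v))
  refine ⟨LinearMap.snd R B.carrier B.carrier ∘ₗ φ.toLin, ⟨fun p x hx => (φ.map_mem p x hx).2, ?_⟩,
    fun v => congrArg Prod.snd (hφ v)⟩
  intro n o x
  change (φ.toLin (B.act o x)).2 = _
  rw [φ.map_act]
  refine (B.dualAct_snd o _).trans ?_
  simp only [h₁]
  rfl

end GrAlg

/-! ### Squares of derivations and differentials -/

namespace GrMod

variable {R : Type u} [CommRing R]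

theorem map_koszul {M N : GrMod R} (f : M.carrier →ₗ[R] N.carrier)
    (hf : ∀ p, ∀ x ∈ M.gr p, f x ∈ N.gr p) {n : ℕ} (i : Fin n) (x : Fin n → M.carrier)
    (y : M.carrier) :
    (fun l => f (M.koszul i x y l)) = N.koszul i (fun l => f (x l)) (f y) := by
  ext l
  simp only [koszul]
  split_ifs
  · exact map_sgn f hf _
  · rfl
  · rfl

theorem koszul_self_of_sgn (M : GrMod R) {n : ℕ} (i : Fin n) (x : Fin n → M.carrier)
    (y z : M.carrier) : M.koszul i (M.koszul i x y) z = Function.update x i z := by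
  ext l
  rcases lt_trichotomy l i with h | rfl | h
  · simp [koszul, h, h.ne, sgn_sgn]
  · simp [koszul]
  · simp [koszul, h.not_gt, h.ne']

end GrMod

namespace GrAlg

variable {R : Type u} [CommRing R] {O : Operad R}

theorem IsDerivation.map_eqOn_adjoin {B C : GrAlg O} {δ : B.carrier →ₗ[R] B.carrier}
    {ε : C.carrier →ₗ[R] C.carrier} (hδ : B.IsDerivation δ) (hε : C.IsDerivation ε)
    (φ : GrAlg.Hom B C) {S : Set B.carrier} (h : ∀ x ∈ S, φ.toLin (δ x) = ε (φ.toLin x))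
    {x : B.carrier} (hx : x ∈ B.adjoin S) : φ.toLin (δ x) = ε (φ.toLin x) := by
  refine adjoin_le (T := LinearMap.eqLocus (φ.toLin ∘ₗ δ) (ε ∘ₗ φ.toLin)) h
    (fun n o x hx => ?_) hx
  simp only [LinearMap.mem_eqLocus, LinearMap.comp_apply] at hx ⊢
  rw [hδ.leibniz, φ.map_act, hε.leibniz, map_add, map_sum, φ.map_act]
  congr 1
  refine Finset.sum_congr rfl fun i _ => ?_
  rw [φ.map_act, GrMod.map_koszul φ.toLin φ.map_mem, hx]

theorem IsDerivation.eqOn_adjoin {B : GrAlg O} {δ ε : B.carrier →ₗ[R] B.carrier}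
    (hδ : B.IsDerivation δ) (hε : B.IsDerivation ε) {S : Set B.carrier} (h : ∀ x ∈ S, δ x = ε x)
    {x : B.carrier} (hx : x ∈ B.adjoin S) : δ x = ε x :=
  hδ.map_eqOn_adjoin hε (Hom.id B) h hx

/-- The square of a derivation of degree `-1` is a derivation of even degree, over the square of the
differential of the operad, which vanishes. -/
theorem IsDerivation.sq_act {B : GrAlg O} {δ : B.carrier →ₗ[R] B.carrier} (hδ : B.IsDerivation δ)
    {n : ℕ} (o : (O.obj n).carrier) (x : Fin n → B.carrier) :
    δ (δ (B.act o x)) = ∑ i, B.act o (Function.update x i (δ (δ (x i)))) := by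
  -- the terms in which `δ` is applied to two different factors
  set T : Fin n → Fin n → B.carrier := fun i l =>
    B.act o (B.koszul l (B.koszul i x (δ (x i))) (δ (B.koszul i x (δ (x i)) l))) with hT
  have hlt (i l : Fin n) (h : l < i) : T i l + T l i = 0 := by
    have e₁ : B.koszul i x (δ (x i)) l = B.sgn (x l) := by simp [GrMod.koszul, h]
    have e₂ : B.koszul l x (δ (x l)) i = x i := by simp [GrMod.koszul, h.not_gt, h.ne']
    set w : Fin n → B.carrier := Function.update (fun k => if l < k ∧ k < i then B.sgn (x k) else
      if k = i then δ (x i) else x k) l (B.sgn (δ (x l))) with hw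
    have e₃ : B.koszul l (B.koszul i x (δ (x i))) (δ (B.koszul i x (δ (x i)) l)) =
        Function.update w l (- w l) := by
      rw [e₁, GrMod.map_sgn_of_degree_neg_one δ hδ.mem]
      ext k
      rcases lt_trichotomy k l with hk | rfl | hk
      · simp [GrMod.koszul, hw, hk, hk.ne, hk.trans h, hk.not_gt, GrMod.sgn_sgn, (hk.trans h).ne]
      · simp [GrMod.koszul, hw]
      · rcases lt_trichotomy k i with hk' | rfl | hk'
        · simp [GrMod.koszul, hw, hk.not_gt, hk.ne', hk', hk]
        · simp [GrMod.koszul, hw, hk.not_gt, hk.ne']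
        · simp [GrMod.koszul, hw, hk.not_gt, hk.ne', hk'.not_gt, hk'.ne']
    have e₄ : B.koszul i (B.koszul l x (δ (x l))) (δ (B.koszul l x (δ (x l)) i)) = w := by
      rw [e₂]
      ext k
      rcases lt_trichotomy k l with hk | rfl | hk
      · simp [GrMod.koszul, hw, hk, hk.ne, hk.trans h, hk.not_gt, GrMod.sgn_sgn, (hk.trans h).ne]
      · simp [GrMod.koszul, hw, h]
      · rcases lt_trichotomy k i with hk' | rfl | hk'
        · simp [GrMod.koszul, hw, hk.not_gt, hk.ne', hk', hk]
        · simp [GrMod.koszul, hw, hk.ne']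
        · simp [GrMod.koszul, hw, hk.not_gt, hk.ne', hk'.not_gt, hk'.ne']
    simp only [hT]
    rw [e₃, e₄, MultilinearMap.map_update_neg, Function.update_eq_self, neg_add_cancel]
  have hdiag (i : Fin n) : T i i = B.act o (Function.update x i (δ (δ (x i)))) := by
    have e : B.koszul i x (δ (x i)) i = δ (x i) := by simp [GrMod.koszul]
    simp only [hT, e, GrMod.koszul_self_of_sgn]
  have h₁ : δ (δ (B.act o x)) = ∑ i, ∑ l, T i l := by
    rw [hδ.leibniz, map_add, hδ.leibniz, (O.obj n).d_d, map_zero, zero_apply, zero_add, map_sum,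
      ← Finset.sum_add_distrib]
    refine Finset.sum_congr rfl fun i _ => ?_
    rw [hδ.leibniz, GrMod.map_sgn_of_degree_neg_one (O.obj n).d (O.obj n).d_mem, map_neg,
      neg_apply, add_neg_cancel_left]
    simp only [GrMod.sgn_sgn]
    rfl
  have h₂ : ∑ i, ∑ l, T i l = ∑ i, T i i := by
    rw [← Finset.sum_product', ← Finset.sum_diag Finset.univ fun z : Fin n × Fin n => T z.1 z.2,
      Finset.univ_product_univ, ← Finset.sum_sdiff (Finset.subset_univ (Finset.diag Finset.univ))]
    rw [add_eq_right]
    refine Finset.sum_involution (fun z _ => z.swap) ?_ ?_ ?_ ?_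
    · rintro ⟨i, l⟩ h
      have h' : i ≠ l := by simpa using h
      rcases lt_or_gt_of_ne h' with h' | h'
      · exact (add_comm _ _).trans (hlt l i h')
      · exact hlt i l h'
    · rintro ⟨i, l⟩ h _ e
      have h' : i ≠ l := by simpa using h
      exact h' (congrArg Prod.snd e)
    · rintro ⟨i, l⟩ h
      have h' : i ≠ l := by simpa using h
      simpa using h'.symm
    · rintro ⟨i, l⟩ _; rfl
  rw [h₁, h₂]
  exact Finset.sum_congr rfl fun i _ => hdiag i

theorem IsDerivation.sq_eq_zero {B : GrAlg O} {δ : B.carrier →ₗ[R] B.carrier}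
    (hδ : B.IsDerivation δ) {S : Set B.carrier} (h : ∀ x ∈ S, δ (δ x) = 0) {x : B.carrier}
    (hx : x ∈ B.adjoin S) : δ (δ x) = 0 := by
  refine adjoin_le (T := LinearMap.ker (δ ∘ₗ δ)) h (fun n o x hx => ?_) hx
  simp only [LinearMap.mem_ker, LinearMap.comp_apply] at hx ⊢
  rw [hδ.sq_act]
  refine Finset.sum_eq_zero fun i _ => ?_
  rw [hx]
  exact MultilinearMap.map_update_zero _ _ _

/-- A graded algebra with a derivation of square zero, as an `O`-algebra. -/
def withDerivation (B : GrAlg O) (δ : B.carrier →ₗ[R] B.carrier) (hδ : B.IsDerivation δ)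
    (h : ∀ x, δ (δ x) = 0) : OAlg O where
  toGrAlg := B
  d := δ
  d_mem := hδ.mem
  d_d := h
  d_act p q o x ho hx := by
    rw [hδ.leibniz]
    exact congrArg _ (Finset.sum_congr rfl fun i _ => B.act_koszul i ho hx _)

end GrAlg

namespace OAlg

variable {R : Type u} [CommRing R] {O : Operad R}

/-- The differential satisfies the Leibniz rule for arbitrary elements, by multilinearity. -/
theorem isDerivation (A : OAlg O) : A.toGrAlg.IsDerivation A.d where
  mem := A.d_mem
  leibniz {n} o x := by
    induction o using GrMod.induction_on with
    | mem p o ho =>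
      have h : A.d.compMultilinearMap (A.act o) = A.act ((O.obj n).d o) +
          ∑ i, (A.act ((O.obj n).sgn o)).compLinearMap fun l =>
            A.toGrAlg.koszulLin i l ∘ₗ LinearMap.prod LinearMap.id A.d := by
        refine A.multilinear_ext fun q x hx => ?_
        have e (i : Fin n) : (fun l => A.toGrAlg.koszulLin i l
            ((LinearMap.prod LinearMap.id A.d) (x l))) = A.koszul i x (A.d (x i)) :=
          A.toGrAlg.koszulLin_apply i fun l => (x l, A.d (x l))
        refine (A.d_act p q o x ho hx).trans ?_
        simp only [add_apply, sum_apply, MultilinearMap.compLinearMap_apply, LinearMap.comp_apply,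
          e]
        exact congrArg _ (Finset.sum_congr rfl fun i _ => (A.act_koszul i ho hx _).symm)
      have hx := DFunLike.congr_fun h x
      refine hx.trans ?_
      simp only [add_apply, sum_apply, MultilinearMap.compLinearMap_apply, LinearMap.comp_apply]
      exact congrArg _ (Finset.sum_congr rfl fun i _ =>
        congrArg _ (A.toGrAlg.koszulLin_apply i fun l => (x l, A.d (x l))))
    | add o o' ho ho' =>
      simp only [map_add, add_apply, ho, ho', Finset.sum_add_distrib]
      abel

theorem hom_ext {A B : OAlg O} {f g : A ⟶ B} (h : ∀ x, lin f x = lin g x) : f = g := by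
  have key : ∀ f g : OAlg.Hom A B, (∀ x, f.toLin x = g.toLin x) → f = g := by
    rintro ⟨f, _⟩ ⟨g, _⟩ h
    congr
    exact GrAlg.Hom.ext' h
  exact key f g h

end OAlg

/-! ### Homogeneous bases adapted to a filtration -/

/-- A basis of `V` by homogeneous elements, in which each basis element has a level such that `F k`
is spanned by the basis elements of level at most `k`. -/
structure CellBasis {R : Type u} [CommRing R] (V : GrMod R) (F : ℕ → Submodule R V.carrier) where
  index : Type u
  basis : Module.Basis index R V.carrier
  deg : index → ℤ
  lev : index → ℕ
  basis_mem : ∀ i, basis i ∈ V.gr (deg i)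
  span_eq : ∀ k, Submodule.span R (basis '' {i | lev i ≤ k}) = F k

namespace IsCellFiltration

variable {R : Type u} [CommRing R] {V : GrMod R} {F : ℕ → Submodule R V.carrier}

theorem prevStage_le (hF : IsCellFiltration V F) (k : ℕ) : prevStage F k ≤ F k := by
  cases k with
  | zero => exact bot_le
  | succ k => exact hF.mono k.le_succ

theorem le_prevStage (hF : IsCellFiltration V F) {k l : ℕ} (h : k < l) : F k ≤ prevStage F l := by
  cases l with
  | zero => exact absurd h (Nat.not_lt_zero k)
  | succ l => exact hF.mono (Nat.le_of_lt_succ h)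

/-- Lifting bases of the homogeneous components of all the quotients `V(k)/V(k-1)` gives a basis. -/
theorem nonempty_cellBasis (hF : IsCellFiltration V F) : Nonempty (CellBasis V F) := by
  classical
  let Q (z : ℕ × ℤ) := ↥(F z.1 ⊓ V.gr z.2) ⧸
    (prevStage F z.1 ⊓ V.gr z.2).submoduleOf (F z.1 ⊓ V.gr z.2)
  have (z : ℕ × ℤ) : Module.Free R (Q z) := hF.free z.1 z.2
  let J (z : ℕ × ℤ) := Module.Free.ChooseBasisIndex R (Q z)
  let e (z : ℕ × ℤ) : Module.Basis (J z) R (Q z) := Module.Free.chooseBasis R (Q z)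
  let π (z : ℕ × ℤ) : ↥(F z.1 ⊓ V.gr z.2) →ₗ[R] Q z := Submodule.mkQ _
  choose c hc using fun (z : ℕ × ℤ) (j : J z) =>
    (Submodule.mkQ_surjective _ : Function.Surjective (π z)) (e z j)
  let C (i : Σ z, J z) : V.carrier := c i.1 i.2
  have hCF (i : Σ z, J z) : C i ∈ F i.1.1 := (c i.1 i.2).2.1
  have hCV (i : Σ z, J z) : C i ∈ V.gr i.1.2 := (c i.1 i.2).2.2
  -- spanning
  have hspan₁ (k : ℕ) (p : ℤ) :
      F k ⊓ V.gr p ≤ Submodule.span R (C '' {i | i.1.1 ≤ k}) := by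
    induction k using Nat.strong_induction_on with
    | _ k ih =>
      intro x hx
      let y : ↥(F k ⊓ V.gr p) := ((e (k, p)).repr (π (k, p) ⟨x, hx⟩)).sum
        fun j r => r • c (k, p) j
      have hy : π (k, p) y = π (k, p) ⟨x, hx⟩ := by
        refine Eq.trans ?_ ((e (k, p)).linearCombination_repr _)
        rw [Finsupp.linearCombination_apply, map_finsuppSum]
        refine Finsupp.sum_congr fun j _ => ?_
        rw [map_smul, hc]
      have h₁ : x - y ∈ prevStage F k ⊓ V.gr p :=
        (Submodule.Quotient.eq ((prevStage F k ⊓ V.gr p).submoduleOf (F k ⊓ V.gr p))).1 hy.symm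
      have h₂ : x - y ∈ Submodule.span R (C '' {i | i.1.1 ≤ k}) := by
        cases k with
        | zero =>
          rw [(Submodule.mem_bot R).1 h₁.1]
          exact zero_mem _
        | succ k =>
          exact Submodule.span_mono (Set.image_mono fun i hi => Nat.le_succ_of_le hi)
            (ih k k.lt_succ_self h₁)
      have h₃ : (y : V.carrier) ∈ Submodule.span R (C '' {i | i.1.1 ≤ k}) := by
        simp only [y, Finsupp.sum, AddSubmonoidClass.coe_finsetSum, Submodule.coe_smul]
        exact Submodule.sum_mem _ fun j _ => Submodule.smul_mem _ _
          (Submodule.subset_span ⟨⟨(k, p), j⟩, le_refl k, rfl⟩)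
      simpa using add_mem h₂ h₃
  have hspan₂ (k : ℕ) : Submodule.span R (C '' {i | i.1.1 ≤ k}) = F k := by
    refine le_antisymm (Submodule.span_le.2 ?_) ?_
    · rintro _ ⟨i, hi, rfl⟩
      exact hF.mono hi (hCF i)
    · rw [hF.graded k]
      exact iSup_le (hspan₁ k)
  have hspan : ⊤ ≤ Submodule.span R (Set.range C) := fun v _ => by
    obtain ⟨k, hk⟩ := hF.exhaustive v
    rw [← hspan₂] at hk
    exact Submodule.span_mono (Set.image_subset_range _ _) hk
  -- the elements of a given level and degree are independent modulo the preceding stage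
  have hli (z : ℕ × ℤ) :
      LinearIndependent R fun j => (prevStage F z.1).mkQ (C ⟨z, j⟩) := by
    let f : Q z →ₗ[R] V.carrier ⧸ prevStage F z.1 :=
      Submodule.mapQ _ _ (F z.1 ⊓ V.gr z.2).subtype fun x hx => hx.1
    have hf : LinearMap.ker f = ⊥ := by
      rw [LinearMap.ker_eq_bot']
      intro x hx
      obtain ⟨x, rfl⟩ := Submodule.mkQ_surjective _ x
      refine (Submodule.Quotient.mk_eq_zero _).2 ⟨?_, x.2.2⟩
      exact (Submodule.Quotient.mk_eq_zero _).1 hx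
    have h := (e z).linearIndependent.map' f hf
    have hfe : f ∘ e z = fun j => (prevStage F z.1).mkQ (C ⟨z, j⟩) := by
      ext j
      rw [Function.comp_apply, ← hc]
      rfl
    rwa [hfe] at h
  have hind : ∀ (N : ℕ) (l : (Σ z, J z) →₀ R), (∀ i ∈ l.support, i.1.1 < N) →
      Finsupp.linearCombination R C l = 0 → l = 0 := by
    intro N
    induction N with
    | zero =>
      intro l hl _
      exact Finsupp.support_eq_empty.1 (Finset.eq_empty_of_forall_notMem
        fun i hi => Nat.not_lt_zero _ (hl i hi))
    | succ N ih =>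
      intro l hl hl'
      refine ih l (fun i hi => lt_of_le_of_ne (Nat.le_of_lt_succ (hl i hi)) fun hN => ?_) hl'
      have hsplit : l.split i.1 = 0 := by
        refine linearIndependent_iff.1 (hli i.1) _ ?_
        have h := congrArg ((prevStage F i.1.1).mkQ ∘ₗ V.proj i.1.2) hl'
        rw [map_zero, Finsupp.linearCombination_apply, map_finsuppSum, Finsupp.sigma_sum] at h
        rw [Finset.sum_eq_single i.1] at h
        · rw [Finsupp.linearCombination_apply, ← h]
          refine Finsupp.sum_congr fun j _ => ?_
          rw [map_smul, LinearMap.comp_apply, V.proj_of_mem (hCV ⟨i.1, j⟩)]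
        · intro z _ hz
          refine Finset.sum_eq_zero fun j hj => ?_
          have hj' : (⟨z, j⟩ : Σ z, J z) ∈ l.support :=
            Finsupp.mem_support_iff.2 (Finsupp.mem_support_iff.1 hj :)
          have hlev : z.1 ≤ N := Nat.le_of_lt_succ (hl _ hj')
          beta_reduce
          rw [map_smul, LinearMap.comp_apply]
          by_cases hp : z.2 = i.1.2
          · have hlt : z.1 < i.1.1 := hN ▸ lt_of_le_of_ne hlev fun e =>
              hz (Prod.ext (e.trans hN.symm) hp)
            rw [V.proj_of_mem (hp ▸ hCV ⟨z, j⟩), Submodule.mkQ_apply,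
              (Submodule.Quotient.mk_eq_zero _).2 (hF.le_prevStage hlt (hCF ⟨z, j⟩)), smul_zero]
          · rw [V.proj_of_mem_ne hp (hCV ⟨z, j⟩), map_zero, smul_zero]
        · intro hz
          rw [Finsupp.mem_splitSupport_iff_nonzero, not_not] at hz
          rw [hz, Finsupp.sum_zero_index]
      exact Finsupp.mem_support_iff.1 hi (DFunLike.congr_fun hsplit i.2)
  have hC : LinearIndependent R C := by
    refine linearIndependent_iff.2 fun l hl => ?_
    refine hind (l.support.sup (fun i => i.1.1) + 1) l (fun i hi => Nat.lt_succ_of_le ?_) hl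
    exact Finset.le_sup (f := fun i : Σ z, J z => i.1.1) hi
  exact ⟨{  index := Σ z, J z
            basis := Module.Basis.mk hC hspan
            deg := fun i => i.1.2
            lev := fun i => i.1.1
            basis_mem := fun i => by rw [Module.Basis.mk_apply]; exact hCV i
            span_eq := fun k => by rw [Module.Basis.coe_mk]; exact hspan₂ k }⟩

end IsCellFiltration

namespace CellBasis

variable {R : Type u} [CommRing R] {V : GrMod R} {F : ℕ → Submodule R V.carrier}

theorem basis_mem_stage (b : CellBasis V F) {i : b.index} {k : ℕ} (h : b.lev i ≤ k) :
    b.basis i ∈ F k :=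
  b.span_eq k ▸ Submodule.subset_span ⟨i, h, rfl⟩

theorem stage_le (b : CellBasis V F) {k : ℕ} {T : Submodule R V.carrier}
    (h : ∀ i, b.lev i ≤ k → b.basis i ∈ T) : F k ≤ T := by
  rw [← b.span_eq k, Submodule.span_le]
  rintro _ ⟨i, hi, rfl⟩
  exact h i hi

theorem gr_le (b : CellBasis V F) {p : ℤ} {T : Submodule R V.carrier}
    (h : ∀ i, b.deg i = p → b.basis i ∈ T) : V.gr p ≤ T := by
  intro v hv
  rw [← V.proj_of_mem hv, ← b.basis.linearCombination_repr v, Finsupp.linearCombination_apply,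
    map_finsuppSum]
  refine Submodule.sum_mem _ fun i _ => ?_
  beta_reduce
  rw [map_smul]
  refine Submodule.smul_mem _ _ ?_
  by_cases hi : b.deg i = p
  · rw [V.proj_of_mem (hi ▸ b.basis_mem i)]; exact h i hi
  · rw [V.proj_of_mem_ne hi (b.basis_mem i)]; exact zero_mem _

/-- The linear map with given values on the basis. -/
noncomputable def constr (b : CellBasis V F) {N : Type*} [AddCommGroup N] [Module R N]
    (f : b.index → N) : V.carrier →ₗ[R] N :=
  b.basis.constr ℕ f

theorem constr_basis (b : CellBasis V F) {N : Type*} [AddCommGroup N] [Module R N]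
    (f : b.index → N) (i : b.index) : b.constr f (b.basis i) = f i :=
  b.basis.constr_basis ℕ f i

theorem constr_mem (b : CellBasis V F) {N : GrMod R} {f : b.index → N.carrier} {c : ℤ}
    (h : ∀ i, f i ∈ N.gr (b.deg i + c)) {p : ℤ} {v : V.carrier} (hv : v ∈ V.gr p) :
    b.constr f v ∈ N.gr (p + c) :=
  b.gr_le (T := (N.gr (p + c)).comap (b.constr f))
    (fun i hi => by rw [Submodule.mem_comap, constr_basis, ← hi]; exact h i) hv

theorem basis_mem_prevStage (b : CellBasis V F) {i : b.index} {k : ℕ} (h : b.lev i < k) :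
    b.basis i ∈ prevStage F k := by
  cases k with
  | zero => exact absurd h (Nat.not_lt_zero _)
  | succ k => exact b.basis_mem_stage (Nat.le_of_lt_succ h)

theorem prevStage_le (b : CellBasis V F) {k : ℕ} {T : Submodule R V.carrier}
    (h : ∀ i, b.lev i < k → b.basis i ∈ T) : prevStage F k ≤ T := by
  cases k with
  | zero => exact bot_le
  | succ k => exact b.stage_le fun i hi => h i (Nat.lt_succ_of_le hi)

theorem lin_ext (b : CellBasis V F) {N : Type*} [AddCommGroup N] [Module R N]
    {f g : V.carrier →ₗ[R] N} (h : ∀ i, f (b.basis i) = g (b.basis i)) (v : V.carrier) :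
    f v = g v :=
  LinearMap.congr_fun (b.basis.ext h) v

theorem mem_of_basis_mem (b : CellBasis V F) {N : Type*} [AddCommGroup N] [Module R N]
    (f : V.carrier →ₗ[R] N) {T : Submodule R N} (h : ∀ i, f (b.basis i) ∈ T) (v : V.carrier) :
    f v ∈ T := by
  have : ⊤ ≤ T.comap f := by
    rw [← b.basis.span_eq, Submodule.span_le]
    rintro _ ⟨i, rfl⟩
    exact h i
  exact this Submodule.mem_top

open Classical in
/-- The projection to `V(k-1)` that kills the basis elements of level at least `k`. -/
noncomputable def trunc (b : CellBasis V F) (k : ℕ) : V.Hom V where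
  toLin := b.constr fun i => if b.lev i < k then b.basis i else 0
  map_mem p v hv := by
    have := b.constr_mem (N := V) (c := 0)
      (f := fun i => if b.lev i < k then b.basis i else 0) (fun i => ?_) hv
    · rwa [add_zero] at this
    · split_ifs
      · rw [add_zero]; exact b.basis_mem i
      · exact zero_mem _

theorem trunc_basis_of_lt (b : CellBasis V F) {k : ℕ} {i : b.index} (h : b.lev i < k) :
    (b.trunc k).toLin (b.basis i) = b.basis i :=
  (b.constr_basis _ i).trans (if_pos h)

theorem trunc_basis_of_le (b : CellBasis V F) {k : ℕ} {i : b.index} (h : k ≤ b.lev i) :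
    (b.trunc k).toLin (b.basis i) = 0 :=
  (b.constr_basis _ i).trans (if_neg h.not_gt)

theorem trunc_of_mem (b : CellBasis V F) {k : ℕ} {v : V.carrier} (hv : v ∈ prevStage F k) :
    (b.trunc k).toLin v = v :=
  b.prevStage_le (T := LinearMap.eqLocus (b.trunc k).toLin LinearMap.id)
    (fun _ hi => b.trunc_basis_of_lt hi) hv

theorem trunc_mem (b : CellBasis V F) (k : ℕ) (v : V.carrier) :
    (b.trunc k).toLin v ∈ prevStage F k := by
  refine b.mem_of_basis_mem _ (fun i => ?_) v
  rcases lt_or_ge (b.lev i) k with h | h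
  · rw [b.trunc_basis_of_lt h]; exact b.basis_mem_prevStage h
  · rw [b.trunc_basis_of_le h]; exact zero_mem _

end CellBasis

/-! ### The cylinder of a cell algebra -/

section Cylinder

variable {R : Type u} [CommRing R] {O : Operad R} {V : GrMod R}

/-- The generators `V' ⊕ V'' ⊕ sV` of the cylinder. -/
abbrev cylGen (V : GrMod R) : GrMod R := (V.prod V).prod V.susp

/-- The graded algebra `O(V' ⊕ V'' ⊕ sV)`. -/
noncomputable abbrev cylAlg (O : Operad R) (V : GrMod R) : GrAlg O := O.freeAlg (cylGen V)

variable (O V)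

/-- The inclusion `x ↦ x'`. -/
noncomputable def cylFst : V.Hom (cylAlg O V).toGrMod where
  toLin := (O.freeι (cylGen V)).toLin ∘ₗ LinearMap.inl R _ _ ∘ₗ LinearMap.inl R _ _
  map_mem p _ hv := (O.freeι (cylGen V)).map_mem p _ ⟨⟨hv, zero_mem _⟩, zero_mem _⟩

/-- The inclusion `x ↦ x''`. -/
noncomputable def cylSnd : V.Hom (cylAlg O V).toGrMod where
  toLin := (O.freeι (cylGen V)).toLin ∘ₗ LinearMap.inl R _ _ ∘ₗ LinearMap.inr R _ _
  map_mem p _ hv := (O.freeι (cylGen V)).map_mem p _ ⟨⟨zero_mem _, hv⟩, zero_mem _⟩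

/-- The inclusion `sx ↦ sx`. -/
noncomputable def cylSusp : V.susp.Hom (cylAlg O V).toGrMod where
  toLin := (O.freeι (cylGen V)).toLin ∘ₗ LinearMap.inr R _ _
  map_mem p _ hv := (O.freeι (cylGen V)).map_mem p _ ⟨zero_mem _, hv⟩

theorem freeι_cylGen :
    O.freeι (cylGen V) = ((cylFst O V).coprod (cylSnd O V)).coprod (cylSusp O V) := by
  ext ⟨⟨x, y⟩, z⟩
  change _ = ((O.freeι (cylGen V)).toLin ((x, 0), 0) + (O.freeι (cylGen V)).toLin ((0, y), 0)) +
    (O.freeι (cylGen V)).toLin ((0, 0), z)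
  rw [← map_add, ← map_add]
  simp

/-- The graded subalgebra of the cylinder generated by `T' ⊕ T'' ⊕ sT`. -/
noncomputable def cylStage (T : Submodule R V.carrier) : Submodule R (cylAlg O V).carrier :=
  (cylAlg O V).adjoin ((cylFst O V).toLin '' T ∪ (cylSnd O V).toLin '' T ∪ (cylSusp O V).toLin '' T)

variable {O V}

theorem cylFst_mem {T : Submodule R V.carrier} {v : V.carrier} (hv : v ∈ T) :
    (cylFst O V).toLin v ∈ cylStage O V T :=
  GrAlg.subset_adjoin _ _ (Or.inl (Or.inl ⟨v, hv, rfl⟩))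

theorem cylSnd_mem {T : Submodule R V.carrier} {v : V.carrier} (hv : v ∈ T) :
    (cylSnd O V).toLin v ∈ cylStage O V T :=
  GrAlg.subset_adjoin _ _ (Or.inl (Or.inr ⟨v, hv, rfl⟩))

theorem cylSusp_mem {T : Submodule R V.carrier} {v : V.carrier} (hv : v ∈ T) :
    (cylSusp O V).toLin v ∈ cylStage O V T :=
  GrAlg.subset_adjoin _ _ (Or.inr ⟨v, hv, rfl⟩)

theorem forall_cylStage {T : Submodule R V.carrier} {P : (cylAlg O V).carrier → Prop}
    (h₁ : ∀ v ∈ T, P ((cylFst O V).toLin v)) (h₂ : ∀ v ∈ T, P ((cylSnd O V).toLin v))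
    (h₃ : ∀ v ∈ T, P ((cylSusp O V).toLin v)) :
    ∀ x ∈ (cylFst O V).toLin '' (T : Set V.carrier) ∪ (cylSnd O V).toLin '' T ∪
      (cylSusp O V).toLin '' T, P x := by
  rintro _ ((⟨v, hv, rfl⟩ | ⟨v, hv, rfl⟩) | ⟨v, hv, rfl⟩)
  exacts [h₁ v hv, h₂ v hv, h₃ v hv]

theorem cylStage_mono {S T : Submodule R V.carrier} (h : S ≤ T) :
    cylStage O V S ≤ cylStage O V T :=
  GrAlg.adjoin_mono _ (Set.union_subset_union
    (Set.union_subset_union (Set.image_mono h) (Set.image_mono h)) (Set.image_mono h))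

theorem cylStage_eq (T : Submodule R V.carrier) :
    cylStage O V T = (cylAlg O V).adjoin
      ((((cylFst O V).coprod (cylSnd O V)).coprod (cylSusp O V)).toLin ''
        ((T.prod T).prod T : Submodule R ((V.carrier × V.carrier) × V.carrier))) := by
  refine le_antisymm (GrAlg.adjoin_mono _ (forall_cylStage ?_ ?_ ?_))
    (GrAlg.adjoin_le ?_ fun _ => GrAlg.act_mem_adjoin _ _)
  · intro v hv
    exact ⟨((v, 0), 0), ⟨⟨hv, zero_mem _⟩, zero_mem _⟩, by simp [GrMod.Hom.coprod]⟩
  · intro v hv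
    exact ⟨((0, v), 0), ⟨⟨zero_mem _, hv⟩, zero_mem _⟩, by simp [GrMod.Hom.coprod]⟩
  · intro v hv
    exact ⟨((0, 0), v), ⟨⟨zero_mem _, zero_mem _⟩, hv⟩, by simp [GrMod.Hom.coprod]⟩
  · rintro _ ⟨⟨⟨x, y⟩, z⟩, ⟨⟨hx, hy⟩, hz⟩, rfl⟩
    exact add_mem (add_mem (cylFst_mem hx) (cylSnd_mem hy)) (cylSusp_mem hz)

theorem cylStage_top : cylStage O V ⊤ = ⊤ := by
  rw [cylStage_eq, ← freeι_cylGen, Submodule.prod_top, Submodule.prod_top, Submodule.top_coe,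
    Set.image_univ, Operad.adjoin_range_freeι]

theorem mem_cylStage_top (x : (cylAlg O V).carrier) : x ∈ cylStage O V ⊤ :=
  cylStage_top (O := O) (V := V) ▸ Submodule.mem_top

theorem cylHom_eqOn {C : GrAlg O} {φ ψ : GrAlg.Hom (cylAlg O V) C} {T : Submodule R V.carrier}
    (h₁ : ∀ v ∈ T, φ.toLin ((cylFst O V).toLin v) = ψ.toLin ((cylFst O V).toLin v))
    (h₂ : ∀ v ∈ T, φ.toLin ((cylSnd O V).toLin v) = ψ.toLin ((cylSnd O V).toLin v))
    (h₃ : ∀ v ∈ T, φ.toLin ((cylSusp O V).toLin v) = ψ.toLin ((cylSusp O V).toLin v))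
    {x : (cylAlg O V).carrier} (hx : x ∈ cylStage O V T) : φ.toLin x = ψ.toLin x :=
  GrAlg.Hom.eqOn_adjoin (forall_cylStage h₁ h₂ h₃) hx

/-- The morphism out of the cylinder with given values on the generators. -/
noncomputable def cylLift {C : GrAlg O} (f g : V.Hom C.toGrMod) (e : V.susp.Hom C.toGrMod) :
    GrAlg.Hom (cylAlg O V) C :=
  (O.isFree_freeι (cylGen V)).lift ((f.coprod g).coprod e)

section lift

variable {C : GrAlg O} (f g : V.Hom C.toGrMod) (e : V.susp.Hom C.toGrMod) (v : V.carrier)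

theorem cylLift_fst : (cylLift f g e).toLin ((cylFst O V).toLin v) = f.toLin v :=
  ((O.isFree_freeι (cylGen V)).lift_apply _ _).trans (by simp [GrMod.Hom.coprod])

theorem cylLift_snd : (cylLift f g e).toLin ((cylSnd O V).toLin v) = g.toLin v :=
  ((O.isFree_freeι (cylGen V)).lift_apply _ _).trans (by simp [GrMod.Hom.coprod])

theorem cylLift_susp : (cylLift f g e).toLin ((cylSusp O V).toLin v) = e.toLin v :=
  ((O.isFree_freeι (cylGen V)).lift_apply _ _).trans (by simp [GrMod.Hom.coprod])

end lift

/-- A morphism of graded modules that vanishes. -/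
def GrMod.Hom.zero (M N : GrMod R) : M.Hom N where
  toLin := 0
  map_mem _ _ _ := zero_mem _

variable {G : GrAlg O} {ι : V.Hom G.toGrMod}

/-- The inclusion of `G = O(V)` in the cylinder with `x ↦ x'`. -/
noncomputable def cylIn₁ (hι : GrAlg.IsFree ι) : GrAlg.Hom G (cylAlg O V) := hι.lift (cylFst O V)

/-- The inclusion of `G = O(V)` in the cylinder with `x ↦ x''`. -/
noncomputable def cylIn₂ (hι : GrAlg.IsFree ι) : GrAlg.Hom G (cylAlg O V) := hι.lift (cylSnd O V)

/-- The projection of the cylinder to `G = O(V)`. -/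
noncomputable def cylProj (ι : V.Hom G.toGrMod) : GrAlg.Hom (cylAlg O V) G :=
  cylLift ι ι (GrMod.Hom.zero _ _)

theorem cylIn₁_ι (hι : GrAlg.IsFree ι) (v : V.carrier) :
    (cylIn₁ hι).toLin (ι.toLin v) = (cylFst O V).toLin v := hι.lift_apply _ v

theorem cylIn₂_ι (hι : GrAlg.IsFree ι) (v : V.carrier) :
    (cylIn₂ hι).toLin (ι.toLin v) = (cylSnd O V).toLin v := hι.lift_apply _ v

theorem cylProj_in₁ (hι : GrAlg.IsFree ι) (x : G.carrier) :
    (cylProj ι).toLin ((cylIn₁ hι).toLin x) = x :=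
  congrArg (fun φ : GrAlg.Hom G G => φ.toLin x)
    (hι.hom_ext (f := (cylProj ι).comp (cylIn₁ hι)) (g := GrAlg.Hom.id G) fun v => by
      change (cylProj ι).toLin ((cylIn₁ hι).toLin _) = _
      rw [cylIn₁_ι, cylProj, cylLift_fst]; rfl)

theorem cylProj_in₂ (hι : GrAlg.IsFree ι) (x : G.carrier) :
    (cylProj ι).toLin ((cylIn₂ hι).toLin x) = x :=
  congrArg (fun φ : GrAlg.Hom G G => φ.toLin x)
    (hι.hom_ext (f := (cylProj ι).comp (cylIn₂ hι)) (g := GrAlg.Hom.id G) fun v => by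
      change (cylProj ι).toLin ((cylIn₂ hι).toLin _) = _
      rw [cylIn₂_ι, cylProj, cylLift_snd]; rfl)

theorem cylIn₁_mem (hι : GrAlg.IsFree ι) {T : Submodule R V.carrier} {x : G.carrier}
    (hx : x ∈ G.adjoin (ι.toLin '' T)) : (cylIn₁ hι).toLin x ∈ cylStage O V T := by
  refine (cylIn₁ hι).map_mem_adjoin ?_ hx
  rintro _ ⟨v, hv, rfl⟩
  rw [cylIn₁_ι]; exact cylFst_mem hv

theorem cylIn₂_mem (hι : GrAlg.IsFree ι) {T : Submodule R V.carrier} {x : G.carrier}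
    (hx : x ∈ G.adjoin (ι.toLin '' T)) : (cylIn₂ hι).toLin x ∈ cylStage O V T := by
  refine (cylIn₂ hι).map_mem_adjoin ?_ hx
  rintro _ ⟨v, hv, rfl⟩
  rw [cylIn₂_ι]; exact cylSnd_mem hv

end Cylinder

section CylinderDifferential

variable {R : Type u} [CommRing R] {O : Operad R} {V : GrMod R} {G : GrAlg O}
  {ι : V.Hom G.toGrMod} {d : G.carrier →ₗ[R] G.carrier}

theorem exists_cylDiff (hι : GrAlg.IsFree ι) (hd : G.IsDerivation d)
    (h : V.Hom (cylAlg O V).toGrMod) :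
    ∃ δ : (cylAlg O V).carrier →ₗ[R] (cylAlg O V).carrier, (cylAlg O V).IsDerivation δ ∧
      (∀ v, δ ((cylFst O V).toLin v) = (cylIn₁ hι).toLin (d (ι.toLin v))) ∧
      (∀ v, δ ((cylSnd O V).toLin v) = (cylIn₂ hι).toLin (d (ι.toLin v))) ∧
      ∀ v, δ ((cylSusp O V).toLin v) =
        (cylFst O V).toLin v - (cylSnd O V).toLin v - h.toLin v := by
  obtain ⟨δ, hδ, hg⟩ := (O.isFree_freeι (cylGen V)).exists_derivation
    ((((cylIn₁ hι).toLin ∘ₗ d ∘ₗ ι.toLin).coprod ((cylIn₂ hι).toLin ∘ₗ d ∘ₗ ι.toLin)).coprod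
      ((cylFst O V).toLin - (cylSnd O V).toLin - h.toLin)) (by
      rintro p ⟨⟨x, y⟩, z⟩ ⟨⟨hx, hy⟩, hz⟩
      refine add_mem (add_mem ?_ ?_) (sub_mem (sub_mem ?_ ?_) ?_)
      · exact (cylIn₁ hι).map_mem _ _ (hd.mem _ _ (ι.map_mem _ _ hx))
      · exact (cylIn₂ hι).map_mem _ _ (hd.mem _ _ (ι.map_mem _ _ hy))
      · exact (cylFst O V).map_mem _ _ hz
      · exact (cylSnd O V).map_mem _ _ hz
      · exact h.map_mem _ _ hz)
  refine ⟨δ, hδ, fun v => (hg _).trans ?_, fun v => (hg _).trans ?_, fun v => (hg _).trans ?_⟩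
  all_goals simp

/-- The derivation of `O(V' ⊕ V'' ⊕ sV)` which extends the differentials of the two copies of `G`,
and for which `d(sx) = x' - x'' - h(x)`. -/
noncomputable def cylDiff (hι : GrAlg.IsFree ι) (hd : G.IsDerivation d)
    (h : V.Hom (cylAlg O V).toGrMod) : (cylAlg O V).carrier →ₗ[R] (cylAlg O V).carrier :=
  (exists_cylDiff hι hd h).choose

variable (hι : GrAlg.IsFree ι) (hd : G.IsDerivation d) (h : V.Hom (cylAlg O V).toGrMod)

theorem isDerivation_cylDiff : (cylAlg O V).IsDerivation (cylDiff hι hd h) :=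
  (exists_cylDiff hι hd h).choose_spec.1

theorem cylDiff_fst (v : V.carrier) : cylDiff hι hd h ((cylFst O V).toLin v) =
    (cylIn₁ hι).toLin (d (ι.toLin v)) := (exists_cylDiff hι hd h).choose_spec.2.1 v

theorem cylDiff_snd (v : V.carrier) : cylDiff hι hd h ((cylSnd O V).toLin v) =
    (cylIn₂ hι).toLin (d (ι.toLin v)) := (exists_cylDiff hι hd h).choose_spec.2.2.1 v

theorem cylDiff_susp (v : V.carrier) : cylDiff hι hd h ((cylSusp O V).toLin v) =
    (cylFst O V).toLin v - (cylSnd O V).toLin v - h.toLin v :=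
  (exists_cylDiff hι hd h).choose_spec.2.2.2 v

theorem cylIn₁_d (x : G.carrier) :
    (cylIn₁ hι).toLin (d x) = cylDiff hι hd h ((cylIn₁ hι).toLin x) := by
  refine hd.map_eqOn_adjoin (isDerivation_cylDiff hι hd h) (cylIn₁ hι)
    (S := Set.range ι.toLin) ?_ (hι.adjoin_eq_top ▸ Submodule.mem_top)
  rintro _ ⟨v, rfl⟩
  rw [cylIn₁_ι, cylDiff_fst]

theorem cylIn₂_d (x : G.carrier) :
    (cylIn₂ hι).toLin (d x) = cylDiff hι hd h ((cylIn₂ hι).toLin x) := by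
  refine hd.map_eqOn_adjoin (isDerivation_cylDiff hι hd h) (cylIn₂ hι)
    (S := Set.range ι.toLin) ?_ (hι.adjoin_eq_top ▸ Submodule.mem_top)
  rintro _ ⟨v, rfl⟩
  rw [cylIn₂_ι, cylDiff_snd]

/-- The condition that `h` be the correction term of a cylinder: `h(V(k))` involves only the
preceding stage, `h` dies in `G`, and the derivation `cylDiff` has square zero. -/
structure IsCylCorrection (F : ℕ → Submodule R V.carrier) : Prop where
  mem_stage : ∀ k, ∀ v ∈ F k, h.toLin v ∈ cylStage O V (prevStage F k)
  proj : ∀ v, (cylProj ι).toLin (h.toLin v) = 0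
  d_eq : ∀ v, cylDiff hι hd h (h.toLin v) =
    (cylIn₁ hι).toLin (d (ι.toLin v)) - (cylIn₂ hι).toLin (d (ι.toLin v))

variable {hι hd h} {F : ℕ → Submodule R V.carrier}

theorem IsCylCorrection.d_d (hh : IsCylCorrection hι hd h F) (hdd : ∀ x, d (d x) = 0)
    (x : (cylAlg O V).carrier) :
    cylDiff hι hd h (cylDiff hι hd h x) = 0 := by
  refine (isDerivation_cylDiff hι hd h).sq_eq_zero (forall_cylStage ?_ ?_ ?_) (mem_cylStage_top x)
  · intro v _
    rw [cylDiff_fst, ← cylIn₁_d, hdd, map_zero]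
  · intro v _
    rw [cylDiff_snd, ← cylIn₂_d, hdd, map_zero]
  · intro v _
    rw [cylDiff_susp, map_sub, map_sub, cylDiff_fst, cylDiff_snd, hh.d_eq, sub_self]

theorem IsCylCorrection.proj_d (hh : IsCylCorrection hι hd h F) (x : (cylAlg O V).carrier) :
    (cylProj ι).toLin (cylDiff hι hd h x) = d ((cylProj ι).toLin x) := by
  refine (isDerivation_cylDiff hι hd h).map_eqOn_adjoin hd (cylProj ι)
    (forall_cylStage ?_ ?_ ?_) (mem_cylStage_top x)
  · intro v _
    rw [cylDiff_fst, cylProj_in₁, cylProj, cylLift_fst]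
  · intro v _
    rw [cylDiff_snd, cylProj_in₂, cylProj, cylLift_snd]
  · intro v _
    rw [cylDiff_susp, map_sub, map_sub, hh.proj, cylProj, cylLift_fst, cylLift_snd, cylLift_susp,
      sub_self, sub_zero]
    exact (map_zero d).symm

end CylinderDifferential

section CylinderAlgebra

variable {R : Type u} [CommRing R] {O : Operad R} {V : GrMod R} {A : OAlg O}
  {ι : V.Hom A.toGrMod} {hι : GrAlg.IsFree (B := A.toGrAlg) ι} {h : V.Hom (cylAlg O V).toGrMod}
  {F : ℕ → Submodule R V.carrier}

/-- The cylinder, as an `O`-algebra. -/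
noncomputable def IsCylCorrection.cyl (hh : IsCylCorrection hι A.isDerivation h F) : OAlg O :=
  (cylAlg O V).withDerivation (cylDiff hι A.isDerivation h)
    (isDerivation_cylDiff hι A.isDerivation h) (hh.d_d A.d_d)

/-- The first inclusion `A → IA`. -/
noncomputable def IsCylCorrection.in₁ (hh : IsCylCorrection hι A.isDerivation h F) : A ⟶ hh.cyl :=
  OAlg.Hom.mk (cylIn₁ hι) (cylIn₁_d hι A.isDerivation h)

/-- The second inclusion `A → IA`. -/
noncomputable def IsCylCorrection.in₂ (hh : IsCylCorrection hι A.isDerivation h F) : A ⟶ hh.cyl :=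
  OAlg.Hom.mk (cylIn₂ hι) (cylIn₂_d hι A.isDerivation h)

/-- The projection `IA → A`. -/
noncomputable def IsCylCorrection.q (hh : IsCylCorrection hι A.isDerivation h F) : hh.cyl ⟶ A :=
  OAlg.Hom.mk (A := hh.cyl) (cylProj ι) hh.proj_d

theorem IsCylCorrection.in₁_q (hh : IsCylCorrection hι A.isDerivation h F) : hh.in₁ ≫ hh.q = 𝟙 A :=
  OAlg.hom_ext (cylProj_in₁ hι)

theorem IsCylCorrection.in₂_q (hh : IsCylCorrection hι A.isDerivation h F) : hh.in₂ ≫ hh.q = 𝟙 A :=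
  OAlg.hom_ext (cylProj_in₂ hι)

end CylinderAlgebra

/-! ### The lifting property of the inclusion of a cell algebra in its cylinder -/

section Lifting

variable {R : Type u} [CommRing R] {O : Operad R} {V : GrMod R} {A : OAlg O}
  {ι : V.Hom A.toGrMod} {hι : GrAlg.IsFree (B := A.toGrAlg) ι} {h : V.Hom (cylAlg O V).toGrMod}
  {F : ℕ → Submodule R V.carrier}

/-- A surjection of graded modules is surjective in each degree. -/
theorem GrMod.Hom.exists_of_surjective {M N : GrMod R} (f : M.Hom N)
    (hf : Function.Surjective f.toLin) {p : ℤ} {y : N.carrier} (hy : y ∈ N.gr p) :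
    ∃ x ∈ M.gr p, f.toLin x = y := by
  obtain ⟨x, rfl⟩ := hf y
  refine ⟨M.proj p x, M.proj_mem p x, ?_⟩
  rw [GrMod.map_proj f.toLin 0 (fun p x hx => by rw [add_zero]; exact f.map_mem p x hx), add_zero,
    N.proj_of_mem hy]

/-- The values of a lift on the generators `x''` have to satisfy a fixed point equation
`ψ(x) = f(x) - φ_ψ(h(x)) - d(e(x))`, where `φ_ψ` denotes the morphism of graded algebras determined
by the values `f`, `ψ` and `e` on the generators `x'`, `x''` and `sx`. As `h` lowers the filtration,
the iterates from `0` become stationary on each stage. -/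
theorem exists_cylLift_snd (b : CellBasis V F) (hF : IsCellFiltration V F)
    (hh : IsCylCorrection hι A.isDerivation h F) (E : OAlg O) (f : V.Hom E.toGrMod)
    (e : V.susp.Hom E.toGrMod) :
    ∃ ψ : V.Hom E.toGrMod, ∀ v, ψ.toLin v =
      f.toLin v - (cylLift (C := E.toGrAlg) f ψ e).toLin (h.toLin v) - E.d (e.toLin v) := by
  have he : ∀ p, ∀ v ∈ V.gr p, E.d (e.toLin v) ∈ E.gr p := fun p v hv => by
    have := E.d_mem (p + 1) _ (e.map_mem (p + 1) v (by
      change v ∈ V.gr (p + 1 - 1); rwa [add_sub_cancel_right]))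
    rwa [add_sub_cancel_right] at this
  let next (ψ : V.Hom E.toGrMod) : V.Hom E.toGrMod :=
    { toLin := f.toLin - (cylLift (C := E.toGrAlg) f ψ e).toLin ∘ₗ h.toLin -
        E.d ∘ₗ (e.toLin : V.carrier →ₗ[R] E.carrier)
      map_mem := fun p v hv => sub_mem (sub_mem (f.map_mem p v hv)
        ((cylLift (C := E.toGrAlg) f ψ e).map_mem p _ (h.map_mem p v hv))) (he p v hv) }
  have hagree (ψ ψ' : V.Hom E.toGrMod) (T : Submodule R V.carrier)
      (hT : ∀ v ∈ T, ψ.toLin v = ψ'.toLin v) (x : (cylAlg O V).carrier) (hx : x ∈ cylStage O V T) :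
      (cylLift (C := E.toGrAlg) f ψ e).toLin x = (cylLift (C := E.toGrAlg) f ψ' e).toLin x := by
    refine cylHom_eqOn (fun v hv => ?_) (fun v hv => ?_) (fun v hv => ?_) hx
    · rw [cylLift_fst, cylLift_fst]
    · rw [cylLift_snd, cylLift_snd, hT v hv]
    · rw [cylLift_susp, cylLift_susp]
  have hnext (ψ ψ' : V.Hom E.toGrMod) (k : ℕ)
      (hT : ∀ v ∈ prevStage F k, ψ.toLin v = ψ'.toLin v) (v : V.carrier) (hv : v ∈ F k) :
      (next ψ).toLin v = (next ψ').toLin v := by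
    change f.toLin v - (cylLift (C := E.toGrAlg) f ψ e).toLin (h.toLin v) - E.d (e.toLin v) =
      f.toLin v - (cylLift (C := E.toGrAlg) f ψ' e).toLin (h.toLin v) - E.d (e.toLin v)
    rw [hagree ψ ψ' _ hT _ (hh.mem_stage k v hv)]
  let seq (n : ℕ) : V.Hom E.toGrMod := next^[n] (GrMod.Hom.zero _ _)
  have hseq (n : ℕ) : seq (n + 1) = next (seq n) := Function.iterate_succ_apply' _ _ _
  have hstep (k : ℕ) : ∀ n, k ≤ n → ∀ v ∈ F k, (seq (n + 2)).toLin v = (seq (n + 1)).toLin v := by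
    induction k with
    | zero =>
      intro n _ v hv
      rw [hseq (n + 1), hseq n]
      refine hnext _ _ 0 (fun v hv => ?_) v hv
      rw [(Submodule.mem_bot R).1 hv, map_zero, map_zero]
    | succ k ih =>
      intro n hn v hv
      obtain ⟨n, rfl⟩ : ∃ m, n = m + 1 := ⟨n - 1, by omega⟩
      have e := hnext _ _ (k + 1) (ih n (by omega)) v hv
      rwa [← hseq, ← hseq] at e
  have hstable (k n : ℕ) (hn : k + 1 ≤ n) (v : V.carrier) (hv : v ∈ F k) :
      (seq n).toLin v = (seq (k + 1)).toLin v := by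
    induction n, hn using Nat.le_induction with
    | base => rfl
    | succ n hn ih =>
      obtain ⟨n, rfl⟩ : ∃ m, n = m + 1 := ⟨n - 1, by omega⟩
      rw [hstep k n (by omega) v hv, ih]
  let ψ : V.Hom E.toGrMod :=
    { toLin := b.constr fun i => (seq (b.lev i + 1)).toLin (b.basis i)
      map_mem := fun p v hv => by
        have := b.constr_mem (N := E.toGrMod) (c := 0)
          (f := fun i => (seq (b.lev i + 1)).toLin (b.basis i)) (fun i => by
            rw [add_zero]; exact (seq _).map_mem _ _ (b.basis_mem i)) hv
        rwa [add_zero] at this }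
  have hψ (k n : ℕ) (hn : k + 1 ≤ n) (v : V.carrier) (hv : v ∈ F k) :
      ψ.toLin v = (seq n).toLin v := by
    refine b.stage_le (T := LinearMap.eqLocus ψ.toLin (seq n).toLin) (fun i hi => ?_) hv
    rw [LinearMap.mem_eqLocus, hstable (b.lev i) n (by omega) _ (b.basis_mem_stage le_rfl)]
    exact b.constr_basis _ i
  refine ⟨ψ, fun v => ?_⟩
  obtain ⟨k, hk⟩ := hF.exhaustive v
  rw [hψ k (k + 2) (by omega) v hk, hseq (k + 1)]
  exact hnext _ ψ k (fun w hw => (hψ k (k + 1) le_rfl w (hF.prevStage_le k hw)).symm) v hk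

@[elab_as_elim]
theorem IsCellFiltration.induction (hF : IsCellFiltration V F) {P : V.carrier → Prop} (h₀ : P 0)
    (hP : ∀ k, (∀ v ∈ prevStage F k, P v) → ∀ v ∈ F k, P v) (v : V.carrier) : P v := by
  have key (k : ℕ) : ∀ v ∈ F k, P v := by
    induction k with
    | zero =>
      refine hP 0 fun v hv => ?_
      rw [(Submodule.mem_bot R).1 hv]
      exact h₀
    | succ k ih => exact hP (k + 1) ih
  obtain ⟨k, hk⟩ := hF.exhaustive v
  exact key k v hk

/-- In the cylinder, the generators `x''` are redundant up to preceding stages and boundaries. -/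
theorem cylSnd_eq (v : V.carrier) : (cylSnd O V).toLin v =
    (cylFst O V).toLin v - h.toLin v - cylDiff hι A.isDerivation h ((cylSusp O V).toLin v) := by
  rw [cylDiff_susp]; abel

/-- A morphism out of the cylinder that is compatible with the differential on the generators
`x'` and `sx` is a chain map. -/
theorem IsCylCorrection.hom_map_d (hF : IsCellFiltration V F)
    (hh : IsCylCorrection hι A.isDerivation h F)
    {E : OAlg O} {φ : GrAlg.Hom (cylAlg O V) E.toGrAlg}
    (h₁ : ∀ v, φ.toLin (cylDiff hι A.isDerivation h ((cylFst O V).toLin v)) =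
      E.d (φ.toLin ((cylFst O V).toLin v)))
    (h₃ : ∀ v, φ.toLin (cylDiff hι A.isDerivation h ((cylSusp O V).toLin v)) =
      E.d (φ.toLin ((cylSusp O V).toLin v))) (x : (cylAlg O V).carrier) :
    φ.toLin (cylDiff hι A.isDerivation h x) = E.d (φ.toLin x) := by
  have h₂ (v : V.carrier) : φ.toLin (cylDiff hι A.isDerivation h ((cylSnd O V).toLin v)) =
      E.d (φ.toLin ((cylSnd O V).toLin v)) := by
    induction v using hF.induction with
    | h₀ => simp only [map_zero]
    | hP k ih v hv =>
      have hdh : φ.toLin (cylDiff hι A.isDerivation h (h.toLin v)) = E.d (φ.toLin (h.toLin v)) :=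
        (isDerivation_cylDiff hι A.isDerivation h).map_eqOn_adjoin E.isDerivation φ
          (forall_cylStage (fun w _ => h₁ w) ih (fun w _ => h₃ w)) (hh.mem_stage k v hv)
      rw [cylSnd_eq (hι := hι) (h := h)]
      simp only [map_sub, hh.d_d A.d_d, sub_zero, h₁, hdh, h₃, E.d_d]
  exact (isDerivation_cylDiff hι A.isDerivation h).map_eqOn_adjoin E.isDerivation φ
    (forall_cylStage (fun w _ => h₁ w) (fun w _ => h₂ w) (fun w _ => h₃ w)) (mem_cylStage_top x)

/-- Morphisms out of the cylinder that agree on `x'`, `sx` and `d(sx)` are equal. -/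
theorem IsCylCorrection.hom_eq (hF : IsCellFiltration V F)
    (hh : IsCylCorrection hι A.isDerivation h F)
    {C : GrAlg O} {φ ψ : GrAlg.Hom (cylAlg O V) C}
    (h₁ : ∀ v, φ.toLin ((cylFst O V).toLin v) = ψ.toLin ((cylFst O V).toLin v))
    (h₃ : ∀ v, φ.toLin ((cylSusp O V).toLin v) = ψ.toLin ((cylSusp O V).toLin v))
    (hd : ∀ v, φ.toLin (cylDiff hι A.isDerivation h ((cylSusp O V).toLin v)) =
      ψ.toLin (cylDiff hι A.isDerivation h ((cylSusp O V).toLin v))) (x : (cylAlg O V).carrier) :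
    φ.toLin x = ψ.toLin x := by
  have h₂ (v : V.carrier) : φ.toLin ((cylSnd O V).toLin v) = ψ.toLin ((cylSnd O V).toLin v) := by
    induction v using hF.induction with
    | h₀ => simp only [map_zero]
    | hP k ih v hv =>
      have hh' : φ.toLin (h.toLin v) = ψ.toLin (h.toLin v) :=
        cylHom_eqOn (fun w _ => h₁ w) ih (fun w _ => h₃ w) (hh.mem_stage k v hv)
      rw [cylSnd_eq (hι := hι) (h := h), map_sub, map_sub, map_sub, map_sub, h₁, hd, hh']
  exact cylHom_eqOn (fun w _ => h₁ w) (fun w _ => h₂ w) (fun w _ => h₃ w) (mem_cylStage_top x)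

/-- The suspension of `V` is free, and hence projective, as a graded module. -/
theorem CellBasis.exists_susp_lift (b : CellBasis V F) {E X : GrMod R} (p : E.Hom X)
    (hp : Function.Surjective p.toLin) (g : V.susp.Hom X) :
    ∃ e : V.susp.Hom E, ∀ v, p.toLin (e.toLin v) = g.toLin v := by
  choose e₀ he₀ hpe₀ using fun i => p.exists_of_surjective hp
    (g.map_mem (b.deg i + 1) (b.basis i) (by
      change _ ∈ V.gr _
      rw [add_sub_cancel_right]; exact b.basis_mem i))
  refine ⟨{ toLin := b.constr e₀
            map_mem := fun q v hv => ?_ }, ?_⟩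
  · have := b.constr_mem he₀ hv
    rwa [sub_add_cancel] at this
  · exact b.lin_ext (f := p.toLin ∘ₗ b.constr e₀) (g := g.toLin) fun i => by
      refine Eq.trans ?_ (hpe₀ i)
      exact congrArg p.toLin (b.constr_basis _ i)

/-- The graded form of the lifting property: `sx` is mapped to any lift `e(x)` of its value, and the
value of `x''` is then determined by `d(sx) = x' - x'' - h(x)`. -/
theorem exists_cylHom_lift (b : CellBasis V F) (hF : IsCellFiltration V F)
    (hh : IsCylCorrection hι A.isDerivation h F) {E X : OAlg O} (p : E ⟶ X)
    (hp : Function.Surjective (OAlg.lin p)) (f : A ⟶ E)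
    (g : GrAlg.Hom (cylAlg O V) X.toGrAlg)
    (hsq : ∀ x, OAlg.lin p (OAlg.lin f x) = g.toLin ((cylIn₁ hι).toLin x))
    (hg : ∀ x, g.toLin (cylDiff hι A.isDerivation h x) = X.d (g.toLin x)) :
    ∃ φ : GrAlg.Hom (cylAlg O V) E.toGrAlg,
      (∀ x, φ.toLin (cylDiff hι A.isDerivation h x) = E.d (φ.toLin x)) ∧
      (∀ x, φ.toLin ((cylIn₁ hι).toLin x) = OAlg.lin f x) ∧
      ∀ x, OAlg.lin p (φ.toLin x) = g.toLin x := by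
  have hpd (x : E.carrier) : OAlg.lin p (E.d x) = X.d (OAlg.lin p x) := OAlg.Hom.map_d p x
  have hfd (x : A.carrier) : OAlg.lin f (A.d x) = E.d (OAlg.lin f x) := OAlg.Hom.map_d f x
  obtain ⟨e, hpe⟩ := b.exists_susp_lift (OAlg.grHom p).toGrModHom hp
    (g.toGrModHom.comp (cylSusp O V))
  obtain ⟨ψ, hψ⟩ := exists_cylLift_snd b hF hh E ((OAlg.grHom f).toGrModHom.comp ι) e
  obtain ⟨φ, hφ⟩ : ∃ φ : GrAlg.Hom (cylAlg O V) E.toGrAlg,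
    φ = cylLift (C := E.toGrAlg) ((OAlg.grHom f).toGrModHom.comp ι) ψ e := ⟨_, rfl⟩
  have hφ₁ (v : V.carrier) : φ.toLin ((cylFst O V).toLin v) = OAlg.lin f (ι.toLin v) := by
    rw [hφ, cylLift_fst]; rfl
  have hφ₂ (v : V.carrier) : φ.toLin ((cylSnd O V).toLin v) = ψ.toLin v := by
    rw [hφ, cylLift_snd]
  have hφ₃ (v : V.carrier) : φ.toLin ((cylSusp O V).toLin v) = e.toLin v := by
    rw [hφ, cylLift_susp]
  have hψ' (v : V.carrier) : ψ.toLin v =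
      OAlg.lin f (ι.toLin v) - φ.toLin (h.toLin v) - E.d (e.toLin v) := by
    rw [hφ]; exact hψ v
  have hφf (x : A.carrier) : φ.toLin ((cylIn₁ hι).toLin x) = OAlg.lin f x :=
    congrArg (fun χ : GrAlg.Hom A.toGrAlg E.toGrAlg => χ.toLin x)
      (hι.hom_ext (f := φ.comp (cylIn₁ hι)) (g := OAlg.grHom f) fun v => by
        change φ.toLin ((cylIn₁ hι).toLin _) = _
        rw [cylIn₁_ι, hφ₁])
  have hd : ∀ x, φ.toLin (cylDiff hι A.isDerivation h x) = E.d (φ.toLin x) := by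
    refine hh.hom_map_d hF (fun v => ?_) fun v => ?_
    · rw [cylDiff_fst, hφf, hφ₁, hfd]
    · rw [cylDiff_susp, map_sub, map_sub, hφ₁, hφ₂, hφ₃, hψ']
      abel
  have hp₁ (v : V.carrier) :
      OAlg.lin p (φ.toLin ((cylFst O V).toLin v)) = g.toLin ((cylFst O V).toLin v) := by
    rw [hφ₁, hsq, cylIn₁_ι]
  have hp₃ (v : V.carrier) :
      OAlg.lin p (φ.toLin ((cylSusp O V).toLin v)) = g.toLin ((cylSusp O V).toLin v) := by
    rw [hφ₃]; exact hpe v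
  have hpd' (v : V.carrier) :
      OAlg.lin p (φ.toLin (cylDiff hι A.isDerivation h ((cylSusp O V).toLin v))) =
      g.toLin (cylDiff hι A.isDerivation h ((cylSusp O V).toLin v)) := by
    rw [hd, hpd, hg, hp₃]
  exact ⟨φ, hd, hφf,
    hh.hom_eq hF (φ := (OAlg.grHom p).comp φ) (ψ := g) (C := X.toGrAlg) hp₁ hp₃ hpd'⟩

/-- The inclusion `x ↦ x'` of a cell algebra in its cylinder has the left lifting property with
respect to surjections. -/
theorem IsCylCorrection.hasLiftingProperty (b : CellBasis V F) (hF : IsCellFiltration V F)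
    (hh : IsCylCorrection hι A.isDerivation h F) {E X : OAlg O} (p : E ⟶ X)
    (hp : Function.Surjective (OAlg.lin p)) : HasLiftingProperty hh.in₁ p := by
  refine ⟨fun {f g} sq => ?_⟩
  obtain ⟨φ, hd, hφf, hpφ⟩ := exists_cylHom_lift b hF hh p hp f (OAlg.grHom g)
    (fun x => congrArg (fun φ : A ⟶ X => OAlg.lin φ x) sq.w) (OAlg.Hom.map_d g)
  exact ⟨⟨{ l := OAlg.Hom.mk (A := hh.cyl) φ hd
            fac_left := OAlg.hom_ext hφf
            fac_right := OAlg.hom_ext hpφ }⟩⟩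

open HomotopicalAlgebra in
/-- The inclusion `x ↦ x'` is a trivial cofibration, by the lifting property; the projection is a
left inverse of it, and hence a weak equivalence. -/
theorem IsCylCorrection.isQuasiIso_q (hO : O.HasSurjQuasiIsoModel) (b : CellBasis V F)
    (hF : IsCellFiltration V F) (hh : IsCylCorrection hι A.isDerivation h F) :
    OAlg.IsQuasiIso hh.q := by
  obtain ⟨_, hfib, hwe⟩ := hO
  have h₁ : trivialCofibrations (OAlg O) hh.in₁ := by
    rw [← fibrations_llp]
    intro E X p hp
    exact hh.hasLiftingProperty b hF p ((hfib p).1 ⟨hp⟩)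
  have h₂ : WeakEquivalence hh.in₁ := ⟨h₁.2⟩
  have h₃ : WeakEquivalence hh.q := weakEquivalence_of_precomp_of_fac hh.in₁_q
  exact (hwe _).1 h₃

end Lifting

/-! ### Construction of the correction term -/

/-- If `f` is injective in homology, then a cycle in the kernel of `f` is a boundary. -/
theorem DGMod.mem_range_d_of_injective {R : Type u} [CommRing R] {M N : DGMod R}
    {f : M.carrier →ₗ[R] N.carrier} {hf : ∀ x, f (M.d x) = N.d (f x)}
    (hinj : Function.Injective (DGMod.homologyMap f hf)) {z : M.carrier} (hz : M.d z = 0)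
    (hfz : f z = 0) : ∃ y, M.d y = z := by
  have h : DGMod.homologyMap f hf (Submodule.Quotient.mk ⟨z, hz⟩) = 0 :=
    (Submodule.Quotient.mk_eq_zero _).2 (by
      change f z ∈ LinearMap.range N.d
      rw [hfz]; exact zero_mem _)
  exact (Submodule.Quotient.mk_eq_zero _).1 (hinj (h.trans (map_zero _).symm))

section Correction

variable {R : Type u} [CommRing R] {O : Operad R} {V : GrMod R}
  {F : ℕ → Submodule R V.carrier}

theorem IsCellFiltration.prevStage_mono (hF : IsCellFiltration V F) : Monotone (prevStage F) := by
  intro k l h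
  rcases h.eq_or_lt with rfl | h
  · exact le_rfl
  · exact (hF.prevStage_le k).trans (hF.le_prevStage h)

section

variable {G : GrAlg O} {ι : V.Hom G.toGrMod} {hι : GrAlg.IsFree ι}
  {d : G.carrier →ₗ[R] G.carrier} {hd : G.IsDerivation d}

/-- On the stage of the cylinder generated by `T`, the differential depends only on the values on
`T` of the differential of `G` and the correction term. -/
theorem cylDiff_eqOn {d' : G.carrier →ₗ[R] G.carrier} {hd' : G.IsDerivation d'}
    {h h' : V.Hom (cylAlg O V).toGrMod} {T : Submodule R V.carrier}
    (hdd' : ∀ v ∈ T, d (ι.toLin v) = d' (ι.toLin v)) (hhh' : ∀ v ∈ T, h.toLin v = h'.toLin v)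
    {x : (cylAlg O V).carrier} (hx : x ∈ cylStage O V T) :
    cylDiff hι hd h x = cylDiff hι hd' h' x := by
  refine (isDerivation_cylDiff hι hd h).eqOn_adjoin (isDerivation_cylDiff hι hd' h')
    (forall_cylStage (fun v hv => ?_) (fun v hv => ?_) fun v hv => ?_) hx
  · rw [cylDiff_fst, cylDiff_fst, hdd' v hv]
  · rw [cylDiff_snd, cylDiff_snd, hdd' v hv]
  · rw [cylDiff_susp, cylDiff_susp, hhh' v hv]

/-- Cycles of the cylinder that die in `G` are boundaries of elements that die in `G`. -/
theorem IsCylCorrection.exists_primitive (hO : O.HasSurjQuasiIsoModel) (b : CellBasis V F)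
    (hF : IsCellFiltration V F) {h : V.Hom (cylAlg O V).toGrMod} (hh : IsCylCorrection hι hd h F)
    (hdd : ∀ x, d (d x) = 0) {p : ℤ} {z : (cylAlg O V).carrier} (hzp : z ∈ (cylAlg O V).gr p)
    (hz : cylDiff hι hd h z = 0) (hqz : (cylProj ι).toLin z = 0) :
    ∃ y ∈ (cylAlg O V).gr (p + 1), cylDiff hι hd h y = z ∧ (cylProj ι).toLin y = 0 := by
  have hh' : IsCylCorrection (G := (G.withDerivation d hd hdd).toGrAlg) hι
    (G.withDerivation d hd hdd).isDerivation h F := hh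
  obtain ⟨y, hy⟩ : ∃ y, cylDiff hι hd h y = z :=
    DGMod.mem_range_d_of_injective (M := hh'.cyl.toDGMod)
      (N := (G.withDerivation d hd hdd).toDGMod) (hh'.isQuasiIso_q hO b hF).1 hz hqz
  -- subtract the image of `q y` under the section `x ↦ x'`, and take the part in degree `p + 1`
  set y₁ := y - (cylIn₁ hι).toLin ((cylProj ι).toLin y) with hy₁
  have hdy₁ : cylDiff hι hd h y₁ = z := by
    rw [hy₁, map_sub, hy, ← cylIn₁_d, ← hh.proj_d, hy, hqz, map_zero, sub_zero]
  have hqy₁ : (cylProj ι).toLin y₁ = 0 := by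
    rw [hy₁, map_sub, cylProj_in₁, sub_self]
  refine ⟨(cylAlg O V).proj (p + 1) y₁, GrMod.proj_mem _ _ _, ?_, ?_⟩
  · rw [GrMod.map_proj (M := (cylAlg O V).toGrMod) (N := (cylAlg O V).toGrMod) _ (-1)
      (isDerivation_cylDiff hι hd h).mem, hdy₁, add_neg_cancel_right, GrMod.proj_of_mem _ hzp]
  · rw [GrMod.map_proj (M := (cylAlg O V).toGrMod) (N := G.toGrMod) _ 0
      (fun p x hx => by rw [add_zero]; exact (cylProj ι).map_mem p x hx), hqy₁, map_zero]

end

variable {A : OAlg O} {ι : V.Hom A.toGrMod}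

theorem exists_truncDiff (hι : GrAlg.IsFree (B := A.toGrAlg) ι) (b : CellBasis V F) (n : ℕ) :
    ∃ δ : A.carrier →ₗ[R] A.carrier, A.IsDerivation δ ∧
      ∀ v, δ (ι.toLin v) = A.d (ι.toLin ((b.trunc n).toLin v)) :=
  hι.exists_derivation (A.d ∘ₗ ι.toLin ∘ₗ (b.trunc n).toLin) fun p v hv =>
    A.d_mem _ _ (ι.map_mem _ _ ((b.trunc n).map_mem p v hv))

/-- The differential of `O(V)` which agrees with the given one on the basis elements of level less
than `n`, and which vanishes on the remaining ones. -/
noncomputable def truncDiff (hι : GrAlg.IsFree (B := A.toGrAlg) ι) (b : CellBasis V F) (n : ℕ) :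
    A.carrier →ₗ[R] A.carrier :=
  (exists_truncDiff hι b n).choose

variable (hι : GrAlg.IsFree (B := A.toGrAlg) ι) (b : CellBasis V F)

theorem isDerivation_truncDiff (n : ℕ) : A.IsDerivation (truncDiff hι b n) :=
  (exists_truncDiff hι b n).choose_spec.1

theorem truncDiff_ι (n : ℕ) (v : V.carrier) :
    truncDiff hι b n (ι.toLin v) = A.d (ι.toLin ((b.trunc n).toLin v)) :=
  (exists_truncDiff hι b n).choose_spec.2 v

theorem truncDiff_of_mem {n : ℕ} {x : A.carrier}
    (hx : x ∈ A.adjoin (ι.toLin '' (prevStage F n))) : truncDiff hι b n x = A.d x := by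
  refine (isDerivation_truncDiff hι b n).eqOn_adjoin A.isDerivation ?_ hx
  rintro _ ⟨v, hv, rfl⟩
  rw [truncDiff_ι, b.trunc_of_mem hv]

theorem d_mem_adjoin_prevStage (hF : IsCellFiltration V F)
    (hA : ∀ k, ∀ v ∈ F k, A.d (ι.toLin v) ∈ A.adjoin (ι.toLin '' (prevStage F k))) {n : ℕ}
    {v : V.carrier} (hv : v ∈ prevStage F n) :
    A.d (ι.toLin v) ∈ A.adjoin (ι.toLin '' (prevStage F n)) := by
  cases n with
  | zero =>
    rw [(Submodule.mem_bot R).1 hv, map_zero, map_zero]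
    exact zero_mem _
  | succ n => exact A.adjoin_mono (Set.image_mono (hF.prevStage_le n)) (hA n v hv)

theorem truncDiff_truncDiff (hF : IsCellFiltration V F)
    (hA : ∀ k, ∀ v ∈ F k, A.d (ι.toLin v) ∈ A.adjoin (ι.toLin '' (prevStage F k))) (n : ℕ)
    (x : A.carrier) : truncDiff hι b n (truncDiff hι b n x) = 0 := by
  refine (isDerivation_truncDiff hι b n).sq_eq_zero (S := Set.range ι.toLin) ?_
    (hι.adjoin_eq_top ▸ Submodule.mem_top)
  rintro _ ⟨v, rfl⟩
  rw [truncDiff_ι, truncDiff_of_mem hι b (d_mem_adjoin_prevStage hF hA (b.trunc_mem n v)), A.d_d]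

variable (O) in
/-- The retraction of the cylinder onto a stage which kills the generators of level at least `n`. -/
noncomputable def cylTrunc (b : CellBasis V F) (n : ℕ) : GrAlg.Hom (cylAlg O V) (cylAlg O V) :=
  cylLift ((cylFst O V).comp (b.trunc n)) ((cylSnd O V).comp (b.trunc n))
    { toLin := (cylSusp O V).toLin ∘ₗ (b.trunc n).toLin
      map_mem := fun p v hv => (cylSusp O V).map_mem p _ ((b.trunc n).map_mem _ v hv) }

variable (n : ℕ)

theorem cylTrunc_fst (v : V.carrier) : (cylTrunc O b n).toLin ((cylFst O V).toLin v) =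
    (cylFst O V).toLin ((b.trunc n).toLin v) := cylLift_fst _ _ _ v

theorem cylTrunc_snd (v : V.carrier) : (cylTrunc O b n).toLin ((cylSnd O V).toLin v) =
    (cylSnd O V).toLin ((b.trunc n).toLin v) := cylLift_snd _ _ _ v

theorem cylTrunc_susp (v : V.carrier) : (cylTrunc O b n).toLin ((cylSusp O V).toLin v) =
    (cylSusp O V).toLin ((b.trunc n).toLin v) := cylLift_susp _ _ _ v

theorem cylTrunc_mem (x : (cylAlg O V).carrier) :
    (cylTrunc O b n).toLin x ∈ cylStage O V (prevStage F n) := by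
  refine (cylTrunc O b n).map_mem_adjoin (forall_cylStage ?_ ?_ ?_) (mem_cylStage_top x)
  · intro v _; rw [cylTrunc_fst]; exact cylFst_mem (b.trunc_mem n v)
  · intro v _; rw [cylTrunc_snd]; exact cylSnd_mem (b.trunc_mem n v)
  · intro v _; rw [cylTrunc_susp]; exact cylSusp_mem (b.trunc_mem n v)

theorem cylTrunc_of_mem {x : (cylAlg O V).carrier} (hx : x ∈ cylStage O V (prevStage F n)) :
    (cylTrunc O b n).toLin x = x := by
  refine cylHom_eqOn (ψ := GrAlg.Hom.id _) (fun v hv => ?_) (fun v hv => ?_) (fun v hv => ?_) hx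
  · rw [cylTrunc_fst, b.trunc_of_mem hv]; rfl
  · rw [cylTrunc_snd, b.trunc_of_mem hv]; rfl
  · rw [cylTrunc_susp, b.trunc_of_mem hv]; rfl

theorem cylProj_cylTrunc (hι : GrAlg.IsFree (B := A.toGrAlg) ι)
    {x : (cylAlg O V).carrier} (hx : (cylProj ι).toLin x = 0) :
    (cylProj ι).toLin ((cylTrunc O b n).toLin x) = 0 := by
  let ρ : GrAlg.Hom A.toGrAlg A.toGrAlg := hι.lift (ι.comp (b.trunc n))
  have hρ (v : V.carrier) : ρ.toLin (ι.toLin v) = ι.toLin ((b.trunc n).toLin v) :=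
    hι.lift_apply _ v
  have h : (cylProj ι).toLin ((cylTrunc O b n).toLin x) = ρ.toLin ((cylProj ι).toLin x) := by
    refine cylHom_eqOn (φ := (cylProj ι).comp (cylTrunc O b n)) (ψ := ρ.comp (cylProj ι))
      (fun v _ => ?_) (fun v _ => ?_) (fun v _ => ?_) (mem_cylStage_top x)
    · change (cylProj ι).toLin ((cylTrunc O b n).toLin _) = ρ.toLin ((cylProj ι).toLin _)
      rw [cylTrunc_fst, cylProj, cylLift_fst, cylLift_fst, hρ]
    · change (cylProj ι).toLin ((cylTrunc O b n).toLin _) = ρ.toLin ((cylProj ι).toLin _)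
      rw [cylTrunc_snd, cylProj, cylLift_snd, cylLift_snd, hρ]
    · change (cylProj ι).toLin ((cylTrunc O b n).toLin _) = ρ.toLin ((cylProj ι).toLin _)
      rw [cylTrunc_susp, cylProj, cylLift_susp, cylLift_susp]
      exact (map_zero ρ.toLin).symm
  rw [h, hx, map_zero]

variable {hι b n}

/-- The retraction commutes with the differential of the cylinder of the truncated algebra. -/
theorem cylTrunc_cylDiff (hF : IsCellFiltration V F)
    (hA : ∀ k, ∀ v ∈ F k, A.d (ι.toLin v) ∈ A.adjoin (ι.toLin '' (prevStage F k)))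
    {h : V.Hom (cylAlg O V).toGrMod}
    (hh : IsCylCorrection hι (isDerivation_truncDiff hι b n) h F)
    (hh₀ : ∀ i, n ≤ b.lev i → h.toLin (b.basis i) = 0) (x : (cylAlg O V).carrier) :
    (cylTrunc O b n).toLin (cylDiff hι (isDerivation_truncDiff hι b n) h x) =
      cylDiff hι (isDerivation_truncDiff hι b n) h ((cylTrunc O b n).toLin x) := by
  have hτ (v : V.carrier) : (b.trunc n).toLin ((b.trunc n).toLin v) = (b.trunc n).toLin v :=
    b.trunc_of_mem (b.trunc_mem n v)
  have hm (v : V.carrier) := d_mem_adjoin_prevStage hF hA (b.trunc_mem n v)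
  refine (isDerivation_cylDiff hι _ h).map_eqOn_adjoin (isDerivation_cylDiff hι _ h)
    (cylTrunc O b n) (forall_cylStage ?_ ?_ ?_) (mem_cylStage_top x)
  · intro v _
    rw [cylTrunc_fst, cylDiff_fst, cylDiff_fst, truncDiff_ι, truncDiff_ι, hτ,
      cylTrunc_of_mem b n (cylIn₁_mem hι (hm v))]
  · intro v _
    rw [cylTrunc_snd, cylDiff_snd, cylDiff_snd, truncDiff_ι, truncDiff_ι, hτ,
      cylTrunc_of_mem b n (cylIn₂_mem hι (hm v))]
  · intro v _
    have hhv : (cylTrunc O b n).toLin (h.toLin v) = h.toLin ((b.trunc n).toLin v) := by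
      refine b.lin_ext (f := (cylTrunc O b n).toLin ∘ₗ h.toLin) (g := h.toLin ∘ₗ (b.trunc n).toLin)
        (fun i => ?_) v
      change (cylTrunc O b n).toLin (h.toLin _) = h.toLin ((b.trunc n).toLin _)
      rcases lt_or_ge (b.lev i) n with hi | hi
      · rw [b.trunc_basis_of_lt hi]
        exact cylTrunc_of_mem b n (cylStage_mono (hF.prevStage_mono hi.le)
          (hh.mem_stage _ _ (b.basis_mem_stage le_rfl)))
      · rw [b.trunc_basis_of_le hi, hh₀ i hi, map_zero, map_zero]
    rw [cylTrunc_susp, cylDiff_susp, cylDiff_susp, map_sub, map_sub, cylTrunc_fst, cylTrunc_snd,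
      hhv]

/-- A basis element `x` of level `n` has a correction term in the preceding stage of the cylinder:
`x ↦ dx' - dx''` has values in the cycles of the cylinder of the truncated algebra that die
in `A`. -/
theorem exists_correction_basis (hO : O.HasSurjQuasiIsoModel) (hF : IsCellFiltration V F)
    (hA : ∀ k, ∀ v ∈ F k, A.d (ι.toLin v) ∈ A.adjoin (ι.toLin '' (prevStage F k)))
    {h : V.Hom (cylAlg O V).toGrMod}
    (hh : IsCylCorrection hι (isDerivation_truncDiff hι b n) h F)
    (hh₀ : ∀ i, n ≤ b.lev i → h.toLin (b.basis i) = 0) (i : b.index) (hi : b.lev i = n) :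
    ∃ y ∈ (cylAlg O V).gr (b.deg i), y ∈ cylStage O V (prevStage F n) ∧
      (cylProj ι).toLin y = 0 ∧ cylDiff hι (isDerivation_truncDiff hι b n) h y =
        (cylIn₁ hι).toLin (A.d (ι.toLin (b.basis i))) -
          (cylIn₂ hι).toLin (A.d (ι.toLin (b.basis i))) := by
  subst hi
  have hw := hA _ _ (b.basis_mem_stage (le_refl (b.lev i)))
  have hwp := A.d_mem _ _ (ι.map_mem _ _ (b.basis_mem i))
  have hdw : truncDiff hι b (b.lev i) (A.d (ι.toLin (b.basis i))) = 0 := by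
    rw [truncDiff_of_mem hι b hw, A.d_d]
  set w := A.d (ι.toLin (b.basis i)) with hw'
  obtain ⟨y, hyp, hdy, hqy⟩ := hh.exists_primitive hO b hF (truncDiff_truncDiff hι b hF hA _)
    (z := (cylIn₁ hι).toLin w - (cylIn₂ hι).toLin w)
    (sub_mem ((cylIn₁ hι).map_mem _ _ hwp) ((cylIn₂ hι).map_mem _ _ hwp))
    (by rw [map_sub, ← cylIn₁_d, ← cylIn₂_d, hdw, map_zero, map_zero, sub_zero])
    (by rw [map_sub, cylProj_in₁, cylProj_in₂, sub_self])
  refine ⟨(cylTrunc O b _).toLin y, ?_, cylTrunc_mem b _ y, cylProj_cylTrunc b _ hι hqy, ?_⟩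
  · rw [sub_add_cancel] at hyp
    exact (cylTrunc O b _).map_mem _ _ hyp
  · rw [← cylTrunc_cylDiff hF hA hh hh₀, hdy,
      cylTrunc_of_mem b _ (sub_mem (cylIn₁_mem hι hw) (cylIn₂_mem hι hw))]

/-- Corrections may be checked one level at a time: it suffices to compare with corrections for the
truncated differentials. -/
theorem isCylCorrection_of_basis (hF : IsCellFiltration V F)
    {d : A.carrier →ₗ[R] A.carrier} (hd : A.IsDerivation d) {h : V.Hom (cylAlg O V).toGrMod}
    (H : ∀ i, h.toLin (b.basis i) ∈ cylStage O V (prevStage F (b.lev i)) ∧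
      (cylProj ι).toLin (h.toLin (b.basis i)) = 0 ∧
      cylDiff hι hd h (h.toLin (b.basis i)) =
        (cylIn₁ hι).toLin (d (ι.toLin (b.basis i))) -
          (cylIn₂ hι).toLin (d (ι.toLin (b.basis i)))) :
    IsCylCorrection hι hd h F where
  mem_stage k _ hv := b.stage_le (T := (cylStage O V (prevStage F k)).comap h.toLin)
    (fun i hi => cylStage_mono (hF.prevStage_mono hi) (H i).1) hv
  proj := b.lin_ext (f := (cylProj ι).toLin ∘ₗ h.toLin) (g := 0) fun i => (H i).2.1
  d_eq := b.lin_ext (f := cylDiff hι hd h ∘ₗ h.toLin)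
    (g := (cylIn₁ hι).toLin ∘ₗ d ∘ₗ ι.toLin - (cylIn₂ hι).toLin ∘ₗ d ∘ₗ ι.toLin)
    fun i => (H i).2.2

/-- One more level: the correction term on the basis elements of level `n` is given by
`exists_correction_basis`, and that on the preceding levels is unchanged. -/
theorem exists_correction_succ (hO : O.HasSurjQuasiIsoModel) (hF : IsCellFiltration V F)
    (hA : ∀ k, ∀ v ∈ F k, A.d (ι.toLin v) ∈ A.adjoin (ι.toLin '' (prevStage F k)))
    {h : V.Hom (cylAlg O V).toGrMod}
    (hh : IsCylCorrection hι (isDerivation_truncDiff hι b n) h F)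
    (hh₀ : ∀ i, n ≤ b.lev i → h.toLin (b.basis i) = 0) :
    ∃ h' : V.Hom (cylAlg O V).toGrMod,
      (IsCylCorrection hι (isDerivation_truncDiff hι b (n + 1)) h' F ∧
        ∀ i, n + 1 ≤ b.lev i → h'.toLin (b.basis i) = 0) ∧
      ∀ i, b.lev i < n → h'.toLin (b.basis i) = h.toLin (b.basis i) := by
  classical
  choose y hyp hym hqy hdy using exists_correction_basis hO hF hA hh hh₀
  let c (i : b.index) : (cylAlg O V).carrier :=
    if hi : b.lev i = n then y i hi else h.toLin (b.basis i)
  have hc₁ (i : b.index) (hi : b.lev i = n) : c i = y i hi := dif_pos hi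
  have hc₂ (i : b.index) (hi : b.lev i ≠ n) : c i = h.toLin (b.basis i) := dif_neg hi
  let h' : V.Hom (cylAlg O V).toGrMod :=
    { toLin := b.constr c
      map_mem := fun p v hv => by
        have := b.constr_mem (N := (cylAlg O V).toGrMod) (f := c) (c := 0) (fun i => ?_) hv
        · rwa [add_zero] at this
        · rw [add_zero]
          by_cases hi : b.lev i = n
          · rw [hc₁ i hi]; exact hyp i hi
          · rw [hc₂ i hi]; exact h.map_mem _ _ (b.basis_mem i) }
  have hh' (i : b.index) : h'.toLin (b.basis i) = c i := b.constr_basis c i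
  have hlt (i : b.index) (hi : b.lev i < n) : h'.toLin (b.basis i) = h.toLin (b.basis i) := by
    rw [hh', hc₂ i hi.ne]
  -- the two differentials of the cylinder agree on the stage before level `n`
  have hδ {x : (cylAlg O V).carrier} (hx : x ∈ cylStage O V (prevStage F n)) :
      cylDiff hι (isDerivation_truncDiff hι b (n + 1)) h' x =
        cylDiff hι (isDerivation_truncDiff hι b n) h x := by
    refine cylDiff_eqOn (fun v hv => ?_) (fun v hv => ?_) hx
    · rw [truncDiff_ι, truncDiff_ι, b.trunc_of_mem hv,
        b.trunc_of_mem (hF.prevStage_mono n.le_succ hv)]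
    · exact b.prevStage_le (T := LinearMap.eqLocus h'.toLin h.toLin) hlt hv
  refine ⟨h', ⟨isCylCorrection_of_basis (b := b) hF _ fun i => ?_, fun i hi => ?_⟩, hlt⟩
  · have hmi := hh.mem_stage _ _ (b.basis_mem_stage (le_refl (b.lev i)))
    rcases lt_trichotomy (b.lev i) n with hi | hi | hi
    · rw [hlt i hi, hδ (cylStage_mono (hF.prevStage_mono hi.le) hmi), hh.d_eq]
      refine ⟨hmi, hh.proj _, ?_⟩
      rw [truncDiff_ι, truncDiff_ι, b.trunc_basis_of_lt hi,
        b.trunc_basis_of_lt (hi.trans n.lt_succ_self)]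
    · rw [hh', hc₁ i hi, hδ (hym i hi), hdy i hi]
      refine ⟨hi ▸ hym i hi, hqy i hi, ?_⟩
      rw [truncDiff_ι, b.trunc_basis_of_lt (hi ▸ n.lt_succ_self)]
    · rw [hh', hc₂ i hi.ne', hh₀ i hi.le]
      refine ⟨zero_mem _, map_zero _, ?_⟩
      rw [truncDiff_ι, b.trunc_basis_of_le hi]
      simp only [map_zero, sub_zero]
  · rw [hh', hc₂ i (by omega), hh₀ i (by omega)]

variable (hι) in
/-- Every cell algebra has a cylinder: the correction term is constructed level by level. -/
theorem exists_isCylCorrection (hO : O.HasSurjQuasiIsoModel) (hF : IsCellFiltration V F)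
    (hA : ∀ k, ∀ v ∈ F k, A.d (ι.toLin v) ∈ A.adjoin (ι.toLin '' (prevStage F k))) :
    ∃ h : V.Hom (cylAlg O V).toGrMod, IsCylCorrection hι A.isDerivation h F := by
  obtain ⟨b⟩ := hF.nonempty_cellBasis
  let Good (n : ℕ) (h : V.Hom (cylAlg O V).toGrMod) : Prop :=
    IsCylCorrection hι (isDerivation_truncDiff hι b n) h F ∧
      ∀ i, n ≤ b.lev i → h.toLin (b.basis i) = 0
  have hzero : Good 0 (GrMod.Hom.zero _ _) := by
    refine ⟨isCylCorrection_of_basis (b := b) hF _ fun i => ⟨zero_mem _, map_zero _, ?_⟩,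
      fun _ _ => rfl⟩
    rw [truncDiff_ι, b.trunc_basis_of_le (Nat.zero_le _), map_zero, map_zero, map_zero, map_zero,
      sub_zero]
    exact map_zero _
  choose next hnext hnext' using fun (n : ℕ) (h : { h // Good n h }) =>
    exists_correction_succ hO hF hA h.2.1 h.2.2
  let seq (n : ℕ) : { h // Good n h } :=
    Nat.rec ⟨_, hzero⟩ (fun n h => ⟨next n h, hnext n h⟩) n
  -- the values on a basis element do not change after its level
  have hstable (i : b.index) (n : ℕ) (hn : b.lev i + 1 ≤ n) :
      (seq n).1.toLin (b.basis i) = (seq (b.lev i + 1)).1.toLin (b.basis i) := by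
    induction n, hn using Nat.le_induction with
    | base => rfl
    | succ n hn ih => exact (hnext' n (seq n) i hn).trans ih
  let h : V.Hom (cylAlg O V).toGrMod :=
    { toLin := b.constr fun i => (seq (b.lev i + 1)).1.toLin (b.basis i)
      map_mem := fun p v hv => by
        have := b.constr_mem (N := (cylAlg O V).toGrMod) (c := 0)
          (f := fun i => (seq (b.lev i + 1)).1.toLin (b.basis i)) (fun i => by
            rw [add_zero]; exact (seq _).1.map_mem _ _ (b.basis_mem i)) hv
        rwa [add_zero] at this }
  have hh (i : b.index) (n : ℕ) (hn : b.lev i < n) :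
      h.toLin (b.basis i) = (seq n).1.toLin (b.basis i) :=
    (b.constr_basis _ i).trans (hstable i n hn).symm
  refine ⟨h, isCylCorrection_of_basis (b := b) hF _ fun i => ?_⟩
  have hi := Nat.lt_succ_self (b.lev i)
  have hs := (seq (b.lev i + 1)).2.1
  have hm := hs.mem_stage _ _ (b.basis_mem_stage (le_refl (b.lev i)))
  rw [hh i _ hi]
  refine ⟨hm, hs.proj _, ?_⟩
  have hδ := hs.d_eq (b.basis i)
  rw [truncDiff_ι, b.trunc_basis_of_lt hi] at hδ
  rw [← hδ]
  refine cylDiff_eqOn (T := prevStage F (b.lev i + 1)) (fun v hv => ?_) (fun v hv => ?_)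
    (cylStage_mono (hF.prevStage_mono hi.le) hm)
  · rw [truncDiff_ι, b.trunc_of_mem hv]
  · exact b.prevStage_le (T := LinearMap.eqLocus h.toLin (seq (b.lev i + 1)).1.toLin)
      (fun l hl => hh l _ hl) hv

end Correction

/-! ### Coproducts of two copies of a free algebra -/

section Coproduct

variable {R : Type u} [CommRing R] {O : Operad R} {V : GrMod R} {A : OAlg O}
  {ι : V.Hom A.toGrMod}

/-- The free graded algebra on `V ⊕ V` carries a differential for which the two inclusions of
`A = (O(V), d)` are chain maps. -/
theorem exists_oAlg_prod (hι : GrAlg.IsFree (B := A.toGrAlg) ι) :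
    ∃ (D : OAlg O) (κ : (V.prod V).Hom D.toGrMod) (j₁ j₂ : A ⟶ D),
      GrAlg.IsFree (B := D.toGrAlg) κ ∧ (∀ v, OAlg.lin j₁ (ι.toLin v) = κ.toLin (v, 0)) ∧
        ∀ v, OAlg.lin j₂ (ι.toLin v) = κ.toLin (0, v) := by
  let κ : (V.prod V).Hom (O.freeAlg (V.prod V)).toGrMod := O.freeι (V.prod V)
  have hκ : GrAlg.IsFree κ := O.isFree_freeι (V.prod V)
  let j₁ : GrAlg.Hom A.toGrAlg (O.freeAlg (V.prod V)) := hι.lift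
    { toLin := κ.toLin ∘ₗ LinearMap.inl R _ _
      map_mem := fun p _ hv => κ.map_mem p _ ⟨hv, zero_mem _⟩ }
  let j₂ : GrAlg.Hom A.toGrAlg (O.freeAlg (V.prod V)) := hι.lift
    { toLin := κ.toLin ∘ₗ LinearMap.inr R _ _
      map_mem := fun p _ hv => κ.map_mem p _ ⟨zero_mem _, hv⟩ }
  have hj₁ (v : V.carrier) : j₁.toLin (ι.toLin v) = κ.toLin (v, 0) := hι.lift_apply _ v
  have hj₂ (v : V.carrier) : j₂.toLin (ι.toLin v) = κ.toLin (0, v) := hι.lift_apply _ v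
  obtain ⟨δ, hδ, hδκ⟩ := hκ.exists_derivation
    ((j₁.toLin ∘ₗ A.d ∘ₗ ι.toLin).coprod (j₂.toLin ∘ₗ A.d ∘ₗ ι.toLin)) fun p v hv =>
      add_mem (j₁.map_mem _ _ (A.d_mem _ _ (ι.map_mem _ _ hv.1)))
        (j₂.map_mem _ _ (A.d_mem _ _ (ι.map_mem _ _ hv.2)))
  have hδκ' (v w : V.carrier) : δ (κ.toLin (v, w)) =
      j₁.toLin (A.d (ι.toLin v)) + j₂.toLin (A.d (ι.toLin w)) := hδκ (v, w)
  have hd₁ (x : A.carrier) : j₁.toLin (A.d x) = δ (j₁.toLin x) := by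
    refine A.isDerivation.map_eqOn_adjoin hδ j₁ (S := Set.range ι.toLin) ?_
      (hι.adjoin_eq_top ▸ Submodule.mem_top)
    rintro _ ⟨v, rfl⟩
    rw [hj₁, hδκ', map_zero, map_zero, map_zero, add_zero]
  have hd₂ (x : A.carrier) : j₂.toLin (A.d x) = δ (j₂.toLin x) := by
    refine A.isDerivation.map_eqOn_adjoin hδ j₂ (S := Set.range ι.toLin) ?_
      (hι.adjoin_eq_top ▸ Submodule.mem_top)
    rintro _ ⟨v, rfl⟩
    rw [hj₂, hδκ', map_zero, map_zero, map_zero, zero_add]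
  have hδδ (x : (O.freeAlg (V.prod V)).carrier) : δ (δ x) = 0 := by
    refine hδ.sq_eq_zero (S := Set.range κ.toLin) ?_ (hκ.adjoin_eq_top ▸ Submodule.mem_top)
    rintro _ ⟨⟨v, w⟩, rfl⟩
    rw [hδκ', map_add, ← hd₁, ← hd₂, A.d_d, A.d_d, map_zero, map_zero, add_zero]
  let D : OAlg O := (O.freeAlg (V.prod V)).withDerivation δ hδ hδδ
  exact ⟨D, κ, OAlg.Hom.mk (B := D) j₁ hd₁, OAlg.Hom.mk (B := D) j₂ hd₂, hκ, hj₁, hj₂⟩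

/-- The coproduct of two copies of `A` is generated by the two copies of `V`, as it is a retract of
the algebra of `exists_oAlg_prod`. -/
theorem adjoin_coprod_eq_top (hι : GrAlg.IsFree (B := A.toGrAlg) ι) {AA : OAlg O}
    {inl inr : A ⟶ AA} (hAA : IsColimit (BinaryCofan.mk inl inr)) :
    AA.adjoin (Set.range (fun v => OAlg.lin inl (ι.toLin v)) ∪
      Set.range fun v => OAlg.lin inr (ι.toLin v)) = ⊤ := by
  obtain ⟨D, κ, j₁, j₂, hκ, hj₁, hj₂⟩ := exists_oAlg_prod hι
  let τ : GrAlg.Hom D.toGrAlg AA.toGrAlg := hκ.lift (C := AA.toGrAlg)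
    (((OAlg.grHom inl).toGrModHom.comp ι).coprod ((OAlg.grHom inr).toGrModHom.comp ι))
  have hτ (v w : V.carrier) : τ.toLin (κ.toLin (v, w)) =
      OAlg.lin inl (ι.toLin v) + OAlg.lin inr (ι.toLin w) :=
    hκ.lift_apply (C := AA.toGrAlg) _ (v, w)
  have hτ₁ (x : A.carrier) : τ.toLin (OAlg.lin j₁ x) = OAlg.lin inl x :=
    congrArg (fun φ : GrAlg.Hom A.toGrAlg AA.toGrAlg => φ.toLin x)
      (hι.hom_ext (f := τ.comp (OAlg.grHom j₁)) (g := OAlg.grHom inl) fun v => by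
        change τ.toLin (OAlg.lin j₁ _) = _
        rw [hj₁, hτ, map_zero, map_zero, add_zero])
  have hτ₂ (x : A.carrier) : τ.toLin (OAlg.lin j₂ x) = OAlg.lin inr x :=
    congrArg (fun φ : GrAlg.Hom A.toGrAlg AA.toGrAlg => φ.toLin x)
      (hι.hom_ext (f := τ.comp (OAlg.grHom j₂)) (g := OAlg.grHom inr) fun v => by
        change τ.toLin (OAlg.lin j₂ _) = _
        rw [hj₂, hτ, map_zero, map_zero, zero_add])
  have hτd (x : D.carrier) : τ.toLin (D.d x) = AA.d (τ.toLin x) := by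
    refine D.isDerivation.map_eqOn_adjoin AA.isDerivation τ (S := Set.range κ.toLin) ?_
      (hκ.adjoin_eq_top ▸ Submodule.mem_top)
    rintro _ ⟨⟨v, w⟩, rfl⟩
    have e : κ.toLin (v, w) = OAlg.lin j₁ (ι.toLin v) + OAlg.lin j₂ (ι.toLin w) := by
      rw [hj₁, hj₂, ← map_add, Prod.mk_add_mk, add_zero, zero_add]
    rw [e, map_add, map_add, map_add, ← OAlg.Hom.map_d j₁, ← OAlg.Hom.map_d j₂, hτ₁, hτ₂, hτ₁,
      hτ₂, map_add, OAlg.Hom.map_d inl, OAlg.Hom.map_d inr]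
  let t : D ⟶ AA := OAlg.Hom.mk τ hτd
  let s : AA ⟶ D := hAA.desc (BinaryCofan.mk j₁ j₂)
  have hs : s ≫ t = 𝟙 AA := by
    refine BinaryCofan.IsColimit.hom_ext hAA ?_ ?_
    · have h : inl ≫ s = j₁ := hAA.fac (BinaryCofan.mk j₁ j₂) ⟨WalkingPair.left⟩
      change inl ≫ s ≫ t = inl ≫ 𝟙 AA
      rw [← Category.assoc, h, Category.comp_id]
      exact OAlg.hom_ext hτ₁
    · have h : inr ≫ s = j₂ := hAA.fac (BinaryCofan.mk j₁ j₂) ⟨WalkingPair.right⟩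
      change inr ≫ s ≫ t = inr ≫ 𝟙 AA
      rw [← Category.assoc, h, Category.comp_id]
      exact OAlg.hom_ext hτ₂
  refine eq_top_iff.2 fun x _ => ?_
  have hx : τ.toLin (OAlg.lin s x) = x := congrArg (fun φ : AA ⟶ AA => OAlg.lin φ x) hs
  rw [← hx]
  refine τ.map_mem_adjoin (S := Set.range κ.toLin) ?_ (hκ.adjoin_eq_top ▸ Submodule.mem_top)
  rintro _ ⟨⟨v, w⟩, rfl⟩
  rw [hτ]
  exact add_mem (GrAlg.subset_adjoin _ _ (Or.inl ⟨v, rfl⟩))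
    (GrAlg.subset_adjoin _ _ (Or.inr ⟨w, rfl⟩))

end Coproduct

/-! ### The factorisation of the fold map -/

section Factorisation

variable {R : Type u} [CommRing R] {O : Operad R} {V : GrMod R}
  {F : ℕ → Submodule R V.carrier}

theorem GrMod.map_s (T : Submodule R V.carrier) :
    (T.map V.s.toLinearMap : Submodule R V.susp.carrier) = T :=
  Submodule.map_id T

theorem prevStage_susp (k : ℕ) :
    prevStage (V := V.susp) (fun k => (F k).map V.s.toLinearMap) k = prevStage F k := by
  cases k with
  | zero => rfl
  | succ k => exact GrMod.map_s _

theorem IsCellFiltration.susp (hF : IsCellFiltration V F) :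
    IsCellFiltration V.susp fun k => (F k).map V.s.toLinearMap := by
  have e : (fun k => ((F k).map V.s.toLinearMap : Submodule R V.susp.carrier)) = F :=
    funext fun k => GrMod.map_s (F k)
  rw [e]
  exact
    { graded := fun k => (hF.graded k).trans
        ((Equiv.subRight (1 : ℤ)).iSup_comp (g := fun p => F k ⊓ V.gr p)).symm
      mono := hF.mono
      exhaustive := hF.exhaustive
      free := fun k p => by
        have := hF.free k (p - 1)
        cases k <;> exact this }

variable {A : OAlg O} {ι : V.Hom A.toGrMod} {hι : GrAlg.IsFree (B := A.toGrAlg) ι}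
  {h : V.Hom (cylAlg O V).toGrMod}

/-- As the coproduct is generated by the images of `x'` and `x''`, a morphism out of the cylinder
extends a given one on the coproduct if it does so on these. -/
theorem IsCylCorrection.isFreeExtension (hh : IsCylCorrection hι A.isDerivation h F) {AA : OAlg O}
    {inl inr : A ⟶ AA} (hAA : IsColimit (BinaryCofan.mk inl inr)) {i : AA ⟶ hh.cyl}
    (h₁ : inl ≫ i = hh.in₁) (h₂ : inr ≫ i = hh.in₂) :
    GrAlg.IsFreeExtension (OAlg.grHom i) (cylSusp O V) := by
  have hi₁ (v : V.carrier) : OAlg.lin i (OAlg.lin inl (ι.toLin v)) = (cylFst O V).toLin v :=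
    (congrArg (fun φ : A ⟶ hh.cyl => OAlg.lin φ (ι.toLin v)) h₁).trans (cylIn₁_ι hι v)
  have hi₂ (v : V.carrier) : OAlg.lin i (OAlg.lin inr (ι.toLin v)) = (cylSnd O V).toLin v :=
    (congrArg (fun φ : A ⟶ hh.cyl => OAlg.lin φ (ι.toLin v)) h₂).trans (cylIn₂_ι hι v)
  intro C f g
  let φ : GrAlg.Hom (cylAlg O V) C := cylLift
    (f.toGrModHom.comp ((OAlg.grHom inl).toGrModHom.comp ι))
    (f.toGrModHom.comp ((OAlg.grHom inr).toGrModHom.comp ι)) g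
  have hφ₁ (v : V.carrier) :
      φ.toLin ((cylFst O V).toLin v) = f.toLin (OAlg.lin inl (ι.toLin v)) := cylLift_fst _ _ _ v
  have hφ₂ (v : V.carrier) :
      φ.toLin ((cylSnd O V).toLin v) = f.toLin (OAlg.lin inr (ι.toLin v)) := cylLift_snd _ _ _ v
  have hφ₃ (v : V.carrier) : φ.toLin ((cylSusp O V).toLin v) = g.toLin v := cylLift_susp _ _ _ v
  refine ⟨φ, ⟨fun x => ?_, hφ₃⟩, ?_⟩
  · refine GrAlg.Hom.eqOn_adjoin (A := AA.toGrAlg) (f := φ.comp (OAlg.grHom i)) (g := f) ?_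
      (adjoin_coprod_eq_top hι hAA ▸ Submodule.mem_top)
    rintro _ (⟨v, rfl⟩ | ⟨v, rfl⟩)
    · exact (congrArg φ.toLin (hi₁ v)).trans (hφ₁ v)
    · exact (congrArg φ.toLin (hi₂ v)).trans (hφ₂ v)
  · rintro ψ ⟨hψ, hψ₃⟩
    refine GrAlg.Hom.ext' fun x => cylHom_eqOn (fun v _ => ?_) (fun v _ => ?_) (fun v _ => ?_)
      (mem_cylStage_top x)
    · rw [hφ₁, ← hψ]; exact congrArg ψ.toLin (hi₁ v).symm
    · rw [hφ₂, ← hψ]; exact congrArg ψ.toLin (hi₂ v).symm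
    · rw [hφ₃]; exact hψ₃ v

theorem IsCylCorrection.isCellExtension (hF : IsCellFiltration V F)
    (hh : IsCylCorrection hι A.isDerivation h F) {AA : OAlg O} {inl inr : A ⟶ AA}
    (hAA : IsColimit (BinaryCofan.mk inl inr)) {i : AA ⟶ hh.cyl}
    (h₁ : inl ≫ i = hh.in₁) (h₂ : inr ≫ i = hh.in₂) :
    OAlg.IsCellExtension i V.susp (fun k => (F k).map V.s.toLinearMap) (cylSusp O V) where
  isCellFiltration := hF.susp
  isFreeExtension := hh.isFreeExtension hAA h₁ h₂
  d_mem k v hv := by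
    rw [GrMod.map_s] at hv
    have hi₁ (v : V.carrier) : (cylFst O V).toLin v ∈ Set.range (OAlg.lin i) :=
      ⟨OAlg.lin inl (ι.toLin v),
        (congrArg (fun φ : A ⟶ hh.cyl => OAlg.lin φ (ι.toLin v)) h₁).trans (cylIn₁_ι hι v)⟩
    have hi₂ (v : V.carrier) : (cylSnd O V).toLin v ∈ Set.range (OAlg.lin i) :=
      ⟨OAlg.lin inr (ι.toLin v),
        (congrArg (fun φ : A ⟶ hh.cyl => OAlg.lin φ (ι.toLin v)) h₂).trans (cylIn₂_ι hι v)⟩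
    rw [prevStage_susp]
    change cylDiff hι A.isDerivation h ((cylSusp O V).toLin v) ∈ (cylAlg O V).adjoin _
    rw [cylDiff_susp]
    refine sub_mem (sub_mem ?_ ?_) ?_
    · exact GrAlg.subset_adjoin _ _ (Or.inl (hi₁ v))
    · exact GrAlg.subset_adjoin _ _ (Or.inl (hi₂ v))
    · exact GrAlg.adjoin_mono _ (forall_cylStage (fun w _ => Or.inl (hi₁ w))
        (fun w _ => Or.inl (hi₂ w)) fun w hw => Or.inr ⟨w, hw, rfl⟩) (hh.mem_stage k v hv)

end Factorisation

theorem mainTheorem6 {R : Type u} [CommRing R] (O : Operad R) (hO : O.HasSurjQuasiIsoModel)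
    (A : OAlg O) (V : GrMod R) (F : ℕ → Submodule R V.carrier) (ι : V.Hom A.toGrMod)
    (hA : A.IsCellAlgebra V F ι)
    (AA : OAlg O) (inl inr : A ⟶ AA) (hAA : IsColimit (BinaryCofan.mk inl inr)) :
    ∃ (IA : OAlg O) (i : AA ⟶ IA) (q : IA ⟶ A) (σ : V.susp.Hom IA.toGrMod)
      (ι' ι'' : V.Hom IA.toGrMod),
      -- `x'` and `x''` are the images of `x` under the two inclusions of `A`
      ι' = (OAlg.grHom (inl ≫ i)).toGrModHom.comp ι ∧
      ι'' = (OAlg.grHom (inr ≫ i)).toGrModHom.comp ι ∧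
      -- `A ∨ A → IA → A` is a factorisation of the fold map
      i ≫ q = hAA.desc (BinaryCofan.mk (𝟙 A) (𝟙 A)) ∧
      -- into a cell extension, with generators `sV` and filtration `(sV)(k) = s(V(k))`,
      OAlg.IsCellExtension i V.susp (fun k => (F k).map V.s.toLinearMap) σ ∧
      -- followed by a surjective quasi-isomorphism
      Function.Surjective (OAlg.lin q) ∧
      OAlg.IsQuasiIso q ∧
      -- `IA = (O(V' ⊕ V'' ⊕ sV), d)`
      GrAlg.IsFree (B := IA.toGrAlg) ((ι'.coprod ι'').coprod σ) ∧
      -- `d(sx) - x' + x'' ∈ O(V'(k-1) ⊕ V''(k-1) ⊕ sV(k-1))` for `x ∈ V(k)`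
      ∀ (k : ℕ), ∀ x ∈ F k,
        IA.d (σ.toLin (V.s x)) - ι'.toLin x + ι''.toLin x ∈
          IA.adjoin (((ι'.coprod ι'').coprod σ).toLin ''
            (((prevStage F k).prod (prevStage F k)).prod
              ((prevStage F k).map V.s.toLinearMap))) := by
  have hF := hA.isCellFiltration
  obtain ⟨h, hh⟩ := exists_isCylCorrection hA.isFree hO hF hA.d_mem
  obtain ⟨b⟩ := hF.nonempty_cellBasis
  let i : AA ⟶ hh.cyl := hAA.desc (BinaryCofan.mk hh.in₁ hh.in₂)
  have h₁ : inl ≫ i = hh.in₁ := hAA.fac (BinaryCofan.mk hh.in₁ hh.in₂) ⟨WalkingPair.left⟩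
  have h₂ : inr ≫ i = hh.in₂ := hAA.fac (BinaryCofan.mk hh.in₁ hh.in₂) ⟨WalkingPair.right⟩
  refine ⟨hh.cyl, i, hh.q, cylSusp O V, cylFst O V, cylSnd O V, ?_, ?_, ?_,
    hh.isCellExtension hF hAA h₁ h₂, fun x => ⟨_, cylProj_in₁ hA.isFree x⟩,
    hh.isQuasiIso_q hO b hF, ?_, fun k x hx => ?_⟩
  · rw [h₁]
    exact GrMod.Hom.ext' fun v => (cylIn₁_ι hA.isFree v).symm
  · rw [h₂]
    exact GrMod.Hom.ext' fun v => (cylIn₂_ι hA.isFree v).symm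
  · refine BinaryCofan.IsColimit.hom_ext hAA ?_ ?_
    · refine Eq.trans ?_ (hAA.fac (BinaryCofan.mk (𝟙 A) (𝟙 A)) ⟨WalkingPair.left⟩).symm
      change inl ≫ i ≫ hh.q = 𝟙 A
      rw [← Category.assoc, h₁, hh.in₁_q]
    · refine Eq.trans ?_ (hAA.fac (BinaryCofan.mk (𝟙 A) (𝟙 A)) ⟨WalkingPair.right⟩).symm
      change inr ≫ i ≫ hh.q = 𝟙 A
      rw [← Category.assoc, h₂, hh.in₂_q]
  · have hfree := O.isFree_freeι (cylGen V)
    rw [freeι_cylGen] at hfree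
    exact hfree
  · rw [GrMod.map_s]
    change cylDiff hA.isFree A.isDerivation h ((cylSusp O V).toLin x) - (cylFst O V).toLin x +
      (cylSnd O V).toLin x ∈ (cylAlg O V).adjoin _
    have e : cylDiff hA.isFree A.isDerivation h ((cylSusp O V).toLin x) - (cylFst O V).toLin x +
        (cylSnd O V).toLin x = -h.toLin x := by
      rw [cylDiff_susp]; abel
    rw [e]
    have hm := neg_mem (hh.mem_stage k x hx)
    rw [cylStage_eq] at hm
    exact hm
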